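/- Notation: $\operatorname{sech}=1/\cosh$, $\langle F,G\rangle=\int_{\mathbb R}FG\,dx$, and $$H(x)=\tanh\tfrac{x}{\sqrt2},\qquad Y_1(x)=2^{-3/4}3^{1/2}\tanh\tfrac{x}{\sqrt2}\,\operatorname{sech}\tfrac{x}{\sqrt2},\qquad \mathcal L=-\partial_x^2-1+3H^2,\qquad \mu=\sqrt{3/2},$$ $$f=\tfrac32\big(HY_1^2-\langle HY_1^2,Y_1\rangle Y_1\big),\qquad k(x)=e^{2ix}\Big(1+\tfrac12\operatorname{sech}^2\tfrac{x}{\sqrt2}+i\sqrt2\tanh\tfrac{x}{\sqrt2}\Big).$$ Let $\lambda=8$ and $$\psi(x)=\lambda\sqrt2\tanh\tfrac{x}{\lambda\sqrt2},\qquad \zeta(x)=\sqrt{\psi'(x)}=\operatorname{sech}\tfrac{x}{\lambda\sqrt2},\qquad Z_1(x)=Y_1(x)\cosh\tfrac{x}{\lambda\sqrt2},$$ $$V=-\tfrac12\Big(\frac{\zeta''}{\zeta}-\frac{(\zeta')^2}{\zeta^2}\Big)+3\frac{\psi}{\psi'}HH',\qquad \mathcal B^\sharp(w)=\int_{\mathbb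 R}\big(w_x^2-Vw^2\big)\,dx .$$ **Lemma.** One has $\langle\psi' f,\operatorname{Im}k\rangle\neq0$. Set $$a=-\frac{\langle\psi f'+\frac12\psi' f,\operatorname{Im}k\rangle}{\langle\psi' f,\operatorname{Im}k\rangle}.$$ Then the equation $$\mathcal L g-4\mu^2 g=\psi f'+\big(a+\tfrac12\big)\psi' f\qquad\text{on }\mathbb R$$ has exactly one real-valued Schwartz solution $g$. With this $g$, for $w\in H^1(\mathbb R)$ real-valued and $\alpha\in\mathbb R$, let $$\mathcal D^\sharp(w,\alpha)=\mathcal B^\sharp(w)-\alpha\int_{\mathbb R}\frac{w}{\zeta}\Big(\psi f'+\tfrac12\psi' f-\mathcal L g+4\mu^2 g\Big)dx+\alpha^2\int_{\mathbb R}fg\,dx ,$$ which by the equation for $g$ is equal to $\mathcal B^\sharp(w)+\alpha a\int_{\mathbb R} w\zeta f\,dx+\alpha^2\langle f,g\rangle$. There exists $\kappa>0$ such that for every odd function $w\in H^1(\mathbb R)$ with $\langle w,Z_1\rangle=0$ and every $\alpha\in\mathbb R$, $$\mathcal D^\sharp(w,\alpha)\ \ge\ \kappa\Big(\alpha^2+\int_{\mathbb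 R}w_x^2\,dx\Big).$$ -/

import Mathlib

open MeasureTheory
open scoped SchwartzMap ContDiff

namespace Phi4Kink

noncomputable section

/-- The hyperbolic secant. -/
def sech (x : ℝ) : ℝ := 1 / Real.cosh x

/-- The real pairing `⟨F, G⟩ = ∫ F G`. -/
def pair (F G : ℝ → ℝ) : ℝ := ∫ x, F x * G x

/-- The kink `H(x) = tanh (x / √2)`. -/
def H (x : ℝ) : ℝ := Real.tanh (x / √2)

/-- The internal mode `Y₁ = 2^{-3/4} 3^{1/2} tanh (x / √2) sech (x / √2)`. -/
def Y₁ (x : ℝ) : ℝ :=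
  (2 : ℝ) ^ (-(3 / 4) : ℝ) * √3 * Real.tanh (x / √2) * sech (x / √2)

/-- The linearized operator `𝓛 = -∂ₓ² - 1 + 3 H²` around the kink. -/
def L (g : ℝ → ℝ) (x : ℝ) : ℝ := -deriv (deriv g) x - g x + 3 * H x ^ 2 * g x

/-- The frequency `μ = √(3/2)` of the internal mode. -/
def μ : ℝ := √(3 / 2)

/-- `f = (3/2) (H Y₁² - ⟨H Y₁², Y₁⟩ Y₁)`. -/
def f (x : ℝ) : ℝ :=
  3 / 2 * (H x * Y₁ x ^ 2 - pair (fun y => H y * Y₁ y ^ 2) Y₁ * Y₁ x)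

/-- The scale `λ = 8`. -/
def lam : ℝ := 8

/-- The virial weight `ψ(x) = λ √2 tanh (x / (λ √2))`. -/
def ψ (x : ℝ) : ℝ := lam * √2 * Real.tanh (x / (lam * √2))

/-- `ζ = √ψ' = sech (x / (λ √2))`. -/
def ζ (x : ℝ) : ℝ := sech (x / (lam * √2))

/-- `Z₁ = Y₁ cosh (x / (λ √2))`. -/
def Z₁ (x : ℝ) : ℝ := Y₁ x * Real.cosh (x / (lam * √2))

/-- `V = -(1/2) (ζ''/ζ - (ζ')²/ζ²) + 3 (ψ/ψ') H H'`. -/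
def V (x : ℝ) : ℝ :=
  -(1 / 2) * (deriv (deriv ζ) x / ζ x - deriv ζ x ^ 2 / ζ x ^ 2)
    + 3 * (ψ x / deriv ψ x) * H x * deriv H x

/-- The solution `k(x) = e^{2ix} (1 + (1/2) sech² (x/√2) + i √2 tanh (x/√2))` of `𝓛 k = 6 k`. -/
def k (x : ℝ) : ℂ :=
  Complex.exp (Complex.I * 2 * (x : ℂ)) *
    (1 + 1 / 2 * ((sech (x / √2) : ℝ) : ℂ) ^ 2
      + Complex.I * ((√2 : ℝ) : ℂ) * ((Real.tanh (x / √2) : ℝ) : ℂ))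

/-- The imaginary part of `k`. -/
def imk (x : ℝ) : ℝ := (k x).im

/-- `a = -⟨ψ f' + (1/2) ψ' f, Im k⟩ / ⟨ψ' f, Im k⟩`. -/
def a : ℝ :=
  -pair (fun x => ψ x * deriv f x + 1 / 2 * deriv ψ x * f x) imk /
    pair (fun x => deriv ψ x * f x) imk

/-- The equation `𝓛 g - 4 μ² g = ψ f' + (a + 1/2) ψ' f` on the whole line. -/
def SolvesG (g : ℝ → ℝ) : Prop :=
  ∀ x, L g x - 4 * μ ^ 2 * g x = ψ x * deriv f x + (a + 1 / 2) * deriv ψ x * f x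

/-- `w ∈ H¹(ℝ)`, with weak derivative `wx ∈ L²(ℝ)`. -/
structure IsH1 (w wx : ℝ → ℝ) : Prop where
  memLp : MemLp w 2
  memLp_deriv : MemLp wx 2
  weak_deriv : ∀ φ : ℝ → ℝ, ContDiff ℝ ∞ φ → HasCompactSupport φ →
    ∫ x, w x * deriv φ x = -∫ x, wx x * φ x

/-- `𝓑♯(w) = ∫ (w_x² - V w²)`. -/
def Bsharp (w wx : ℝ → ℝ) : ℝ := ∫ x, (wx x ^ 2 - V x * w x ^ 2)

/-- `𝓓♯(w, α) = 𝓑♯(w) - α ∫ w (1/ζ) (ψ f' + (1/2) ψ' f - 𝓛 g + 4 μ² g) + α² ∫ f g`. -/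
def Dsharp (g w wx : ℝ → ℝ) (α : ℝ) : ℝ :=
  Bsharp w wx
    - α * (∫ x, w x * (1 / ζ x) *
        (ψ x * deriv f x + 1 / 2 * deriv ψ x * f x - L g x + 4 * μ ^ 2 * g x))
    + α ^ 2 * (∫ x, f x * g x)

end

end Phi4Kink

/-! Write s = sech(x/√2). Up to the factor 9√2/8 the function f is `fh` = H³s² − (3π/32)Hs, and 𝓛 −
4μ² is −∂² − 4 − 3s². The solutions of the homogeneous equation are spanned by the even function Re
k (`K₁`) and the odd function Im k (`K₂`), both bounded, with Wronskian 6. The source of the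
equation for g is odd, hence orthogonal to Re k, and the definition of a says exactly that it is
orthogonal to Im k. Variation of constants then yields a Schwartz solution (`exists_schwartz_sol`).
Green's formula on a half-line gives |φ(x₀)| ≤ ½ ∫_{x₀}^∞ |R| for a decaying solution φ with source
R (`DecayingSol.abs_le_integral`). This bound gives uniqueness and also controls the error of
approximate solutions.

Coercivity rests on three quantitative facts: 0.67 ≤ a ≤ 0.702 (`a_bounds`); ⟨f,g⟩ ≥ 29/2000 (from
`integral_fh_mul_ghat`); and, for odd w orthogonal to Z₁ and every real γ, ∫(w_x² − 1.02 V w²) + 2γ∫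
wζ·fh + 0.041γ² ≥ 0 (`odd_coercive`). With γ chosen so that the middle term reproduces the cross
term of 𝓓♯, the third fact costs about 0.0131 α² at most, less than ⟨f,g⟩α². The surplus, and the
share 1/51 of ∫ w_x² spared by the factor 1.02, provide κ (`le_Dsharp`).

For the first two facts, the two halves of the source are matched on x ≥ 0 by explicit decaying
functions, rational in E = exp(−√2x/8), with small residual. Their values at 0 give the pairings
with Im k, hence a; their combination approximates g, and piecewise polynomial minorants bound the
integral of the product with f.

For the third fact, w is replaced by its continuous representative W on a half-line, cut at a point
x₁. On each side a positive supersolution θ of −∂² − 1.02V gives a Jacobi (completed-square)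
identity for functions vanishing at x₁. Subtracting τu, with τ = W(x₁) and u(x₁) = 1, makes W vanish
there. The corrector u nearly solves −u'' − 1.02Vu = σZ, so that the orthogonality condition removes
the main cross term. A quadratic form in (|τ|, |γ|) remains (`half_line_ge`, `half_line_coercive`).

Every pointwise estimate becomes the nonnegativity of an integer polynomial on a rational interval,
decided by a Bernstein test. The number π enters affinely, through 3π/32 alone, so it suffices to
test at two rational bounds. -/

namespace Phi4Kink

/-! ### Integer polynomials as coefficient lists, and a positivity test on intervals -/

/-- The value at `x` of the polynomial with coefficient list `p` (constant term first). -/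
noncomputable def ev : List ℤ → ℝ → ℝ
  | [], _ => 0
  | c :: p, x => c + x * ev p x

/-- Sum of coefficient lists. -/
def padd : List ℤ → List ℤ → List ℤ
  | [], q => q
  | p, [] => p
  | a :: p, b :: q => Int.add a b :: padd p q

/-- Scalar multiple of a coefficient list. -/
def psmul (c : ℤ) : List ℤ → List ℤ
  | [] => []
  | a :: p => Int.mul c a :: psmul c p

/-- Product of coefficient lists. -/
def pmul : List ℤ → List ℤ → List ℤ
  | [], _ => []
  | a :: p, q => padd (psmul a q) (0 :: pmul p q)

/-- Power of a coefficient list. -/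
def ppow (p : List ℤ) : ℕ → List ℤ
  | 0 => [1]
  | n + 1 => pmul p (ppow p n)

/-- Derivative of a coefficient list. -/
def pder : List ℤ → List ℤ
  | [] => []
  | _ :: p => padd p (0 :: pder p)

/-- The Euler operator `x d/dx` on coefficient lists. -/
def pD (p : List ℤ) : List ℤ := 0 :: pder p

/-- The monomial `x ^ n`. -/
def pX : ℕ → List ℤ
  | 0 => [1]
  | n + 1 => 0 :: pX n

/-- `y b + (a + b s) p(s)` shifted: the coefficients of `(a + b s) p(s)` when `y = 0`. -/
def plin (a b : ℤ) : ℤ → List ℤ → List ℤ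
  | y, [] => [Int.mul b y]
  | y, x :: p => Int.add (Int.mul a x) (Int.mul b y) :: plin a b x p

/-- `p + c q`. -/
def paxpy (c : ℤ) : List ℤ → List ℤ → List ℤ
  | [], q => psmul c q
  | p, [] => p
  | x :: p, y :: q => Int.add x (Int.mul c y) :: paxpy c p q

/-- Numerator of `p ((a + b s) / (d (1 + s)))` as a polynomial in `s`, paired with the power of
`d (1 + s)` used. -/
def bern (a b d : ℤ) : List ℤ → List ℤ × List ℤ
  | [] => ([], [1])
  | c :: p =>
    match bern a b d p with
    | (acc, dp) => (paxpy c (plin a b 0 acc) dp, plin d d 0 dp)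

/-- Nonnegativity of all entries. -/
def allNonneg : List ℤ → Bool
  | [] => true
  | c :: p => decide (0 ≤ c) && allNonneg p

/-- Application of `f` to an evaluated natural number. -/
def withNat (n : ℕ) (f : ℕ → Bool) : Bool :=
  match n with
  | 0 => f 0
  | m + 1 => f (Nat.succ m)

/-- Homogenized evaluation of a coefficient list after applying `t` to its entries. -/
def hval (t : ℤ → ℕ) (A D : ℕ) : List ℤ → ℕ
  | [] => 0
  | c :: p => Nat.add (Nat.mul A (hval t A D p)) (Nat.mul (t c) (Nat.pow D p.length))

/-- Whether all digits of `N` in base `M` are at most `B`. -/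
def digitsLE (B M : ℕ) : ℕ → ℕ → Bool
  | 0, N => Nat.beq N 0
  | k + 1, N => Nat.ble (Nat.mod N M) B && withNat (Nat.div N M) (digitsLE B M k)

/-- Negative part of an integer. -/
def negNat (c : ℤ) : ℕ := Int.toNat (Int.neg c)

/-- Bernstein test for `0 ≤ p` on `[a / d, b / d]`, by Kronecker substitution: the coefficients of
`(bern a b d p).1` are read off as digits of its value at a large integer. -/
def bernTest (p : List ℤ) (a b d : ℕ) : Bool :=
  withNat (hval Int.natAbs (Nat.add a b) (Nat.mul 2 d) p) fun B =>
    withNat (Nat.add (Nat.mul 2 B) 1) fun M =>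
      withNat (Nat.add a (Nat.mul b M)) fun A =>
        withNat (Nat.mul d (Nat.add 1 M)) fun D =>
          withNat (hval Int.toNat A D p) fun P =>
            withNat (hval negNat A D p) fun N =>
              Nat.ble N P && digitsLE B M p.length (Nat.sub P N)

/-- Bernstein test, with bisection, for `0 ≤ p` on `[a / d, b / d]`. -/
def nonnegOnNat (p : List ℤ) : ℕ → ℕ → ℕ → ℕ → Bool
  | 0, a, b, d => bernTest p a b d
  | n + 1, a, b, d =>
    bernTest p a b d ||
      (nonnegOnNat p n (Nat.mul 2 a) (Nat.add a b) (Nat.mul 2 d) &&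
        nonnegOnNat p n (Nat.add a b) (Nat.mul 2 b) (Nat.mul 2 d))

/-- Bernstein test, with bisection, for `0 ≤ p` on `[a / d, b / d]` with `a`, `b`, `d` natural. -/
def nonnegOn (p : List ℤ) (n : ℕ) (a b d : ℤ) : Bool :=
  decide (0 ≤ a) && nonnegOnNat p n a.toNat b.toNat d.toNat

/-! ### Evaluation of coefficient lists and the Bernstein criterion. -/

@[simp] theorem ev_nil (x : ℝ) : ev [] x = 0 := rfl

@[simp] theorem ev_cons (c : ℤ) (p : List ℤ) (x : ℝ) : ev (c :: p) x = c + x * ev p x := rfl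

theorem iadd (a b : ℤ) : Int.add a b = a + b := rfl

theorem imul (a b : ℤ) : Int.mul a b = a * b := rfl

@[simp] theorem ev_padd (p q : List ℤ) (x : ℝ) : ev (padd p q) x = ev p x + ev q x := by
  induction p generalizing q with
  | nil => simp [padd]
  | cons a p ih =>
    cases q with
    | nil => simp [padd]
    | cons b q => simp only [padd, ev_cons, ih, iadd]; push_cast; ring

@[simp] theorem ev_psmul (c : ℤ) (p : List ℤ) (x : ℝ) : ev (psmul c p) x = c * ev p x := by
  induction p with
  | nil => simp [psmul]
  | cons a p ih => simp only [psmul, ev_cons, ih, imul]; push_cast; ring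

@[simp] theorem ev_pmul (p q : List ℤ) (x : ℝ) : ev (pmul p q) x = ev p x * ev q x := by
  induction p with
  | nil => simp [pmul]
  | cons a p ih => simp only [pmul, ev_padd, ev_psmul, ev_cons, ih]; push_cast; ring

@[simp] theorem ev_ppow (p : List ℤ) (n : ℕ) (x : ℝ) : ev (ppow p n) x = ev p x ^ n := by
  induction n with
  | zero => simp [ppow]
  | succ n ih => simp only [ppow, ev_pmul, ih]; ring

@[simp] theorem ev_pX (n : ℕ) (x : ℝ) : ev (pX n) x = x ^ n := by
  induction n with
  | zero => simp [pX]
  | succ n ih => simp only [pX, ev_cons, ih]; push_cast; ring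

theorem hasDerivAt_ev (p : List ℤ) (x : ℝ) : HasDerivAt (ev p) (ev (pder p) x) x := by
  induction p with
  | nil => exact (hasDerivAt_const x (0 : ℝ)).congr_deriv (by simp [pder])
  | cons a p ih =>
    have h := ((hasDerivAt_id x).mul ih).const_add (a : ℝ)
    refine h.congr_deriv ?_
    simp [pder]

theorem ev_pD (p : List ℤ) (x : ℝ) : ev (pD p) x = x * ev (pder p) x := by simp [pD]

theorem continuous_ev (p : List ℤ) : Continuous (ev p) :=
  continuous_iff_continuousAt.2 fun x => (hasDerivAt_ev p x).continuousAt

theorem ev_plin (a b y : ℤ) (p : List ℤ) (s : ℝ) :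
    ev (plin a b y p) s = b * y + (a + b * s) * ev p s := by
  induction p generalizing y with
  | nil => simp [plin]
  | cons x p ih => simp only [plin, ev_cons, ih, iadd, imul]; push_cast; ring

theorem ev_paxpy (c : ℤ) (p q : List ℤ) (s : ℝ) :
    ev (paxpy c p q) s = ev p s + c * ev q s := by
  induction p generalizing q with
  | nil => simp [paxpy]
  | cons a p ih =>
    cases q with
    | nil => simp [paxpy]
    | cons b q => simp only [paxpy, ev_cons, ih, iadd, imul]; push_cast; ring

/-- Horner's scheme at x = (a + b s)/(d(1 + s)) with denominators cleared. The numerator carries one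
power of d(1 + s) fewer than the second component, whence the extra factor on the left. -/
theorem ev_bern (a b d : ℤ) (p : List ℤ) (s x : ℝ) (h : (a + b * s : ℝ) = d * (1 + s) * x) :
    ev (bern a b d p).1 s * (d * (1 + s)) = ev (bern a b d p).2 s * ev p x ∧
      ev (bern a b d p).2 s = (d * (1 + s)) ^ p.length := by
  induction p with
  | nil => simp [bern]
  | cons c p ih =>
    obtain ⟨h1, h2⟩ := ih
    simp only [bern, ev_paxpy, ev_plin, ev_cons, List.length_cons, pow_succ, ← h2]
    constructor
    · push_cast
      linear_combination (↑a + ↑b * s) * h1 +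
        ev (bern a b d p).2 s * ev p x * h
    · push_cast; ring

theorem ev_nonneg_of_allNonneg {p : List ℤ} (h : allNonneg p = true) {s : ℝ} (hs : 0 ≤ s) :
    0 ≤ ev p s := by
  induction p with
  | nil => simp
  | cons c p ih =>
    simp only [allNonneg, Bool.and_eq_true, decide_eq_true_eq] at h
    have : (0 : ℝ) ≤ c := by exact_mod_cast h.1
    have := ih h.2
    rw [ev_cons]; positivity

/-- The substitution s = (d x − a)/(b − d x) maps [a/d, b/d) onto [0, ∞), where a polynomial with
nonnegative coefficients is nonnegative. The right end point is s = ∞ and is reached by closure. -/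
theorem ev_nonneg_of_bern {p : List ℤ} {a b d : ℤ} (hd : 0 < d) (hab : a < b)
    (h : allNonneg (bern a b d p).1 = true) {x : ℝ} (ha : a ≤ d * x) (hb : d * x ≤ b) :
    0 ≤ ev p x := by
  have hd' : (0 : ℝ) < d := by exact_mod_cast hd
  have hab' : (a : ℝ) < b := by exact_mod_cast hab
  have key : ∀ y ∈ Set.Ico ((a : ℝ) / d) (b / d), 0 ≤ ev p y := by
    rintro y ⟨h1, h2⟩
    rw [div_le_iff₀ hd'] at h1
    rw [lt_div_iff₀ hd'] at h2
    have hby : 0 < (b : ℝ) - d * y := by linarith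
    set s : ℝ := (d * y - a) / (b - d * y) with hs
    have hs0 : 0 ≤ s := div_nonneg (by linarith) hby.le
    have hx : (a + b * s : ℝ) = d * (1 + s) * y := by
      rw [hs]; field_simp; ring
    obtain ⟨e1, e2⟩ := ev_bern a b d p s y hx
    have h3 := ev_nonneg_of_allNonneg h hs0
    have h4 : 0 < ev (bern a b d p).2 s := by rw [e2]; positivity
    have h5 : 0 ≤ ev (bern a b d p).2 s * ev p y := by rw [← e1]; positivity
    exact nonneg_of_mul_nonneg_right h5 h4
  have hsub : Set.Icc ((a : ℝ) / d) (b / d) ⊆ {y | 0 ≤ ev p y} := by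
    rw [← closure_Ico (ne_of_lt (by gcongr : (a : ℝ) / d < b / d))]
    exact closure_minimal key (isClosed_le continuous_const (continuous_ev p))
  exact hsub ⟨by rw [div_le_iff₀ hd']; linarith, by rw [le_div_iff₀ hd']; linarith⟩

/-! ### Soundness of the digit-based form of the Bernstein test. -/

@[simp] theorem withNat_eq (n : ℕ) (f : ℕ → Bool) : withNat n f = f n := by
  cases n <;> rfl

theorem ev_bern_cons (a b d c : ℤ) (p : List ℤ) (s : ℝ) :
    ev (bern a b d (c :: p)).1 s =
      (a + b * s) * ev (bern a b d p).1 s + c * (d * (1 + s)) ^ p.length := by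
  have h2 : ∀ q : List ℤ, ev (bern a b d q).2 s = (d * (1 + s)) ^ q.length := by
    intro q
    induction q with
    | nil => simp [bern]
    | cons c q ih =>
      simp only [bern, ev_plin, List.length_cons, pow_succ, ← ih]
      push_cast; ring
  simp only [bern, ev_paxpy, ev_plin, h2]
  push_cast; ring

theorem toNat_sub_negNat (c : ℤ) : ((c.toNat : ℤ) - negNat c : ℤ) = c := by
  change (c.toNat : ℤ) - ((-c).toNat : ℤ) = c
  omega

/-- Splitting coefficients into positive and negative parts keeps the computation in natural
numbers; the difference is the value of the Bernstein numerator at the single integer s = M. -/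
theorem hval_sub_hval (a b d M : ℕ) (p : List ℤ) :
    ((hval Int.toNat (a + b * M) (d * (1 + M)) p : ℕ) : ℝ) -
      (hval negNat (a + b * M) (d * (1 + M)) p : ℕ) = ev (bern a b d p).1 M := by
  induction p with
  | nil => simp [hval, bern]
  | cons c p ih =>
    rw [ev_bern_cons, ← ih]
    simp only [hval, Nat.add_eq, Nat.mul_eq, Nat.pow_eq]
    have h : ((c.toNat : ℝ) - negNat c) = c := by exact_mod_cast toNat_sub_negNat c
    push_cast
    linear_combination ((d : ℝ) * (1 + M)) ^ p.length * h

/-- Sum of the absolute values of the entries. -/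
def absSum : List ℤ → ℕ
  | [] => 0
  | c :: p => c.natAbs + absSum p

theorem natAbs_le_absSum {p : List ℤ} {c : ℤ} (h : c ∈ p) : c.natAbs ≤ absSum p := by
  induction p with
  | nil => simp at h
  | cons x p ih =>
    rcases List.mem_cons.1 h with rfl | h
    · simp [absSum]
    · have := ih h
      simp only [absSum]; omega

theorem absSum_plin (a b : ℕ) (y : ℤ) (p : List ℤ) :
    absSum (plin a b y p) ≤ b * y.natAbs + (a + b) * absSum p := by
  induction p generalizing y with
  | nil => simp [plin, absSum, Int.natAbs_mul]
  | cons x p ih =>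
    have h := Int.natAbs_add_le ((a : ℤ) * x) (b * y)
    simp only [Int.natAbs_mul, Int.natAbs_natCast] at h
    have h2 := ih x
    simp only [plin, absSum, iadd, imul]
    nlinarith

theorem absSum_psmul (c : ℤ) (p : List ℤ) : absSum (psmul c p) = c.natAbs * absSum p := by
  induction p with
  | nil => simp [psmul, absSum]
  | cons x p ih => simp only [psmul, absSum, imul, ih, Int.natAbs_mul]; ring

theorem absSum_paxpy (c : ℤ) (p q : List ℤ) :
    absSum (paxpy c p q) ≤ absSum p + c.natAbs * absSum q := by
  induction p generalizing q with
  | nil => simp [paxpy, absSum, absSum_psmul]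
  | cons x p ih =>
    cases q with
    | nil => simp [paxpy, absSum]
    | cons y q =>
      have h := Int.natAbs_add_le x (c * y)
      rw [Int.natAbs_mul] at h
      have h2 := ih q
      simp only [paxpy, absSum, iadd, imul]
      nlinarith

/-- Running the recursion with absolute values at s = 1, where a + b s = a + b and d(1 + s) = 2d,
majorizes the sum of the absolute values of the coefficients. This supplies the digit bound B. -/
theorem absSum_bern (a b d : ℕ) (p : List ℤ) :
    absSum (bern a b d p).1 ≤ hval Int.natAbs (a + b) (2 * d) p ∧
      absSum (bern a b d p).2 ≤ (2 * d) ^ p.length := by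
  induction p with
  | nil => simp [bern, absSum, hval]
  | cons c p ih =>
    obtain ⟨h1, h2⟩ := ih
    have e1 := absSum_paxpy c (plin a b 0 (bern a b d p).1) (bern a b d p).2
    have e2 := absSum_plin a b 0 (bern a b d p).1
    have e3 := absSum_plin d d 0 (bern a b d p).2
    have e4 := Nat.mul_le_mul_left (a + b) h1
    have e5 := Nat.mul_le_mul_left c.natAbs h2
    have e6 := Nat.mul_le_mul_left (d + d) h2
    simp only [Int.natAbs_zero, mul_zero, zero_add] at e2 e3
    refine ⟨?_, ?_⟩
    · change absSum (paxpy c (plin a b 0 (bern a b d p).1) (bern a b d p).2) ≤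
        (a + b) * hval Int.natAbs (a + b) (2 * d) p + c.natAbs * (2 * d) ^ p.length
      omega
    · change absSum (plin d d 0 (bern a b d p).2) ≤ (2 * d) ^ (p.length + 1)
      rw [pow_succ, mul_comm, two_mul] at *
      omega

theorem exists_ev_eq_intCast (p : List ℤ) (M : ℕ) : ∃ z : ℤ, ev p M = z := by
  induction p with
  | nil => exact ⟨0, by simp⟩
  | cons c p ih =>
    obtain ⟨z, hz⟩ := ih
    exact ⟨c + M * z, by rw [ev_cons, hz]; push_cast; ring⟩

/-- Entries that are small compared to the base are the digits of the value at the base. -/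
theorem allNonneg_of_digitsLE {q : List ℤ} {B M : ℕ} (hM : M = 2 * B + 1)
    (hq : ∀ c ∈ q, c.natAbs ≤ B) {k N : ℕ} (hN : ev q M = N) (h : digitsLE B M k N = true) :
    allNonneg q = true := by
  induction q generalizing k N with
  | nil => rfl
  | cons c q ih =>
    obtain ⟨z, hz⟩ := exists_ev_eq_intCast q M
    rw [ev_cons, hz] at hN
    have hN' : c + M * z = (N : ℤ) := by exact_mod_cast hN
    have hc := hq c (List.mem_cons_self)
    have hq' : ∀ c ∈ q, c.natAbs ≤ B := fun c hc => hq c (List.mem_cons_of_mem _ hc)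
    have key : N % M ≤ B → 0 ≤ c ∧ z = ((N / M : ℕ) : ℤ) := by
      intro hr
      have h1 : (N : ℤ) = (N % M : ℕ) + M * (N / M : ℕ) := by
        exact_mod_cast (Nat.mod_add_div N M).symm
      have h2 : c - (N % M : ℕ) = M * (((N / M : ℕ) : ℤ) - z) := by linarith
      -- Here c lies in [−B, B] and the remainder in [0, B], so they differ by at most 2B < M = 2B +
      -- 1. Being congruent modulo M, they coincide.
      have h3 : ((N / M : ℕ) : ℤ) - z = 0 := by
        by_contra hne
        have h4 : (M : ℤ) ≤ |c - (N % M : ℕ)| := by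
          rw [h2, abs_mul, Nat.abs_cast]
          exact le_mul_of_one_le_right (by positivity) (Int.one_le_abs hne)
        have h5 : |c - (N % M : ℕ)| ≤ 2 * B := by
          rw [abs_le]; omega
        omega
      rw [h3, mul_zero] at h2
      omega
    have hstep : N % M ≤ B ∧ ∃ k, digitsLE B M k (N / M) = true := by
      cases k with
      | zero =>
        have h0 : N = 0 := Nat.eq_of_beq_eq_true h
        subst h0
        exact ⟨by simp, 0, by simp [digitsLE]⟩
      | succ k =>
        simp only [digitsLE, withNat_eq, Bool.and_eq_true] at h
        exact ⟨Nat.le_of_ble_eq_true h.1, k, h.2⟩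
    obtain ⟨hr, k', hk'⟩ := hstep
    obtain ⟨h0, hz'⟩ := key hr
    have := ih hq' (N := N / M) (k := k') (by rw [hz, hz']; push_cast; rfl) hk'
    simp [allNonneg, h0, this]

theorem allNonneg_of_bernTest {p : List ℤ} {a b d : ℕ} (h : bernTest p a b d = true) :
    allNonneg (bern a b d p).1 = true := by
  simp only [bernTest, withNat_eq, Bool.and_eq_true] at h
  obtain ⟨h1, h2⟩ := h
  have h1 := Nat.le_of_ble_eq_true h1
  refine allNonneg_of_digitsLE (B := hval Int.natAbs (a + b) (2 * d) p) rfl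
    (fun c hc => (natAbs_le_absSum hc).trans (absSum_bern a b d p).1) ?_ h2
  rw [← hval_sub_hval]
  exact (Nat.cast_sub h1).symm

theorem ev_nonneg_of_nonnegOnNat {p : List ℤ} {n a b d : ℕ} (hd : 0 < d) (hab : a < b)
    (h : nonnegOnNat p n a b d = true) {x : ℝ} (ha : a ≤ d * x) (hb : d * x ≤ b) :
    0 ≤ ev p x := by
  have one : ∀ {a b d : ℕ}, 0 < d → a < b → bernTest p a b d = true → (a : ℝ) ≤ d * x →
      d * x ≤ b → 0 ≤ ev p x := fun hd hab h ha hb =>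
    ev_nonneg_of_bern (by exact_mod_cast hd) (by exact_mod_cast hab) (allNonneg_of_bernTest h)
      (by exact_mod_cast ha) (by exact_mod_cast hb)
  induction n generalizing a b d with
  | zero => exact one hd hab h ha hb
  | succ n ih =>
    simp only [nonnegOnNat, Bool.or_eq_true, Bool.and_eq_true, Nat.add_eq, Nat.mul_eq] at h
    rcases h with h | ⟨h1, h2⟩
    · exact one hd hab h ha hb
    · rcases le_total (d * x) ((a + b) / 2) with hx | hx
      · exact ih (by omega) (by omega) h1 (by push_cast; linarith) (by push_cast; linarith)
      · exact ih (by omega) (by omega) h2 (by push_cast; linarith) (by push_cast; linarith)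

theorem ev_nonneg_of_nonnegOn {p : List ℤ} {n : ℕ} {a b d : ℤ} (hd : 0 < d) (hab : a < b)
    (h : nonnegOn p n a b d = true) {x : ℝ} (ha : a ≤ d * x) (hb : d * x ≤ b) :
    0 ≤ ev p x := by
  simp only [nonnegOn, Bool.and_eq_true, decide_eq_true_eq] at h
  obtain ⟨h0, h⟩ := h
  lift a to ℕ using h0
  lift b to ℕ using by omega
  lift d to ℕ using hd.le
  exact ev_nonneg_of_nonnegOnNat (by exact_mod_cast hd) (by exact_mod_cast hab) h
    (by exact_mod_cast ha) (by exact_mod_cast hb)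

/-! ### Polynomials in a decaying exponential -/

theorem hasDerivAt_ev_exp (p : List ℤ) (c x : ℝ) :
    HasDerivAt (fun x => ev p (Real.exp (-(c * x)))) (-c * ev (pD p) (Real.exp (-(c * x)))) x := by
  have h1 : HasDerivAt (fun x : ℝ => Real.exp (-(c * x))) (Real.exp (-(c * x)) * -(c * 1)) x :=
    (((hasDerivAt_id x).const_mul c).neg).exp
  refine ((hasDerivAt_ev p _).comp x h1).congr_deriv ?_
  rw [ev_pD]; ring

theorem continuous_ev_exp (p : List ℤ) (c : ℝ) :
    Continuous fun x => ev p (Real.exp (-(c * x))) :=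
  (continuous_ev p).comp (by fun_prop)

/-- Integral of a polynomial in `exp (-c x)`, given a primitive of `p` for the Euler operator. -/
theorem integral_ev_exp {p P : List ℤ} {N : ℤ} (hN : N ≠ 0) (hP : pD P = psmul N p) {c : ℝ}
    (hc : c ≠ 0) (x y : ℝ) :
    ∫ z in x..y, ev p (Real.exp (-(c * z))) =
      (ev P (Real.exp (-(c * x))) - ev P (Real.exp (-(c * y)))) / (c * N) := by
  have hN' : (N : ℝ) ≠ 0 := by exact_mod_cast hN
  have h : ∀ z ∈ Set.uIcc x y, HasDerivAt (fun z => -(ev P (Real.exp (-(c * z)))) / (c * N))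
      (ev p (Real.exp (-(c * z)))) z := by
    intro z _
    refine ((hasDerivAt_ev_exp P c z).neg.div_const _).congr_deriv ?_
    rw [hP, ev_psmul]; field_simp
  rw [intervalIntegral.integral_eq_sub_of_hasDerivAt h
    ((continuous_ev_exp p c).intervalIntegrable _ _)]
  ring

end Phi4Kink

namespace Phi4Kink

/-! ### Smooth functions through classes closed under differentiation -/

/-- Estimates on all derivatives reduce to an estimate on each member of a class stable under
differentiation: polynomials in tanh, sech times such polynomials, or combinations of cos and sin.
-/
theorem iteratedDeriv_mem_of_closed {S : Set (ℝ → ℝ)} (hS : ∀ f ∈ S, deriv f ∈ S) {f : ℝ → ℝ}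
    (hf : f ∈ S) (n : ℕ) : iteratedDeriv n f ∈ S := by
  induction n with
  | zero => simpa using hf
  | succ n ih => rw [iteratedDeriv_succ]; exact hS _ ih

theorem contDiff_of_closed {S : Set (ℝ → ℝ)} (hd : ∀ f ∈ S, Differentiable ℝ f)
    (hS : ∀ f ∈ S, deriv f ∈ S) {f : ℝ → ℝ} (hf : f ∈ S) : ContDiff ℝ ∞ f :=
  contDiff_of_differentiable_iteratedDeriv fun n _ => hd _ (iteratedDeriv_mem_of_closed hS hf n)

theorem hasTemperateGrowth_of_closed {S : Set (ℝ → ℝ)} (hd : ∀ f ∈ S, Differentiable ℝ f)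
    (hS : ∀ f ∈ S, deriv f ∈ S) (hb : ∀ f ∈ S, ∃ C, ∀ x, |f x| ≤ C) {f : ℝ → ℝ} (hf : f ∈ S) :
    f.HasTemperateGrowth := by
  refine ⟨contDiff_of_closed hd hS hf, fun n => ?_⟩
  obtain ⟨C, hC⟩ := hb _ (iteratedDeriv_mem_of_closed hS hf n)
  refine ⟨0, C, fun x => ?_⟩
  rw [norm_iteratedFDeriv_eq_norm_iteratedDeriv]
  simpa using hC x

theorem exists_schwartz_of_closed {S : Set (ℝ → ℝ)} (hd : ∀ f ∈ S, Differentiable ℝ f)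
    (hS : ∀ f ∈ S, deriv f ∈ S) (hb : ∀ f ∈ S, ∀ k : ℕ, ∃ C, ∀ x, |x| ^ k * |f x| ≤ C)
    {f : ℝ → ℝ} (hf : f ∈ S) : ∃ F : 𝓢(ℝ, ℝ), ⇑F = f := by
  refine ⟨⟨f, contDiff_of_closed hd hS hf, fun k n => ?_⟩, rfl⟩
  obtain ⟨C, hC⟩ := hb _ (iteratedDeriv_mem_of_closed hS hf n) k
  refine ⟨C, fun x => ?_⟩
  rw [norm_iteratedFDeriv_eq_norm_iteratedDeriv]
  exact hC x

/-! ### Hyperbolic functions -/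

theorem sech_pos (x : ℝ) : 0 < sech x := by
  unfold sech; have := Real.cosh_pos x; positivity

theorem tanh_sq_add_sech_sq (x : ℝ) : Real.tanh x ^ 2 + sech x ^ 2 = 1 := by
  have h := Real.cosh_pos x
  have h2 := Real.cosh_sq x
  unfold sech
  rw [Real.tanh_eq_sinh_div_cosh]
  field_simp
  linarith

theorem sech_sq (x : ℝ) : sech x ^ 2 = 1 - Real.tanh x ^ 2 := by
  linarith [tanh_sq_add_sech_sq x]

theorem abs_tanh_le (x : ℝ) : |Real.tanh x| ≤ 1 := by
  rw [abs_le_one_iff_mul_self_le_one]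
  nlinarith [tanh_sq_add_sech_sq x, sq_nonneg (sech x)]

theorem sech_le_exp (x : ℝ) : sech x ≤ 2 * Real.exp (-|x|) := by
  unfold sech
  rw [← Real.cosh_abs, Real.cosh_eq, Real.exp_neg, one_div_div]
  have h1 := Real.exp_pos |x|
  have h2 := Real.exp_pos (-|x|)
  rw [← div_eq_mul_inv]
  gcongr
  rw [← Real.exp_neg]
  linarith

theorem hasDerivAt_tanh_div (c x : ℝ) :
    HasDerivAt (fun x => Real.tanh (x / c)) (sech (x / c) ^ 2 / c) x := by
  have h := Real.cosh_pos (x / c)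
  have e : (fun x => Real.tanh (x / c)) = fun x => Real.sinh (x / c) / Real.cosh (x / c) := by
    funext x; exact Real.tanh_eq_sinh_div_cosh _
  rw [e]
  have h0 : HasDerivAt (fun x : ℝ => x / c) (1 / c) x := (hasDerivAt_id x).div_const c
  have h1 := (h0.sinh).div (h0.cosh) h.ne'
  refine h1.congr_deriv ?_
  have h2 := Real.cosh_sq (x / c)
  unfold sech
  by_cases hc : c = 0
  · subst hc; simp
  · field_simp; linear_combination h2

theorem hasDerivAt_sech_div (c x : ℝ) :
    HasDerivAt (fun x => sech (x / c)) (-(Real.tanh (x / c) * sech (x / c)) / c) x := by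
  have h := Real.cosh_pos (x / c)
  have h0 : HasDerivAt (fun x : ℝ => x / c) (1 / c) x := (hasDerivAt_id x).div_const c
  have h1 := (hasDerivAt_const x (1 : ℝ)).div (h0.cosh) h.ne'
  refine h1.congr_deriv ?_
  rw [Real.tanh_eq_sinh_div_cosh]
  unfold sech
  by_cases hc : c = 0
  · subst hc; simp
  · field_simp; ring

open Polynomial in
theorem abs_eval_tanh_le (P : ℝ[X]) : ∃ C, 0 ≤ C ∧ ∀ x : ℝ, |P.eval (Real.tanh x)| ≤ C := by
  obtain ⟨C, hC⟩ := isCompact_Icc.exists_bound_of_continuousOn (s := Set.Icc (-1 : ℝ) 1)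
    (P.continuous.continuousOn)
  refine ⟨C, (norm_nonneg _).trans (hC 0 (by simp)), fun x => hC _ ?_⟩
  exact abs_le.1 (abs_tanh_le x)

open Polynomial in
theorem hasTemperateGrowth_tanh (c : ℝ) :
    Function.HasTemperateGrowth fun x : ℝ => Real.tanh (x / c) := by
  have hder : ∀ (P : ℝ[X]) (x : ℝ), HasDerivAt (fun x => P.eval (Real.tanh (x / c)))
      ((C (1 / c) * (1 - X ^ 2) * derivative P).eval (Real.tanh (x / c))) x := by
    intro P x
    refine ((P.hasDerivAt _).comp x (hasDerivAt_tanh_div c x)).congr_deriv ?_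
    rw [sech_sq]; simp; ring
  refine hasTemperateGrowth_of_closed
    (S := {f | ∃ P : ℝ[X], f = fun x => P.eval (Real.tanh (x / c))}) ?_ ?_ ?_ ⟨X, by simp⟩
  · rintro f ⟨P, rfl⟩ x
    exact (hder P x).differentiableAt
  · rintro f ⟨P, rfl⟩
    exact ⟨_, funext fun x => (hder P x).deriv⟩
  · rintro f ⟨P, rfl⟩
    obtain ⟨C, -, hC⟩ := abs_eval_tanh_le P
    exact ⟨C, fun x => hC _⟩

theorem pow_mul_sech_le {c : ℝ} (hc : 0 < c) (k : ℕ) :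
    ∃ C, 0 ≤ C ∧ ∀ x, |x| ^ k * sech (x / c) ≤ C := by
  refine ⟨c ^ k * (2 * (k.factorial : ℝ)), by positivity, fun x => ?_⟩
  have h1 := sech_le_exp (x / c)
  have h2 := Real.pow_div_factorial_le_exp |x / c| (abs_nonneg _) k
  rw [div_le_iff₀ (by positivity)] at h2
  have h3 : |x| = c * |x / c| := by
    rw [abs_div, abs_of_pos hc]; field_simp
  calc |x| ^ k * sech (x / c)
      ≤ (c * |x / c|) ^ k * (2 * Real.exp (-|x / c|)) := by rw [← h3]; gcongr
    _ = c ^ k * 2 * (|x / c| ^ k * Real.exp (-|x / c|)) := by ring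
    _ ≤ c ^ k * 2 * (Real.exp |x / c| * k.factorial * Real.exp (-|x / c|)) := by gcongr
    _ = c ^ k * 2 * k.factorial * (Real.exp |x / c| * Real.exp (-|x / c|)) := by ring
    _ = c ^ k * (2 * (k.factorial : ℝ)) := by rw [← Real.exp_add]; simp; ring

open Polynomial in
theorem exists_schwartz_sech {c : ℝ} (hc : 0 < c) :
    ∃ F : 𝓢(ℝ, ℝ), ⇑F = fun x : ℝ => sech (x / c) := by
  have hder : ∀ (P : ℝ[X]) (x : ℝ), HasDerivAt (fun x => sech (x / c) * P.eval (Real.tanh (x / c)))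
      (sech (x / c) * (C (1 / c) * ((1 - X ^ 2) * derivative P - X * P)).eval
        (Real.tanh (x / c))) x := by
    intro P x
    refine ((hasDerivAt_sech_div c x).mul
      ((P.hasDerivAt _).comp x (hasDerivAt_tanh_div c x))).congr_deriv ?_
    rw [sech_sq]; simp; ring
  refine exists_schwartz_of_closed
    (S := {f | ∃ P : ℝ[X], f = fun x => sech (x / c) * P.eval (Real.tanh (x / c))})
    ?_ ?_ ?_ ⟨1, by simp⟩
  · rintro f ⟨P, rfl⟩ x
    exact (hder P x).differentiableAt
  · rintro f ⟨P, rfl⟩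
    exact ⟨_, funext fun x => (hder P x).deriv⟩
  · rintro f ⟨P, rfl⟩ k
    obtain ⟨C, hC0, hC⟩ := abs_eval_tanh_le P
    obtain ⟨C', hC0', hC'⟩ := pow_mul_sech_le hc k
    refine ⟨C' * C, fun x => ?_⟩
    rw [abs_mul, abs_of_pos (sech_pos _), ← mul_assoc]
    exact mul_le_mul (hC' x) (hC _) (abs_nonneg _) hC0'

theorem hasTemperateGrowth_trig (a b c : ℝ) :
    Function.HasTemperateGrowth fun x : ℝ => a * Real.cos (c * x) + b * Real.sin (c * x) := by
  have hder : ∀ (a b x : ℝ), HasDerivAt (fun x => a * Real.cos (c * x) + b * Real.sin (c * x))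
      ((c * b) * Real.cos (c * x) + (-(c * a)) * Real.sin (c * x)) x := by
    intro a b x
    have h0 : HasDerivAt (fun x : ℝ => c * x) c x := by
      simpa using (hasDerivAt_id x).const_mul c
    refine ((h0.cos.const_mul a).add (h0.sin.const_mul b)).congr_deriv ?_
    ring
  refine hasTemperateGrowth_of_closed
    (S := {f | ∃ a b : ℝ, f = fun x => a * Real.cos (c * x) + b * Real.sin (c * x)})
    ?_ ?_ ?_ ⟨a, b, rfl⟩
  · rintro f ⟨a, b, rfl⟩ x
    exact (hder a b x).differentiableAt
  · rintro f ⟨a, b, rfl⟩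
    exact ⟨_, _, funext fun x => (hder a b x).deriv⟩
  · rintro f ⟨a, b, rfl⟩
    refine ⟨|a| + |b|, fun x => (abs_add_le _ _).trans ?_⟩
    rw [abs_mul, abs_mul]
    gcongr
    · exact mul_le_of_le_one_right (abs_nonneg _) (Real.abs_cos_le_one _)
    · exact mul_le_of_le_one_right (abs_nonneg _) (Real.abs_sin_le_one _)

/-! ### A primitive of a Schwartz function of zero mean -/

/-- The tail integral decays at +∞ because h does. Zero mean turns it into minus the integral over
(−∞, x], which gives the same decay at −∞. -/
theorem exists_schwartz_primitive (h : 𝓢(ℝ, ℝ)) (h0 : ∫ x, h x = 0) :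
    ∃ J : 𝓢(ℝ, ℝ), (∀ x, J x = ∫ z in Set.Ioi x, h z) ∧ ∀ x, HasDerivAt J (-h x) x := by
  have hi : Integrable h := h.integrable
  have hsplit : ∀ x, (∫ z in Set.Iic x, h z) + ∫ z in Set.Ioi x, h z = 0 := by
    intro x
    rw [← h0, ← intervalIntegral.integral_Iic_add_Ioi hi.integrableOn hi.integrableOn]
  have hd : ∀ x, HasDerivAt (fun x => ∫ z in Set.Ioi x, h z) (-h x) x := by
    intro x
    have e : (fun x => ∫ z in Set.Ioi x, h z) =
        fun x => (∫ z in Set.Ioi (0 : ℝ), h z) - ∫ z in (0 : ℝ)..x, h z := by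
      funext x
      have h1 := hsplit x
      have h2 := hsplit 0
      have h3 := intervalIntegral.integral_Iic_sub_Iic (a := 0) (b := x)
        hi.integrableOn hi.integrableOn
      linarith
    rw [e]
    have := intervalIntegral.integral_hasDerivAt_right (hi.intervalIntegrable (a := 0) (b := x))
      h.continuous.stronglyMeasurable.stronglyMeasurableAtFilter h.continuous.continuousAt
    simpa using this.const_sub (∫ z in Set.Ioi (0 : ℝ), h z)
  have hdec : ∀ k : ℕ, ∃ C, ∀ x : ℝ, |x| ^ k * |∫ z in Set.Ioi x, h z| ≤ C := by
    intro k
    have hk : Integrable fun z : ℝ => |z| ^ k * |h z| := by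
      simpa using h.integrable_pow_mul volume k
    refine ⟨∫ z, |z| ^ k * |h z|, fun x => ?_⟩
    have gen : ∀ s : Set ℝ, MeasurableSet s → (∀ z ∈ s, |x| ≤ |z|) →
        |x| ^ k * |∫ z in s, h z| ≤ ∫ z, |z| ^ k * |h z| := by
      intro s hs hz
      calc |x| ^ k * |∫ z in s, h z| ≤ |x| ^ k * ∫ z in s, |h z| := by
            gcongr; exact abs_integral_le_integral_abs
        _ = ∫ z in s, |x| ^ k * |h z| := by rw [integral_const_mul]
        _ ≤ ∫ z in s, |z| ^ k * |h z| := by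
            refine setIntegral_mono_on (hi.abs.const_mul _).integrableOn hk.integrableOn hs ?_
            intro z hzs
            have := hz z hzs
            gcongr
        _ ≤ ∫ z, |z| ^ k * |h z| :=
            setIntegral_le_integral hk (Filter.Eventually.of_forall fun z => by positivity)
    rcases le_total 0 x with hx | hx
    · refine gen _ measurableSet_Ioi fun z hz => ?_
      have hz' : x < z := hz
      rw [abs_of_nonneg hx, abs_of_nonneg (hx.trans hz'.le)]; exact hz'.le
    · have e : ∫ z in Set.Ioi x, h z = -∫ z in Set.Iic x, h z := by linarith [hsplit x]
      rw [e, abs_neg]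
      refine gen _ measurableSet_Iic fun z hz => ?_
      have hz' : z ≤ x := hz
      rw [abs_of_nonpos hx, abs_of_nonpos (hz'.trans hx)]; linarith
  have hder : deriv (fun x => ∫ z in Set.Ioi x, h z) = -h := funext fun x => (hd x).deriv
  have hsm : ContDiff ℝ ∞ (fun x => ∫ z in Set.Ioi x, h z) := by
    rw [contDiff_infty_iff_deriv]
    refine ⟨fun x => (hd x).differentiableAt, ?_⟩
    rw [hder]; exact (h.smooth ⊤).neg
  refine ⟨⟨fun x => ∫ z in Set.Ioi x, h z, hsm, fun k n => ?_⟩, fun x => rfl, hd⟩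
  cases n with
  | zero =>
    obtain ⟨C, hC⟩ := hdec k
    exact ⟨C, fun x => by simpa using hC x⟩
  | succ n =>
    obtain ⟨C, -, hC⟩ := (-h).decay k n
    refine ⟨C, fun x => ?_⟩
    have := hC x
    rw [norm_iteratedFDeriv_eq_norm_iteratedDeriv] at this ⊢
    rwa [iteratedDeriv_succ', hder]

end Phi4Kink

namespace Phi4Kink

/-! ### Explicit formulas for the functions of the statement -/

/-- `sech (x / √2)`. -/
noncomputable def sx (x : ℝ) : ℝ := sech (x / √2)

/-- `tanh (x / (λ √2))`. -/
noncomputable def tl (x : ℝ) : ℝ := Real.tanh (x / (lam * √2))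

/-- The constant `3 π / 32`. -/
noncomputable def bc : ℝ := 3 * Real.pi / 32

/-- `f` up to the factor `9 √2 / 8`. -/
noncomputable def fh (x : ℝ) : ℝ := H x ^ 3 * sx x ^ 2 - bc * (H x * sx x)

/-- The derivative of `fh`. -/
noncomputable def fh' (x : ℝ) : ℝ :=
  (3 * H x ^ 2 * sx x ^ 4 - 2 * H x ^ 4 * sx x ^ 2 - bc * (sx x ^ 3 - H x ^ 2 * sx x)) / √2

/-- `ψ' f` up to the factor `9 √2 / 8`. -/
noncomputable def srcD (x : ℝ) : ℝ := ζ x ^ 2 * fh x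

/-- `ψ f' + ψ' f / 2` up to the factor `9 √2 / 8`. -/
noncomputable def srcN (x : ℝ) : ℝ := ψ x * fh' x + 1 / 2 * (ζ x ^ 2 * fh x)

theorem sq2 : (√2 : ℝ) ^ 2 = 2 := Real.sq_sqrt (by norm_num)

theorem sqrt2_pos : (0 : ℝ) < √2 := Real.sqrt_pos.2 (by norm_num)

theorem lam_sqrt2_pos : (0 : ℝ) < lam * √2 := by unfold lam; positivity

theorem sx_sq (x : ℝ) : sx x ^ 2 = 1 - H x ^ 2 := sech_sq _

theorem sx_pos (x : ℝ) : 0 < sx x := sech_pos _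

theorem ζ_sq (x : ℝ) : ζ x ^ 2 = 1 - tl x ^ 2 := sech_sq _

theorem ζ_pos (x : ℝ) : 0 < ζ x := sech_pos _

theorem abs_H_le (x : ℝ) : |H x| ≤ 1 := abs_tanh_le _

theorem hasDerivAt_H (x : ℝ) : HasDerivAt H (sx x ^ 2 / √2) x := hasDerivAt_tanh_div _ x

theorem hasDerivAt_sx (x : ℝ) : HasDerivAt sx (-(H x * sx x) / √2) x := hasDerivAt_sech_div _ x

theorem hasDerivAt_tl (x : ℝ) : HasDerivAt tl (ζ x ^ 2 / (lam * √2)) x := hasDerivAt_tanh_div _ x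

theorem hasDerivAt_ζ (x : ℝ) : HasDerivAt ζ (-(tl x * ζ x) / (lam * √2)) x :=
  hasDerivAt_sech_div _ x

theorem hasDerivAt_ψ (x : ℝ) : HasDerivAt ψ (ζ x ^ 2) x := by
  refine ((hasDerivAt_tl x).const_mul (lam * √2)).congr_deriv ?_
  have := lam_sqrt2_pos.ne'
  rw [mul_div_cancel₀ _ this]

theorem deriv_ψ (x : ℝ) : deriv ψ x = ζ x ^ 2 := (hasDerivAt_ψ x).deriv

theorem ψ_eq (x : ℝ) : ψ x = 8 * √2 * tl x := rfl

theorem V_eq (x : ℝ) : V x = ζ x ^ 2 / 256 + 24 * (tl x / ζ x ^ 2) * (H x * sx x ^ 2) := by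
  have hz := ζ_pos x
  have h1 : deriv ζ = fun x => -(tl x * ζ x) / (lam * √2) := funext fun x => (hasDerivAt_ζ x).deriv
  have h2 : deriv (fun x => -(tl x * ζ x) / (lam * √2)) x =
      -((ζ x ^ 2 / (lam * √2)) * ζ x + tl x * (-(tl x * ζ x) / (lam * √2))) / (lam * √2) :=
    ((((hasDerivAt_tl x).mul (hasDerivAt_ζ x)).neg).div_const _).deriv
  unfold V
  rw [deriv_ψ, (hasDerivAt_H x).deriv, h1, h2, ψ_eq]
  have h3 := sq2
  have h4 := sqrt2_pos
  unfold lam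
  field_simp
  ring_nf
  simp only [h3]
  ring

theorem hasDerivAt_fh (x : ℝ) : HasDerivAt fh (fh' x) x := by
  have h := (((hasDerivAt_H x).pow 3).mul ((hasDerivAt_sx x).pow 2)).sub
    (((hasDerivAt_H x).mul (hasDerivAt_sx x)).const_mul bc)
  refine h.congr_deriv ?_
  have := sqrt2_pos
  simp only [fh', Pi.pow_apply]
  field_simp
  push_cast
  ring

theorem exists_schwartz_sx : ∃ F : 𝓢(ℝ, ℝ), ⇑F = sx := exists_schwartz_sech sqrt2_pos

theorem exists_schwartz_ζ : ∃ F : 𝓢(ℝ, ℝ), ⇑F = ζ := exists_schwartz_sech lam_sqrt2_pos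

theorem hasTemperateGrowth_H : H.HasTemperateGrowth := hasTemperateGrowth_tanh _

theorem hasTemperateGrowth_tl : tl.HasTemperateGrowth := hasTemperateGrowth_tanh _

theorem hasTemperateGrowth_sx : sx.HasTemperateGrowth := by
  obtain ⟨F, hF⟩ := exists_schwartz_sx
  rw [← hF]; exact F.hasTemperateGrowth

theorem hasTemperateGrowth_ζ : ζ.HasTemperateGrowth := by
  obtain ⟨F, hF⟩ := exists_schwartz_ζ
  rw [← hF]; exact F.hasTemperateGrowth

theorem continuous_H : Continuous H := hasTemperateGrowth_H.1.continuous

theorem continuous_sx : Continuous sx := hasTemperateGrowth_sx.1.continuous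

theorem continuous_ζ : Continuous ζ := hasTemperateGrowth_ζ.1.continuous

theorem continuous_tl : Continuous tl := hasTemperateGrowth_tl.1.continuous

/-- A function of temperate growth times a Schwartz function is Schwartz. -/
theorem exists_schwartz_mul {u : ℝ → ℝ} (hu : u.HasTemperateGrowth) (F : 𝓢(ℝ, ℝ)) :
    ∃ G : 𝓢(ℝ, ℝ), ⇑G = fun x => u x * F x :=
  ⟨SchwartzMap.smulLeftCLM ℝ u F, by
    funext x; simp [SchwartzMap.smulLeftCLM_apply_apply hu]⟩

theorem exists_schwartz_fh : ∃ F : 𝓢(ℝ, ℝ), ⇑F = fh := by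
  obtain ⟨S, hS⟩ := exists_schwartz_sx
  have h1 := hasTemperateGrowth_H
  have h2 := hasTemperateGrowth_sx
  obtain ⟨G, hG⟩ := exists_schwartz_mul (u := fun x => H x ^ 3 * sx x - bc * H x)
    (((h1.pow 3).mul h2).sub ((Function.HasTemperateGrowth.const bc).mul h1)) S
  refine ⟨G, ?_⟩
  rw [hG, hS]; funext x; simp only [fh]; ring

theorem exists_schwartz_srcD : ∃ F : 𝓢(ℝ, ℝ), ⇑F = srcD := by
  obtain ⟨F, hF⟩ := exists_schwartz_fh
  obtain ⟨G, hG⟩ := exists_schwartz_mul (hasTemperateGrowth_ζ.pow 2) F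
  exact ⟨G, by rw [hG, hF]; rfl⟩

theorem exists_schwartz_srcN : ∃ F : 𝓢(ℝ, ℝ), ⇑F = srcN := by
  obtain ⟨F, hF⟩ := exists_schwartz_fh
  have hd : ∀ x, SchwartzMap.derivCLM ℝ ℝ F x = fh' x := by
    intro x; rw [SchwartzMap.derivCLM_apply, hF]; exact (hasDerivAt_fh x).deriv
  have hψ : ψ.HasTemperateGrowth :=
    (Function.HasTemperateGrowth.const (8 * √2)).mul hasTemperateGrowth_tl
  obtain ⟨G, hG⟩ := exists_schwartz_mul hψ (SchwartzMap.derivCLM ℝ ℝ F)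
  obtain ⟨G', hG'⟩ := exists_schwartz_srcD
  refine ⟨G + (1 / 2 : ℝ) • G', funext fun x => ?_⟩
  simp [hG, hG', hd, srcN, srcD]

/-- The mean value `⟨H Y₁², Y₁⟩` in closed form. -/
theorem integral_H_pow_four_mul_sx_pow_three :
    ∫ x, H x ^ 4 * sx x ^ 3 = √2 * Real.pi / 16 := by
  have h2 := sq2
  have hp := sqrt2_pos
  -- Reduction of tanh⁴ sech³ = sech³ − 2 sech⁵ + sech⁷. The function arctan ∘ sinh is the only term
  -- with nonzero limits at infinity, and the source of π.
  set F : ℝ → ℝ := fun x => √2 * (1 / 6 * (sx x ^ 5 * H x) - 7 / 24 * (sx x ^ 3 * H x) +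
    1 / 16 * (sx x * H x) + 1 / 16 * Real.arctan (Real.sinh (x / √2))) with hF
  have hder : ∀ x, HasDerivAt F (H x ^ 4 * sx x ^ 3) x := by
    intro x
    have ha : HasDerivAt (fun x => Real.arctan (Real.sinh (x / √2))) (sx x / √2) x := by
      have h0 : HasDerivAt (fun x : ℝ => x / √2) (1 / √2) x := (hasDerivAt_id x).div_const _
      refine (h0.sinh.arctan).congr_deriv ?_
      have hc := Real.cosh_pos (x / √2)
      have e : 1 + Real.sinh (x / √2) ^ 2 = Real.cosh (x / √2) ^ 2 := by rw [Real.cosh_sq]; ring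
      rw [e]; unfold sx sech; field_simp
    have hs := hasDerivAt_sx x
    have hH := hasDerivAt_H x
    have h := ((((((hs.pow 5).mul hH).const_mul (1 / 6)).sub
      (((hs.pow 3).mul hH).const_mul (7 / 24))).add ((hs.mul hH).const_mul (1 / 16))).add
      (ha.const_mul (1 / 16))).const_mul √2
    refine h.congr_deriv ?_
    simp only [Pi.pow_apply]
    have e4 : H x ^ 2 = 1 - sx x ^ 2 := by rw [sx_sq]; ring
    have e5 : H x ^ 4 = (1 - sx x ^ 2) ^ 2 := by rw [← e4]; ring
    rw [e5]
    field_simp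
    push_cast
    ring_nf
    simp only [e4]
    ring
  have hint : Integrable fun x => H x ^ 4 * sx x ^ 3 := by
    obtain ⟨S, hS⟩ := exists_schwartz_sx
    obtain ⟨G, hG⟩ := exists_schwartz_mul ((hasTemperateGrowth_H.pow 4).mul
      (hasTemperateGrowth_sx.pow 2)) S
    refine G.integrable.congr (Filter.Eventually.of_forall fun x => ?_)
    simp only [hG, hS, Pi.mul_apply, Pi.pow_apply]; ring
  have hs0 : ∀ l : Filter ℝ, l ≤ Filter.cocompact ℝ → Filter.Tendsto sx l (nhds 0) := by
    intro l hl
    obtain ⟨S, hS⟩ := exists_schwartz_sx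
    rw [← hS]
    exact (SchwartzMap.tendsto_cocompact S).mono_left hl
  have hlim : ∀ (l : Filter ℝ) (L : ℝ), l ≤ Filter.cocompact ℝ →
      Filter.Tendsto (fun x => Real.arctan (Real.sinh (x / √2))) l (nhds L) →
      Filter.Tendsto F l (nhds (√2 * (1 / 16 * L))) := by
    intro l L hl hL
    have hz : ∀ n : ℕ, n ≠ 0 → Filter.Tendsto (fun x => sx x ^ n * H x) l (nhds 0) := by
      intro n hn
      have h1 : Filter.Tendsto (fun x => sx x ^ n) l (nhds 0) := by
        simpa [hn] using (hs0 l hl).pow n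
      refine squeeze_zero_norm (fun x => ?_) h1
      rw [norm_mul, Real.norm_of_nonneg (pow_nonneg (sx_pos x).le n)]
      exact mul_le_of_le_one_right (pow_nonneg (sx_pos x).le n) (abs_H_le x)
    have h1 := hz 1 one_ne_zero
    simp only [pow_one] at h1
    have := (((((hz 5 (by norm_num)).const_mul (1 / 6)).sub
      ((hz 3 (by norm_num)).const_mul (7 / 24))).add (h1.const_mul (1 / 16))).add
      (hL.const_mul (1 / 16))).const_mul √2
    simpa [hF] using this
  have hdiv : Filter.Tendsto (fun x : ℝ => x / √2) Filter.atTop Filter.atTop :=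
    Filter.tendsto_id.atTop_div_const hp
  have hdivb : Filter.Tendsto (fun x : ℝ => x / √2) Filter.atBot Filter.atBot :=
    Filter.tendsto_id.atBot_div_const hp
  have htop := hlim Filter.atTop (Real.pi / 2) atTop_le_cocompact
    ((Real.tendsto_arctan_atTop.mono_right nhdsWithin_le_nhds).comp
      (Real.sinhOrderIso.tendsto_atTop.comp hdiv))
  have hbot := hlim Filter.atBot (-(Real.pi / 2)) atBot_le_cocompact
    ((Real.tendsto_arctan_atBot.mono_right nhdsWithin_le_nhds).comp
      (Real.sinhOrderIso.tendsto_atBot.comp hdivb))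
  rw [integral_of_hasDerivAt_of_tendsto hder hint hbot htop]
  ring

/-- With Y₁ = A·H·sx one has A² = 3√2/4 and A⁴ = 9/8. The prefactor is then 3A²/2, and the mean
value contributes A²√2π/16 = 3π/32, which is `bc`. -/
theorem f_eq (x : ℝ) : f x = 9 * √2 / 8 * fh x := by
  set A : ℝ := (2 : ℝ) ^ (-(3 / 4) : ℝ) * √3 with hA
  have hY : ∀ x, Y₁ x = A * (H x * sx x) := by
    intro x; simp only [Y₁, H, sx, hA]; ring
  have h3 : (√3 : ℝ) ^ 2 = 3 := Real.sq_sqrt (by norm_num)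
  have hp := sqrt2_pos
  have h2 := sq2
  have hA2 : A ^ 2 = 3 * √2 / 4 := by
    have e : ((2 : ℝ) ^ (-(3 / 4) : ℝ)) ^ 2 = √2 / 4 := by
      rw [← Real.rpow_natCast, ← Real.rpow_mul (by norm_num)]
      have : ((-(3 / 4) : ℝ) * (2 : ℕ)) = 1 / 2 - 2 := by norm_num
      rw [this, Real.rpow_sub (by norm_num), ← Real.sqrt_eq_rpow]
      norm_num
    rw [hA, mul_pow, h3, e]; ring
  have hpair : pair (fun y => H y * Y₁ y ^ 2) Y₁ = A ^ 3 * (√2 * Real.pi / 16) := by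
    rw [← integral_H_pow_four_mul_sx_pow_three, ← integral_const_mul]
    unfold pair
    congr 1; funext x; simp only [hY]; ring
  unfold f
  rw [hpair, hY]
  have hA4 : A ^ 4 = 9 / 8 := by
    rw [show (4:ℕ) = 2 * 2 from rfl, pow_mul, hA2]; linear_combination (9 / 16) * h2
  unfold fh bc
  linear_combination (3 / 2 * H x ^ 3 * sx x ^ 2) * hA2 -
    (3 / 2 * (√2 * Real.pi / 16) * (H x * sx x)) * hA4

theorem deriv_f (x : ℝ) : deriv f x = 9 * √2 / 8 * fh' x := by
  have e : f = fun x => 9 * √2 / 8 * fh x := funext f_eq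
  rw [e]; exact ((hasDerivAt_fh x).const_mul _).deriv

end Phi4Kink

namespace Phi4Kink

/-! ### The solutions `Re k`, `Im k` of the homogeneous equation -/

/-- The real part of `k`. -/
noncomputable def K₁ (x : ℝ) : ℝ :=
  Real.cos (2 * x) * (1 + 1 / 2 * sx x ^ 2) - √2 * H x * Real.sin (2 * x)

/-- The imaginary part of `k`. -/
noncomputable def K₂ (x : ℝ) : ℝ :=
  Real.sin (2 * x) * (1 + 1 / 2 * sx x ^ 2) + √2 * H x * Real.cos (2 * x)

/-- The derivative of `K₁`. -/
noncomputable def K₁' (x : ℝ) : ℝ :=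
  -2 * Real.sin (2 * x) - 2 * sx x ^ 2 * Real.sin (2 * x)
    - √2 / 2 * (H x * sx x ^ 2) * Real.cos (2 * x) - 2 * √2 * H x * Real.cos (2 * x)

/-- The derivative of `K₂`. -/
noncomputable def K₂' (x : ℝ) : ℝ :=
  2 * Real.cos (2 * x) + 2 * sx x ^ 2 * Real.cos (2 * x)
    - √2 / 2 * (H x * sx x ^ 2) * Real.sin (2 * x) - 2 * √2 * H x * Real.sin (2 * x)

theorem imk_eq (x : ℝ) : imk x = K₂ x := by
  unfold imk k K₂
  have e : Complex.exp (Complex.I * 2 * (x : ℂ)) =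
      ((Real.cos (2 * x) : ℝ) : ℂ) + ((Real.sin (2 * x) : ℝ) : ℂ) * Complex.I := by
    rw [show Complex.I * 2 * (x : ℂ) = ((2 * x : ℝ) : ℂ) * Complex.I by push_cast; ring,
      Complex.exp_mul_I, Complex.ofReal_cos, Complex.ofReal_sin]
  have e2 : (1 + 1 / 2 * ((sech (x / √2) : ℝ) : ℂ) ^ 2
      + Complex.I * ((√2 : ℝ) : ℂ) * ((Real.tanh (x / √2) : ℝ) : ℂ)) =
      ((1 + 1 / 2 * sx x ^ 2 : ℝ) : ℂ) + ((√2 * H x : ℝ) : ℂ) * Complex.I := by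
    unfold sx H; push_cast; ring
  rw [e, e2]
  simp only [Complex.mul_im, Complex.add_im, Complex.add_re, Complex.mul_re, Complex.ofReal_re,
    Complex.ofReal_im, Complex.I_re, Complex.I_im]
  ring

theorem hasDerivAt_cos_two (x : ℝ) :
    HasDerivAt (fun x => Real.cos (2 * x)) (-2 * Real.sin (2 * x)) x := by
  have h0 : HasDerivAt (fun x : ℝ => 2 * x) 2 x := by simpa using (hasDerivAt_id x).const_mul 2
  exact h0.cos.congr_deriv (by ring)

theorem hasDerivAt_sin_two (x : ℝ) :
    HasDerivAt (fun x => Real.sin (2 * x)) (2 * Real.cos (2 * x)) x := by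
  have h0 : HasDerivAt (fun x : ℝ => 2 * x) 2 x := by simpa using (hasDerivAt_id x).const_mul 2
  exact h0.sin.congr_deriv (by ring)

theorem inv_sqrt2 : (√2 : ℝ)⁻¹ = √2 / 2 := by
  have := sqrt2_pos
  field_simp
  exact sq2.symm

theorem hasDerivAt_H' (x : ℝ) : HasDerivAt H (√2 / 2 * sx x ^ 2) x :=
  (hasDerivAt_H x).congr_deriv (by rw [div_eq_mul_inv, inv_sqrt2]; ring)

theorem hasDerivAt_sx_sq (x : ℝ) :
    HasDerivAt (fun x => sx x ^ 2) (-√2 * (H x * sx x ^ 2)) x :=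
  ((hasDerivAt_sx x).pow 2).congr_deriv (by rw [div_eq_mul_inv, inv_sqrt2]; push_cast; ring)

theorem hasDerivAt_K₁ (x : ℝ) : HasDerivAt K₁ (K₁' x) x := by
  have h := ((hasDerivAt_cos_two x).mul (((hasDerivAt_sx_sq x).const_mul (1 / 2)).const_add 1)).sub
    (((hasDerivAt_H' x).const_mul √2).mul (hasDerivAt_sin_two x))
  refine h.congr_deriv ?_
  unfold K₁'
  linear_combination (-(1 / 2) * sx x ^ 2 * Real.sin (2 * x)) * sq2

theorem hasDerivAt_K₂ (x : ℝ) : HasDerivAt K₂ (K₂' x) x := by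
  have h := ((hasDerivAt_sin_two x).mul (((hasDerivAt_sx_sq x).const_mul (1 / 2)).const_add 1)).add
    (((hasDerivAt_H' x).const_mul √2).mul (hasDerivAt_cos_two x))
  refine h.congr_deriv ?_
  unfold K₂'
  linear_combination ((1 / 2) * sx x ^ 2 * Real.cos (2 * x)) * sq2

theorem hasDerivAt_K₁' (x : ℝ) : HasDerivAt K₁' (-(4 + 3 * sx x ^ 2) * K₁ x) x := by
  have hs := hasDerivAt_sx_sq x
  have hH := hasDerivAt_H' x
  have hc := hasDerivAt_cos_two x
  have hn := hasDerivAt_sin_two x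
  have h := (((hn.const_mul (-2)).sub ((hs.const_mul 2).mul hn)).sub
    (((hH.mul hs).const_mul (√2 / 2)).mul hc)).sub ((hH.const_mul (2 * √2)).mul hc)
  refine h.congr_deriv ?_
  unfold K₁
  have e : H x ^ 2 = 1 - sx x ^ 2 := by rw [sx_sq]; ring
  have h2 := sq2
  simp only [Pi.mul_apply]
  linear_combination (-1 / 4 * sx x ^ 4 * Real.cos (2 * x) + 1 / 2 * H x ^ 2 * sx x ^ 2 * Real.cos (2 * x) - sx x ^ 2 * Real.cos (2 * x)) * h2 + (sx x ^ 2 * Real.cos (2 * x)) * e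

theorem hasDerivAt_K₂' (x : ℝ) : HasDerivAt K₂' (-(4 + 3 * sx x ^ 2) * K₂ x) x := by
  have hs := hasDerivAt_sx_sq x
  have hH := hasDerivAt_H' x
  have hc := hasDerivAt_cos_two x
  have hn := hasDerivAt_sin_two x
  have h := (((hc.const_mul 2).add ((hs.const_mul 2).mul hc)).sub
    (((hH.mul hs).const_mul (√2 / 2)).mul hn)).sub ((hH.const_mul (2 * √2)).mul hn)
  refine h.congr_deriv ?_
  unfold K₂
  have e : H x ^ 2 = 1 - sx x ^ 2 := by rw [sx_sq]; ring
  have h2 := sq2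
  simp only [Pi.mul_apply]
  linear_combination (-1 / 4 * sx x ^ 4 * Real.sin (2 * x) + 1 / 2 * H x ^ 2 * sx x ^ 2 * Real.sin (2 * x) - sx x ^ 2 * Real.sin (2 * x)) * h2 + (sx x ^ 2 * Real.sin (2 * x)) * e

theorem wronskian (x : ℝ) : K₁ x * K₂' x - K₂ x * K₁' x = 6 := by
  have e : H x ^ 2 = 1 - sx x ^ 2 := by rw [sx_sq]; ring
  have h2 := sq2
  have h3 := Real.sin_sq_add_cos_sq (2 * x)
  unfold K₁ K₂ K₁' K₂'
  set S := sx x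
  set h := H x
  set c := Real.cos (2 * x)
  set s := Real.sin (2 * x)
  have e1 : (c * (1 + 1 / 2 * S ^ 2) - √2 * h * s) *
      (2 * c + 2 * S ^ 2 * c - √2 / 2 * (h * S ^ 2) * s - 2 * √2 * h * s) -
      (s * (1 + 1 / 2 * S ^ 2) + √2 * h * c) *
      (-2 * s - 2 * S ^ 2 * s - √2 / 2 * (h * S ^ 2) * c - 2 * √2 * h * c) =
      (s ^ 2 + c ^ 2) * ((1 + 1 / 2 * S ^ 2) * (2 + 2 * S ^ 2) +
        √2 ^ 2 * h ^ 2 * (1 / 2 * S ^ 2 + 2)) := by ring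
  rw [e1, h3, h2, e]
  ring

/-- The modulus |k|², in which the oscillating factor drops out. -/
theorem K_sq_add_sq (x : ℝ) : K₁ x ^ 2 + K₂ x ^ 2 = 3 - sx x ^ 2 + 1 / 4 * sx x ^ 4 := by
  have e : H x ^ 2 = 1 - sx x ^ 2 := by rw [sx_sq]; ring
  have h2 := sq2
  have h3 := Real.sin_sq_add_cos_sq (2 * x)
  have e1 : K₁ x ^ 2 + K₂ x ^ 2 = (Real.sin (2 * x) ^ 2 + Real.cos (2 * x) ^ 2) *
      ((1 + 1 / 2 * sx x ^ 2) ^ 2 + √2 ^ 2 * H x ^ 2) := by unfold K₁ K₂; ring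
  rw [e1, h3, h2, e]; ring

theorem sx_sq_le_one (x : ℝ) : sx x ^ 2 ≤ 1 := by rw [sx_sq]; nlinarith [sq_nonneg (H x)]

theorem K_sq_add_sq_le (x : ℝ) : K₁ x ^ 2 + K₂ x ^ 2 ≤ 3 := by
  rw [K_sq_add_sq]
  nlinarith [sx_sq_le_one x, sq_nonneg (sx x)]

theorem hasTemperateGrowth_K₁ : K₁.HasTemperateGrowth := by
  have hc : Function.HasTemperateGrowth fun x : ℝ => Real.cos (2 * x) := by
    simpa using hasTemperateGrowth_trig 1 0 2
  have hs : Function.HasTemperateGrowth fun x : ℝ => Real.sin (2 * x) := by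
    simpa using hasTemperateGrowth_trig 0 1 2
  exact (hc.mul ((Function.HasTemperateGrowth.const 1).add
    ((Function.HasTemperateGrowth.const (1 / 2)).mul (hasTemperateGrowth_sx.pow 2)))).sub
    (((Function.HasTemperateGrowth.const √2).mul hasTemperateGrowth_H).mul hs)

theorem hasTemperateGrowth_K₂ : K₂.HasTemperateGrowth := by
  have hc : Function.HasTemperateGrowth fun x : ℝ => Real.cos (2 * x) := by
    simpa using hasTemperateGrowth_trig 1 0 2
  have hs : Function.HasTemperateGrowth fun x : ℝ => Real.sin (2 * x) := by
    simpa using hasTemperateGrowth_trig 0 1 2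
  exact (hs.mul ((Function.HasTemperateGrowth.const 1).add
    ((Function.HasTemperateGrowth.const (1 / 2)).mul (hasTemperateGrowth_sx.pow 2)))).add
    (((Function.HasTemperateGrowth.const √2).mul hasTemperateGrowth_H).mul hc)

theorem continuous_K₁ : Continuous K₁ := hasTemperateGrowth_K₁.1.continuous

theorem continuous_K₂ : Continuous K₂ := hasTemperateGrowth_K₂.1.continuous

/-- Only boundedness is needed, to discard boundary terms at infinity; the constant 10 enters no
estimate. -/
theorem abs_K₁'_le (x : ℝ) : |K₁' x| ≤ 10 := by
  have hs := sx_sq_le_one x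
  have h0 := sq_nonneg (sx x)
  have hH := abs_le.1 (abs_H_le x)
  have h2 : √2 ≤ 2 := by rw [Real.sqrt_le_left (by norm_num)]; norm_num
  have h2' := sqrt2_pos
  have hcs := abs_le.1 (Real.abs_cos_le_one (2 * x))
  have hsn := abs_le.1 (Real.abs_sin_le_one (2 * x))
  have key : ∀ {A B C D : ℝ}, |A| ≤ 2 → |B| ≤ 2 → |C| ≤ 1 → |D| ≤ 4 → |A - B - C - D| ≤ 10 := by
    intro A B C D hA hB hC hD
    rw [abs_le] at *
    constructor <;> linarith [hA.1, hA.2, hB.1, hB.2, hC.1, hC.2, hD.1, hD.2]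
  have hc1 := Real.abs_cos_le_one (2 * x)
  have hs1 := Real.abs_sin_le_one (2 * x)
  have hH1 := abs_H_le x
  apply key
  · rw [abs_mul]; norm_num; linarith
  · rw [abs_mul, abs_mul, abs_of_nonneg h0]; norm_num
    nlinarith [abs_nonneg (Real.sin (2 * x))]
  · rw [abs_mul, abs_mul, abs_mul, abs_of_nonneg h0, abs_of_nonneg (by positivity : 0 ≤ √2 / 2)]
    have : |H x| * sx x ^ 2 ≤ 1 := by nlinarith [abs_nonneg (H x)]
    have h5 : 0 ≤ |H x| * sx x ^ 2 := by positivity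
    have : √2 / 2 * (|H x| * sx x ^ 2) ≤ 1 := by nlinarith
    have h6 : 0 ≤ √2 / 2 * (|H x| * sx x ^ 2) := by positivity
    nlinarith [abs_nonneg (Real.cos (2 * x))]
  · rw [abs_mul, abs_mul, abs_of_nonneg (by positivity : 0 ≤ 2 * √2)]
    have : 2 * √2 * |H x| ≤ 4 := by nlinarith [abs_nonneg (H x)]
    have h6 : 0 ≤ 2 * √2 * |H x| := by positivity
    nlinarith [abs_nonneg (Real.cos (2 * x))]

theorem abs_K₂'_le (x : ℝ) : |K₂' x| ≤ 10 := by
  have hs := sx_sq_le_one x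
  have h0 := sq_nonneg (sx x)
  have h2 : √2 ≤ 2 := by rw [Real.sqrt_le_left (by norm_num)]; norm_num
  have h2' := sqrt2_pos
  have key : ∀ {A B C D : ℝ}, |A| ≤ 2 → |B| ≤ 2 → |C| ≤ 1 → |D| ≤ 4 → |A + B - C - D| ≤ 10 := by
    intro A B C D hA hB hC hD
    rw [abs_le] at *
    constructor <;> linarith [hA.1, hA.2, hB.1, hB.2, hC.1, hC.2, hD.1, hD.2]
  have hc1 := Real.abs_cos_le_one (2 * x)
  have hs1 := Real.abs_sin_le_one (2 * x)
  have hH1 := abs_H_le x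
  apply key
  · rw [abs_mul]; norm_num; linarith
  · rw [abs_mul, abs_mul, abs_of_nonneg h0]; norm_num
    nlinarith [abs_nonneg (Real.cos (2 * x))]
  · rw [abs_mul, abs_mul, abs_mul, abs_of_nonneg h0, abs_of_nonneg (by positivity : 0 ≤ √2 / 2)]
    have : |H x| * sx x ^ 2 ≤ 1 := by nlinarith [abs_nonneg (H x)]
    have h5 : 0 ≤ |H x| * sx x ^ 2 := by positivity
    have : √2 / 2 * (|H x| * sx x ^ 2) ≤ 1 := by nlinarith
    have h6 : 0 ≤ √2 / 2 * (|H x| * sx x ^ 2) := by positivity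
    nlinarith [abs_nonneg (Real.sin (2 * x))]
  · rw [abs_mul, abs_mul, abs_of_nonneg (by positivity : 0 ≤ 2 * √2)]
    have : 2 * √2 * |H x| ≤ 4 := by nlinarith [abs_nonneg (H x)]
    have h6 : 0 ≤ 2 * √2 * |H x| := by positivity
    nlinarith [abs_nonneg (Real.sin (2 * x))]

end Phi4Kink

namespace Phi4Kink

open Filter Topology

/-! ### Green's formula on a half-line -/

/-- A decaying solution of `-φ'' - (4 + 3 sech²) φ = R` on `(x₀, ∞)`, with its derivatives. -/
structure DecayingSol (φ φ' R : ℝ → ℝ) (x₀ : ℝ) : Prop where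
  deriv₁ : ∀ x, x₀ ≤ x → HasDerivAt φ (φ' x) x
  deriv₂ : ∀ x, x₀ ≤ x → HasDerivAt φ' (-(4 + 3 * sx x ^ 2) * φ x - R x) x
  tendsto : Tendsto φ atTop (𝓝 0)
  tendsto' : Tendsto φ' atTop (𝓝 0)
  integrable : IntegrableOn R (Set.Ioi x₀)

namespace DecayingSol

variable {φ φ' R ρ ρ' T : ℝ → ℝ} {x₀ : ℝ}

theorem mono (h : DecayingSol φ φ' R x₀) {x₁ : ℝ} (hx : x₀ ≤ x₁) : DecayingSol φ φ' R x₁ where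
  deriv₁ x hx' := h.deriv₁ x (hx.trans hx')
  deriv₂ x hx' := h.deriv₂ x (hx.trans hx')
  tendsto := h.tendsto
  tendsto' := h.tendsto'
  integrable := h.integrable.mono_set (Set.Ioi_subset_Ioi hx)

theorem add (h : DecayingSol φ φ' R x₀) (h' : DecayingSol ρ ρ' T x₀) :
    DecayingSol (fun x => φ x + ρ x) (fun x => φ' x + ρ' x) (fun x => R x + T x) x₀ where
  deriv₁ x hx := (h.deriv₁ x hx).add (h'.deriv₁ x hx)
  deriv₂ x hx := ((h.deriv₂ x hx).add (h'.deriv₂ x hx)).congr_deriv (by ring)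
  tendsto := by simpa using h.tendsto.add h'.tendsto
  tendsto' := by simpa using h.tendsto'.add h'.tendsto'
  integrable := h.integrable.add h'.integrable

theorem const_mul (h : DecayingSol φ φ' R x₀) (c : ℝ) :
    DecayingSol (fun x => c * φ x) (fun x => c * φ' x) (fun x => c * R x) x₀ where
  deriv₁ x hx := (h.deriv₁ x hx).const_mul c
  deriv₂ x hx := ((h.deriv₂ x hx).const_mul c).congr_deriv (by ring)
  tendsto := by simpa using h.tendsto.const_mul c
  tendsto' := by simpa using h.tendsto'.const_mul c
  integrable := h.integrable.const_mul c

/-- Cauchy–Schwarz together with K₁² + K₂² ≤ 3. -/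
theorem abs_comb_le (A B x : ℝ) : |A * K₁ x + B * K₂ x| ≤ √3 * √(A ^ 2 + B ^ 2) := by
  rw [← Real.sqrt_mul (by norm_num)]
  apply Real.abs_le_sqrt
  nlinarith [K_sq_add_sq_le x, sq_nonneg (A * K₂ x - B * K₁ x), sq_nonneg A, sq_nonneg B,
    mul_nonneg (add_nonneg (sq_nonneg A) (sq_nonneg B)) (sub_nonneg.2 (K_sq_add_sq_le x))]

theorem integrable_mul_comb (hR : IntegrableOn R (Set.Ioi x₀)) (A B : ℝ) :
    IntegrableOn (fun x => R x * (A * K₁ x + B * K₂ x)) (Set.Ioi x₀) := by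
  refine Integrable.mul_bdd (c := √3 * √(A ^ 2 + B ^ 2)) hR ?_
    (Eventually.of_forall fun x => abs_comb_le A B x)
  exact ((continuous_K₁.const_mul A).add (continuous_K₂.const_mul B)).aestronglyMeasurable

/-- Green's formula: the Wronskian of φ with a homogeneous solution has derivative R times that
solution, and it vanishes at infinity. -/
theorem integral_mul_comb (h : DecayingSol φ φ' R x₀) (A B : ℝ) :
    ∫ x in Set.Ioi x₀, R x * (A * K₁ x + B * K₂ x) =
      φ' x₀ * (A * K₁ x₀ + B * K₂ x₀) - φ x₀ * (A * K₁' x₀ + B * K₂' x₀) := by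
  have hd : ∀ x ∈ Set.Ici x₀, HasDerivAt
      (fun x => φ x * (A * K₁' x + B * K₂' x) - φ' x * (A * K₁ x + B * K₂ x))
      (R x * (A * K₁ x + B * K₂ x)) x := by
    intro x hx
    have e1 := ((hasDerivAt_K₁ x).const_mul A).add ((hasDerivAt_K₂ x).const_mul B)
    have e2 := ((hasDerivAt_K₁' x).const_mul A).add ((hasDerivAt_K₂' x).const_mul B)
    exact (((h.deriv₁ x hx).mul e2).sub ((h.deriv₂ x hx).mul e1)).congr_deriv (by simp; ring)
  have hz : ∀ {u v : ℝ → ℝ} {C : ℝ}, Tendsto u atTop (𝓝 0) → (∀ x, |v x| ≤ C) →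
      Tendsto (fun x => u x * v x) atTop (𝓝 0) := by
    intro u v C hu hv
    have hu' : Tendsto (fun x => |u x| * C) atTop (𝓝 0) := by simpa using hu.abs.mul_const C
    refine squeeze_zero_norm (fun x => ?_) hu'
    rw [norm_mul]
    exact mul_le_mul_of_nonneg_left (hv x) (norm_nonneg _)
  have hb : ∀ x, |A * K₁' x + B * K₂' x| ≤ |A| * 10 + |B| * 10 := by
    intro x
    refine (abs_add_le _ _).trans ?_
    rw [abs_mul, abs_mul]
    gcongr
    · exact abs_K₁'_le x
    · exact abs_K₂'_le x
  have hlim := (hz h.tendsto hb).sub (hz h.tendsto' (abs_comb_le A B))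
  rw [integral_Ioi_of_hasDerivAt_of_tendsto' hd (integrable_mul_comb h.integrable A B) hlim]
  ring

/-- The combination is the one that vanishes at x₀, so φ'(x₀) disappears and the coefficient of
φ(x₀) is the Wronskian 6. -/
theorem eq_integral (h : DecayingSol φ φ' R x₀) :
    φ x₀ = -(1 / 6) * ∫ x in Set.Ioi x₀, R x * (-K₂ x₀ * K₁ x + K₁ x₀ * K₂ x) := by
  rw [h.integral_mul_comb]
  linear_combination (-(1 / 6) * φ x₀) * wronskian x₀

/-- The Green kernel is at most √3·√3/6 = 1/2. This is the stability estimate behind both uniqueness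
and the error bound for g. -/
theorem abs_le_integral (h : DecayingSol φ φ' R x₀) :
    |φ x₀| ≤ 1 / 2 * ∫ x in Set.Ioi x₀, |R x| := by
  rw [h.eq_integral, abs_mul]
  have h3 : ∀ x, |-K₂ x₀ * K₁ x + K₁ x₀ * K₂ x| ≤ 3 := by
    intro x
    refine (abs_comb_le _ _ x).trans ?_
    have : √((-K₂ x₀) ^ 2 + K₁ x₀ ^ 2) ≤ √3 :=
      Real.sqrt_le_sqrt (by linarith [K_sq_add_sq_le x₀, neg_sq (K₂ x₀)])
    calc _ ≤ √3 * √3 := by gcongr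
      _ = 3 := Real.mul_self_sqrt (by norm_num)
  have h4 : |∫ x in Set.Ioi x₀, R x * (-K₂ x₀ * K₁ x + K₁ x₀ * K₂ x)| ≤
      ∫ x in Set.Ioi x₀, 3 * |R x| := by
    refine abs_integral_le_integral_abs.trans ?_
    refine integral_mono (integrable_mul_comb h.integrable _ _).abs
      (h.integrable.abs.const_mul 3) fun x => ?_
    change |_ * _| ≤ _
    rw [abs_mul, mul_comm]
    exact mul_le_mul_of_nonneg_right (h3 x) (abs_nonneg _)
  rw [integral_const_mul] at h4
  rw [show |(-(1 / 6) : ℝ)| = 1 / 6 by rw [abs_neg, abs_of_pos (by norm_num)]]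
  linarith

end DecayingSol

/-- A Schwartz function solves its equation on every half-line. -/
theorem decayingSol_of_schwartz {g : 𝓢(ℝ, ℝ)} {R : ℝ → ℝ} (hR : Integrable R)
    (hg : ∀ x, -deriv (deriv g) x - (4 + 3 * sx x ^ 2) * g x = R x) (x₀ : ℝ) :
    DecayingSol g (deriv g) R x₀ := by
  have hd : ⇑(SchwartzMap.derivCLM ℝ ℝ g) = deriv g := by
    funext x; exact SchwartzMap.derivCLM_apply ℝ g x
  refine ⟨fun x _ => g.hasDerivAt x, fun x _ => ?_,
    (SchwartzMap.tendsto_cocompact g).mono_left atTop_le_cocompact, ?_, hR.integrableOn⟩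
  · have := (SchwartzMap.derivCLM ℝ ℝ g).hasDerivAt x
    rw [hd] at this
    exact this.congr_deriv (by linarith [hg x])
  · rw [← hd]
    exact (SchwartzMap.tendsto_cocompact _).mono_left atTop_le_cocompact

/-- Two Schwartz solutions of the same equation agree. -/
theorem schwartz_sol_unique {g g' : 𝓢(ℝ, ℝ)} {R : ℝ → ℝ} (hR : Integrable R)
    (hg : ∀ x, -deriv (deriv g) x - (4 + 3 * sx x ^ 2) * g x = R x)
    (hg' : ∀ x, -deriv (deriv g') x - (4 + 3 * sx x ^ 2) * g' x = R x) : g' = g := by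
  ext x
  have h := ((decayingSol_of_schwartz hR hg' x).add
    ((decayingSol_of_schwartz hR hg x).const_mul (-1))).abs_le_integral
  have h0 : ∀ x, R x + -1 * R x = 0 := fun x => by ring
  simp only [h0] at h
  norm_num at h
  linarith

/-- Solvability in the Schwartz class under the two orthogonality conditions. -/
theorem exists_schwartz_sol (R : 𝓢(ℝ, ℝ)) (h₁ : ∫ x, K₁ x * R x = 0) (h₂ : ∫ x, K₂ x * R x = 0) :
    ∃ g : 𝓢(ℝ, ℝ), ∀ x, -deriv (deriv g) x - (4 + 3 * sx x ^ 2) * g x = R x := by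
  obtain ⟨R₁, hR₁⟩ := exists_schwartz_mul hasTemperateGrowth_K₁ R
  obtain ⟨R₂, hR₂⟩ := exists_schwartz_mul hasTemperateGrowth_K₂ R
  obtain ⟨J₁, -, hJ₁⟩ := exists_schwartz_primitive R₁ (by rw [hR₁]; exact h₁)
  obtain ⟨J₂, -, hJ₂⟩ := exists_schwartz_primitive R₂ (by rw [hR₂]; exact h₂)
  obtain ⟨G₁, hG₁⟩ := exists_schwartz_mul hasTemperateGrowth_K₁ J₂
  obtain ⟨G₂, hG₂⟩ := exists_schwartz_mul hasTemperateGrowth_K₂ J₁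
  -- Variation of constants from +∞, as in `eq_integral`, with Jᵢ the tail integral of KᵢR. The two
  -- orthogonality conditions are what makes J₁ and J₂ Schwartz.
  have hg : ⇑((-(1 / 6) : ℝ) • (G₁ - G₂)) =
      fun x => -(1 / 6) * (K₁ x * J₂ x - K₂ x * J₁ x) := by
    funext x; simp [hG₁, hG₂]
  refine ⟨(-(1 / 6) : ℝ) • (G₁ - G₂), fun x => ?_⟩
  rw [hg]
  have hd1 : deriv (fun x => -(1 / 6) * (K₁ x * J₂ x - K₂ x * J₁ x)) =
      fun x => -(1 / 6) * (K₁' x * J₂ x - K₂' x * J₁ x) := by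
    funext x
    refine ((((hasDerivAt_K₁ x).mul (hJ₂ x)).sub
      ((hasDerivAt_K₂ x).mul (hJ₁ x))).const_mul (-(1 / 6))).deriv.trans ?_
    rw [hR₁, hR₂]; ring
  have hd2 := ((((hasDerivAt_K₁' x).mul (hJ₂ x)).sub
      ((hasDerivAt_K₂' x).mul (hJ₁ x))).const_mul (-(1 / 6))).deriv
  rw [hd1]
  refine (congrArg (fun t => -t - _) hd2).trans ?_
  rw [hR₁, hR₂]
  linear_combination (1 / 6 * R x) * wronskian x

end Phi4Kink

namespace Phi4Kink

open Filter Topology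

/-! ### Rational parametrization by a decaying exponential -/

/-- `exp (-√2 x / 8)`, in which all the functions on the half-line are rational. -/
noncomputable def E (x : ℝ) : ℝ := Real.exp (-(√2 / 8 * x))

theorem E_pos (x : ℝ) : 0 < E x := Real.exp_pos _

theorem E_le_one {x : ℝ} (hx : 0 ≤ x) : E x ≤ 1 :=
  Real.exp_le_one_iff.2 (by have := sqrt2_pos; nlinarith [mul_nonneg this.le hx])

theorem E_zero : E 0 = 1 := by simp [E]

theorem tanh_eq_exp (y : ℝ) :
    Real.tanh y = (1 - Real.exp (-(2 * y))) / (1 + Real.exp (-(2 * y))) := by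
  have h := Real.exp_pos y
  rw [Real.tanh_eq, show -(2 * y) = -y + -y by ring, Real.exp_add, Real.exp_neg]
  field_simp

theorem sech_eq_exp (y : ℝ) : sech y = 2 * Real.exp (-y) / (1 + Real.exp (-(2 * y))) := by
  have h := Real.exp_pos y
  rw [sech, Real.cosh_eq, show -(2 * y) = -y + -y by ring, Real.exp_add, Real.exp_neg]
  field_simp

theorem E_pow (n : ℕ) (x : ℝ) : E x ^ n = Real.exp (-(n * (√2 / 8) * x)) := by
  unfold E; rw [← Real.exp_nat_mul]; congr 1; ring

theorem H_eq_E (x : ℝ) : H x = (1 - E x ^ 8) / (1 + E x ^ 8) := by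
  rw [H, tanh_eq_exp, E_pow, div_eq_mul_inv x, inv_sqrt2]
  congr 3 <;> (congr 1; push_cast; ring)

theorem sx_eq_E (x : ℝ) : sx x = 2 * E x ^ 4 / (1 + E x ^ 8) := by
  rw [sx, sech_eq_exp, E_pow, E_pow, div_eq_mul_inv x, inv_sqrt2]
  congr 3 <;> (congr 1; push_cast; ring)

theorem div_lam_sqrt2 (x : ℝ) : x / (lam * √2) = √2 / 16 * x := by
  have := sqrt2_pos
  unfold lam; field_simp; linear_combination (-8 * x) * sq2

theorem tl_eq_E (x : ℝ) : tl x = (1 - E x) / (1 + E x) := by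
  rw [tl, tanh_eq_exp, div_lam_sqrt2, show -(2 * (√2 / 16 * x)) = -(√2 / 8 * x) by ring]; rfl

theorem ζ_sq_eq_E (x : ℝ) : ζ x ^ 2 = 4 * E x / (1 + E x) ^ 2 := by
  have h := E_pos x
  rw [ζ_sq, tl_eq_E]; field_simp; ring

theorem fh_eq_E (x : ℝ) : fh x = 2 * E x ^ 4 * (1 - E x ^ 8) *
    (2 * E x ^ 4 * (1 - E x ^ 8) ^ 2 - bc * (1 + E x ^ 8) ^ 3) / (1 + E x ^ 8) ^ 5 := by
  have h := E_pos x
  rw [fh, H_eq_E, sx_eq_E]; field_simp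

theorem srcD_eq_E (x : ℝ) : srcD x = 8 * E x ^ 5 * (1 - E x ^ 8) *
    (2 * E x ^ 4 * (1 - E x ^ 8) ^ 2 - bc * (1 + E x ^ 8) ^ 3) /
      ((1 + E x ^ 8) ^ 5 * (1 + E x) ^ 2) := by
  have h := E_pos x
  rw [srcD, fh_eq_E, ζ_sq_eq_E]; field_simp; ring

theorem srcN_eq_E (x : ℝ) : srcN x = (8 * (1 - E x) * (1 + E x) *
    (48 * E x ^ 16 * (1 - E x ^ 8) ^ 2 - 8 * E x ^ 8 * (1 - E x ^ 8) ^ 4 -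
      bc * (1 + E x ^ 8) ^ 3 * (8 * E x ^ 12 - 2 * (1 - E x ^ 8) ^ 2 * E x ^ 4)) +
    4 * E x ^ 5 * (1 - E x ^ 8) * (1 + E x ^ 8) *
      (2 * E x ^ 4 * (1 - E x ^ 8) ^ 2 - bc * (1 + E x ^ 8) ^ 3)) /
      ((1 + E x ^ 8) ^ 6 * (1 + E x) ^ 2) := by
  have h := E_pos x
  have h2 := sqrt2_pos
  rw [srcN, fh_eq_E, ζ_sq_eq_E, ψ_eq, fh', tl_eq_E, H_eq_E, sx_eq_E]; field_simp; ring

/-- The sources are affine in `bc`, so each polynomial inequality involving it is tested only at b =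
29451 and b = 29453 and then interpolated by `affine_nonneg`. -/
theorem bc_bounds : (29451 : ℝ) ≤ 100000 * bc ∧ 100000 * bc ≤ 29453 := by
  have h1 := Real.pi_gt_d4
  have h2 := Real.pi_lt_d4
  unfold bc
  constructor <;> linarith

/-- An affine function that is nonnegative at the end points of an interval is nonnegative. -/
theorem affine_nonneg {F : ℝ → ℝ} (hF : ∀ t, F t = F 0 + t * (F 1 - F 0)) {a b t : ℝ}
    (ha : 0 ≤ F a) (hb : 0 ≤ F b) (h1 : a ≤ t) (h2 : t ≤ b) : 0 ≤ F t := by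
  rw [hF] at *
  rcases le_total 0 (F 1 - F 0) with h | h
  · nlinarith
  · nlinarith

/-! ### Approximate solutions of the inhomogeneous equations -/

/-- `1 + x ^ 8`. -/
def pQ : List ℤ := padd [1] (pX 8)

/-- `1 - x ^ 8`. -/
def pM : List ℤ := padd [1] (psmul (-1) (pX 8))

/-- Coefficients of the approximate solution with source `ψ' f`, times `10 ^ 5`. -/
def pφD : List ℤ := [0, 0, 0, 0, -20777, 1021711, -18036534, 178471231, -1088133085, 4365803929, -11972142107, 22838986459, -30328509108, 27522293017, -16289030918, 5670500900, -881163679]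

/-- Coefficients of the approximate solution with source `ψ f' + ψ' f / 2`, times `10 ^ 5`. -/
def pφN : List ℤ := [0, 0, 0, 0, -95723, -152711, 5904736, -53695375, 290056236, -1012367240, 2379104576, -3804307754, 4083173605, -2812490149, 1118250104, -193408517]

/-- Numerator of the Euler derivative of `p / (1 + x ^ 8) ^ k`. -/
def qstep (k : ℤ) (p : List ℤ) : List ℤ :=
  padd (pmul (pD p) pQ) (psmul (-8 * k) (pmul (pX 8) p))

/-- The function `p / (1 + E ^ 8) ^ k` of `x`. -/
noncomputable def quot (p : List ℤ) (k : ℕ) (x : ℝ) : ℝ := ev p (E x) / (1 + E x ^ 8) ^ k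

theorem ev_pQ (x : ℝ) : ev pQ x = 1 + x ^ 8 := by simp [pQ]

theorem ev_pM (x : ℝ) : ev pM x = 1 - x ^ 8 := by simp [pM]; ring

theorem hasDerivAt_E (x : ℝ) : HasDerivAt E (-(√2 / 8) * E x) x := by
  have h1 : HasDerivAt (fun x : ℝ => -(√2 / 8 * x)) (-(√2 / 8)) x := by
    exact (((hasDerivAt_id x).const_mul (√2 / 8)).neg).congr_deriv (by simp)
  exact h1.exp.congr_deriv (by unfold E; ring)

theorem hasDerivAt_quot (p : List ℤ) (k : ℕ) (x : ℝ) :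
    HasDerivAt (quot p k) (-(√2 / 8) * quot (qstep k p) (k + 1) x) x := by
  have h := E_pos x
  have hQ : HasDerivAt (fun x => 1 + E x ^ 8) (8 * E x ^ 7 * (-(√2 / 8) * E x)) x :=
    (((hasDerivAt_E x).pow 8).const_add 1).congr_deriv (by norm_num)
  have h1 := ((hasDerivAt_ev p (E x)).comp x (hasDerivAt_E x)).div (hQ.pow k)
    (pow_ne_zero k (by positivity : (1 + E x ^ 8) ≠ 0))
  refine h1.congr_deriv ?_
  simp only [quot, qstep, ev_padd, ev_pmul, ev_psmul, ev_pX, ev_pQ, ev_pD, Function.comp,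
    Pi.pow_apply]
  rcases k with _ | k
  · field_simp; push_cast; ring
  · rw [Nat.add_sub_cancel]; field_simp; push_cast; ring

theorem continuous_quot (p : List ℤ) (k : ℕ) : Continuous (quot p k) :=
  continuous_iff_continuousAt.2 fun x => (hasDerivAt_quot p k x).continuousAt

theorem tendsto_E : Tendsto E atTop (𝓝 0) := by
  have h : Tendsto (fun x : ℝ => √2 / 8 * x) atTop atTop :=
    tendsto_id.const_mul_atTop (by have := sqrt2_pos; positivity)
  exact Real.tendsto_exp_neg_atTop_nhds_zero.comp h

theorem tendsto_quot {p : List ℤ} (hp : ev p 0 = 0) (k : ℕ) :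
    Tendsto (quot p k) atTop (𝓝 0) := by
  have h1 := ((continuous_ev p).tendsto 0).comp tendsto_E
  have h2 : Tendsto (fun x => (1 + E x ^ 8) ^ k) atTop (𝓝 ((1 + 0 ^ 8) ^ k)) :=
    ((tendsto_E.pow 8).const_add 1).pow k
  have h3 := h1.div h2 (by norm_num)
  rw [hp, zero_div] at h3
  exact h3

theorem integrableOn_E_pow {n : ℕ} (hn : n ≠ 0) (x₀ : ℝ) :
    IntegrableOn (fun x => E x ^ n) (Set.Ioi x₀) := by
  have hn' : (0 : ℝ) < n := by positivity
  have h := integrableOn_exp_mul_Ioi (a := -(n * (√2 / 8))) (by have := sqrt2_pos; nlinarith) x₀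
  refine h.congr_fun (fun x _ => ?_) measurableSet_Ioi
  simp only [E_pow]; congr 1; ring

theorem integral_E_pow {n : ℕ} (hn : n ≠ 0) (x₀ : ℝ) :
    ∫ x in Set.Ioi x₀, E x ^ n = 4 * √2 / n * E x₀ ^ n := by
  have hn' : (0 : ℝ) < n := by positivity
  have h := integral_exp_mul_Ioi (a := -(n * (√2 / 8))) (by have := sqrt2_pos; nlinarith) x₀
  have hs := sqrt2_pos
  simp only [E_pow]
  have e : ∀ x : ℝ, -(n * (√2 / 8) * x) = -(n * (√2 / 8)) * x := fun x => by ring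
  simp only [e]
  rw [h]
  field_simp
  linear_combination (-4) * sq2

/-- Numerator of minus the operator applied to `p / (1 + x ^ 8) ^ 4`, times `32`. -/
def rnum (p : List ℤ) : List ℤ :=
  padd (qstep 5 (qstep 4 p))
    (psmul 32 (pmul (padd (psmul 4 (ppow pQ 2)) (psmul 12 (pX 8))) p))

/-- One x-derivative is −√2/8 times the Euler operator in E. Two of them give the rational factor
1/32, so the residual has integer coefficients after scaling. -/
theorem quot_operator (p : List ℤ) (x : ℝ) :
    -(1 / 32 * quot (qstep 5 (qstep 4 p)) 6 x) - (4 + 3 * sx x ^ 2) * quot p 4 x =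
      -(ev (rnum p) (E x) / (32 * (1 + E x ^ 8) ^ 6)) := by
  have h := E_pos x
  rw [sx_eq_E]
  simp only [quot, rnum, ev_padd, ev_psmul, ev_pmul, ev_pX, ev_ppow, ev_pQ]
  field_simp
  push_cast
  ring

/-- `10 ^ 5` times the numerator of `ψ' f`. -/
def dnum (b : ℤ) : List ℤ :=
  pmul (psmul 8 (pX 5)) (pmul (pmul pM pQ)
    (padd (psmul 200000 (pmul (pX 4) (ppow pM 2))) (psmul (-b) (ppow pQ 3))))

/-- `10 ^ 5` times the numerator of `ψ f' + ψ' f / 2`. -/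
def nnum (b : ℤ) : List ℤ :=
  padd (pmul [8, 0, -8]
    (padd (padd (psmul 4800000 (pmul (pX 16) (ppow pM 2)))
      (psmul (-800000) (pmul (pX 8) (ppow pM 4))))
      (psmul (-b) (pmul (ppow pQ 3)
        (padd (psmul 8 (pX 12)) (psmul (-2) (pmul (ppow pM 2) (pX 4))))))))
    (pmul (psmul 4 (pX 5)) (pmul (pmul pM pQ)
      (padd (psmul 200000 (pmul (pX 4) (ppow pM 2))) (psmul (-b) (ppow pQ 3)))))

/-- The polynomial whose positivity bounds a residual by `e / 20000` times `E ^ 2`. -/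
def resid (e σ : ℤ) (num p : List ℤ) : List ℤ :=
  padd (psmul (16000000 * e) (pmul (pX 2) (pmul (ppow pQ 6) [1, 2, 1])))
    (psmul σ (padd (psmul 3200000 num) (pmul [1, 2, 1] (psmul 100000 (rnum p)))))

-- Nothing is assumed about how `pφD` was found: smallness of the residual, checked with both signs
-- and both bounds of `bc`, is all that is used. The argument 4 stands for 4/20000 = 2/10000, and 3
-- in the next check for 15/100000.
set_option maxRecDepth 100000 in
theorem resid_D_check : ∀ σ ∈ [1, -1], ∀ b ∈ [29451, 29453],
    nonnegOn (resid 4 σ (dnum b) pφD) 6 0 1 1 = true := by decide +kernel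

set_option maxRecDepth 100000 in
theorem resid_N_check : ∀ σ ∈ [1, -1], ∀ b ∈ [29451, 29453],
    nonnegOn (resid 3 σ (nnum b) pφN) 6 0 1 1 = true := by decide +kernel

end Phi4Kink

namespace Phi4Kink

open Filter Topology

/-! ### Integrals of polynomials in a decaying exponential over half-lines -/

theorem ev_eq_mul_tail {p : List ℤ} (hp : ev p 0 = 0) (x : ℝ) : ev p x = x * ev p.tail x := by
  rcases p with _ | ⟨c, p⟩
  · simp
  · have : (c : ℝ) = 0 := by simpa using hp
    simp [this]

theorem exp_neg_mem {c x : ℝ} (hc : 0 < c) (hx : 0 ≤ x) :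
    Real.exp (-(c * x)) ∈ Set.Icc (0 : ℝ) 1 :=
  ⟨(Real.exp_pos _).le, Real.exp_le_one_iff.2 (by nlinarith [mul_nonneg hc.le hx])⟩

theorem integrableOn_exp_neg {c : ℝ} (hc : 0 < c) (x₀ : ℝ) :
    IntegrableOn (fun x => Real.exp (-(c * x))) (Set.Ioi x₀) := by
  refine (integrableOn_exp_mul_Ioi (a := -c) (by linarith) x₀).congr_fun (fun x _ => ?_)
    measurableSet_Ioi
  simp only [neg_mul]

/-- A rational function of `exp (-c x)` vanishing at infinity is integrable on a half-line. -/
theorem integrableOn_ev_mul {c : ℝ} (hc : 0 < c) {p : List ℤ} (hp : ev p 0 = 0) {u : ℝ → ℝ}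
    (hu : ContinuousOn u (Set.Icc 0 1)) {x₀ : ℝ} (hx₀ : 0 ≤ x₀) :
    IntegrableOn (fun x => ev p (Real.exp (-(c * x))) * u (Real.exp (-(c * x)))) (Set.Ioi x₀) := by
  have hcont : ContinuousOn (fun t => ev p.tail t * u t) (Set.Icc 0 1) :=
    (continuous_ev _).continuousOn.mul hu
  obtain ⟨C, hC⟩ := isCompact_Icc.exists_bound_of_continuousOn hcont
  have hm : ContinuousOn (fun x => ev p.tail (Real.exp (-(c * x))) * u (Real.exp (-(c * x))))
      (Set.Ioi x₀) :=
    hcont.comp (by fun_prop) fun x hx => exp_neg_mem hc (hx₀.trans (le_of_lt hx))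
  refine (Integrable.mul_bdd (c := C) (integrableOn_exp_neg hc x₀)
    (hm.aestronglyMeasurable measurableSet_Ioi) ?_).congr (Eventually.of_forall fun x => ?_)
  · exact (ae_restrict_iff' measurableSet_Ioi).2 (Eventually.of_forall fun x hx =>
      hC _ (exp_neg_mem hc (hx₀.trans (le_of_lt hx))))
  · simp only; rw [ev_eq_mul_tail hp]; ring

theorem integrableOn_ev {c : ℝ} (hc : 0 < c) {p : List ℤ} (hp : ev p 0 = 0) {x₀ : ℝ}
    (hx₀ : 0 ≤ x₀) : IntegrableOn (fun x => ev p (Real.exp (-(c * x)))) (Set.Ioi x₀) := by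
  simpa using integrableOn_ev_mul hc hp (u := fun _ => 1) continuousOn_const hx₀

theorem tendsto_exp_neg {c : ℝ} (hc : 0 < c) :
    Tendsto (fun x : ℝ => Real.exp (-(c * x))) atTop (𝓝 0) :=
  Real.tendsto_exp_neg_atTop_nhds_zero.comp (tendsto_id.const_mul_atTop hc)

theorem integral_Ioi_ev_exp {p P : List ℤ} {N : ℤ} (hN : N ≠ 0) (hP : pD P = psmul N p)
    (hP0 : ev P 0 = 0) {c : ℝ} (hc : 0 < c) {x₀ : ℝ} (hx₀ : 0 ≤ x₀) :
    ∫ z in Set.Ioi x₀, ev p (Real.exp (-(c * z))) = ev P (Real.exp (-(c * x₀))) / (c * N) := by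
  have hN' : (N : ℝ) ≠ 0 := by exact_mod_cast hN
  have hp0 : ev p 0 = 0 := by
    have h : ev (pD P) 0 = ev (psmul N p) 0 := by rw [hP]
    rw [ev_pD, ev_psmul, zero_mul] at h
    exact (mul_eq_zero.1 h.symm).resolve_left hN'
  have h : ∀ z ∈ Set.Ici x₀, HasDerivAt (fun z => -(ev P (Real.exp (-(c * z)))) / (c * N))
      (ev p (Real.exp (-(c * z)))) z := by
    intro z _
    refine ((hasDerivAt_ev_exp P c z).neg.div_const _).congr_deriv ?_
    rw [hP, ev_psmul]; field_simp
  have hl : Tendsto (fun z => -(ev P (Real.exp (-(c * z)))) / (c * N)) atTop (𝓝 0) := by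
    have := (((continuous_ev P).tendsto 0).comp (tendsto_exp_neg hc)).neg.div_const (c * N)
    simpa [hP0] using this
  rw [integral_Ioi_of_hasDerivAt_of_tendsto' h (integrableOn_ev hc hp0 hx₀) hl]
  ring

/-! ### Parity -/

theorem H_neg (x : ℝ) : H (-x) = -H x := by simp [H, neg_div, Real.tanh_neg]
theorem sx_neg (x : ℝ) : sx (-x) = sx x := by simp [sx, sech, neg_div, Real.cosh_neg]
theorem tl_neg (x : ℝ) : tl (-x) = -tl x := by simp [tl, neg_div, Real.tanh_neg]
theorem ζ_neg (x : ℝ) : ζ (-x) = ζ x := by simp [ζ, sech, neg_div, Real.cosh_neg]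
theorem ψ_neg (x : ℝ) : ψ (-x) = -ψ x := by rw [ψ_eq, ψ_eq, tl_neg]; ring
theorem fh_neg (x : ℝ) : fh (-x) = -fh x := by simp only [fh, H_neg, sx_neg]; ring
theorem fh'_neg (x : ℝ) : fh' (-x) = fh' x := by simp only [fh', H_neg, sx_neg]; ring
theorem srcD_neg (x : ℝ) : srcD (-x) = -srcD x := by simp only [srcD, ζ_neg, fh_neg]; ring
theorem srcN_neg (x : ℝ) : srcN (-x) = -srcN x := by
  simp only [srcN, ζ_neg, fh_neg, fh'_neg, ψ_neg]; ring
theorem K₁_neg (x : ℝ) : K₁ (-x) = K₁ x := by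
  simp only [K₁, H_neg, sx_neg, mul_neg, Real.cos_neg, Real.sin_neg]; ring
theorem K₂_neg (x : ℝ) : K₂ (-x) = -K₂ x := by
  simp only [K₂, H_neg, sx_neg, mul_neg, Real.cos_neg, Real.sin_neg]; ring

theorem integral_of_even {F : ℝ → ℝ} (hF : ∀ x, F (-x) = F x) :
    ∫ x, F x = 2 * ∫ x in Set.Ioi 0, F x := by
  rw [← integral_comp_abs]
  congr 1; funext x
  rcases abs_choice x with h | h <;> rw [h]
  exact (hF x).symm

/-! ### The inner products with the odd resonance -/

/-- The part of `ψ' f` matched by the approximate solution. -/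
noncomputable def resD (x : ℝ) : ℝ :=
  1 / 100000 * -(ev (rnum pφD) (E x) / (32 * (1 + E x ^ 8) ^ 6))

/-- The part of `ψ f' + ψ' f / 2` matched by the approximate solution. -/
noncomputable def resN (x : ℝ) : ℝ :=
  1 / 100000 * -(ev (rnum pφN) (E x) / (32 * (1 + E x ^ 8) ^ 6))

theorem ev_qstep_zero {p : List ℤ} (k : ℤ) : ev (qstep k p) 0 = 0 := by
  simp [qstep, ev_pD]

theorem decayingSol_quot {p : List ℤ} (hp : ev p 0 = 0) :
    DecayingSol (quot p 4) (fun x => -(√2 / 8) * quot (qstep 4 p) 5 x)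
      (fun x => -(ev (rnum p) (E x) / (32 * (1 + E x ^ 8) ^ 6))) 0 where
  deriv₁ x _ := hasDerivAt_quot p 4 x
  deriv₂ x _ := by
    refine ((hasDerivAt_quot (qstep 4 p) 5 x).const_mul (-(√2 / 8))).congr_deriv ?_
    rw [← quot_operator]
    push_cast
    linear_combination (1 / 64 * quot (qstep 5 (qstep 4 p)) 6 x) * sq2
  tendsto := tendsto_quot hp 4
  tendsto' := by simpa using (tendsto_quot (ev_qstep_zero (p := p) 4) 5).const_mul (-(√2 / 8))
  integrable := by
    have h0 : ev (rnum p) 0 = 0 := by simp [rnum, ev_qstep_zero, hp]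
    have hu : ContinuousOn (fun t : ℝ => (32 * (1 + t ^ 8) ^ 6)⁻¹) (Set.Icc 0 1) := by
      refine ContinuousOn.inv₀ (by fun_prop) fun t _ => ?_
      positivity
    refine ((integrableOn_ev_mul (c := √2 / 8) (by have := sqrt2_pos; positivity) h0 hu
      le_rfl).neg).congr (Eventually.of_forall fun x => ?_)
    simp only [E, div_eq_mul_inv]; rfl

theorem decayingSol_D :
    DecayingSol (fun x => 1 / 100000 * quot pφD 4 x)
      (fun x => 1 / 100000 * (-(√2 / 8) * quot (qstep 4 pφD) 5 x)) resD 0 :=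
  (decayingSol_quot (by simp [pφD])).const_mul _

theorem decayingSol_N :
    DecayingSol (fun x => 1 / 100000 * quot pφN 4 x)
      (fun x => 1 / 100000 * (-(√2 / 8) * quot (qstep 4 pφN) 5 x)) resN 0 :=
  (decayingSol_quot (by simp [pφN])).const_mul _

theorem abs_srcD_sub_resD {x : ℝ} (hx : 0 ≤ x) : |srcD x - resD x| ≤ 2 / 10000 * E x ^ 2 := by
  have hE := E_pos x
  have key : ∀ σ ∈ [(1 : ℤ), -1], 0 ≤ 2 / 10000 * E x ^ 2 + σ * (srcD x - resD x) := by
    intro σ hσ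
    have hc : ∀ b ∈ [(29451 : ℤ), 29453], 0 ≤ ev (resid 4 σ (dnum b) pφD) (E x) := fun b hb =>
      ev_nonneg_of_nonnegOn one_pos one_pos (resid_D_check σ hσ b hb) (by simpa using hE.le)
        (by simpa using E_le_one hx)
    have h := affine_nonneg (F := fun t => 16000000 * 4 * (E x ^ 2 * ((1 + E x ^ 8) ^ 6 *
      (1 + E x) ^ 2)) + σ * (3200000 * (8 * E x ^ 5 * ((1 - E x ^ 8) * (1 + E x ^ 8) *
      (200000 * (E x ^ 4 * (1 - E x ^ 8) ^ 2) - t * (1 + E x ^ 8) ^ 3))) +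
      (1 + E x) ^ 2 * (100000 * ev (rnum pφD) (E x)))) (fun t => by ring)
      (a := 29451) (b := 29453) (t := 100000 * bc) ?_ ?_ bc_bounds.1 bc_bounds.2
    · have hpos : 0 < 3200000 * 100000 * ((1 + E x ^ 8) ^ 6 * (1 + E x) ^ 2) := by positivity
      refine le_of_mul_le_mul_right ?_ hpos
      rw [zero_mul]
      refine h.trans_eq ?_
      rw [srcD_eq_E, resD]; field_simp; ring
    · have := hc 29451 (by simp)
      simp only [resid, dnum, ev_padd, ev_psmul, ev_pmul, ev_pX, ev_ppow, ev_pQ, ev_pM] at this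
      refine this.trans_eq ?_
      push_cast [ev_cons, ev_nil]; ring
    · have := hc 29453 (by simp)
      simp only [resid, dnum, ev_padd, ev_psmul, ev_pmul, ev_pX, ev_ppow, ev_pQ, ev_pM] at this
      refine this.trans_eq ?_
      push_cast [ev_cons, ev_nil]; ring
  have h1 := key 1 (by simp)
  have h2 := key (-1) (by simp)
  push_cast at h1 h2
  rw [abs_le]; constructor <;> linarith

theorem abs_srcN_sub_resN {x : ℝ} (hx : 0 ≤ x) : |srcN x - resN x| ≤ 15 / 100000 * E x ^ 2 := by
  have hE := E_pos x
  have key : ∀ σ ∈ [(1 : ℤ), -1], 0 ≤ 15 / 100000 * E x ^ 2 + σ * (srcN x - resN x) := by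
    intro σ hσ
    have hc : ∀ b ∈ [(29451 : ℤ), 29453], 0 ≤ ev (resid 3 σ (nnum b) pφN) (E x) := fun b hb =>
      ev_nonneg_of_nonnegOn one_pos one_pos (resid_N_check σ hσ b hb) (by simpa using hE.le)
        (by simpa using E_le_one hx)
    have h := affine_nonneg (F := fun t => 16000000 * 3 * (E x ^ 2 * ((1 + E x ^ 8) ^ 6 *
      (1 + E x) ^ 2)) + σ * (3200000 * ((8 - 8 * E x ^ 2) *
      (4800000 * (E x ^ 16 * (1 - E x ^ 8) ^ 2) - 800000 * (E x ^ 8 * (1 - E x ^ 8) ^ 4) -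
      t * ((1 + E x ^ 8) ^ 3 * (8 * E x ^ 12 - 2 * ((1 - E x ^ 8) ^ 2 * E x ^ 4)))) +
      4 * E x ^ 5 * ((1 - E x ^ 8) * (1 + E x ^ 8) *
      (200000 * (E x ^ 4 * (1 - E x ^ 8) ^ 2) - t * (1 + E x ^ 8) ^ 3))) +
      (1 + E x) ^ 2 * (100000 * ev (rnum pφN) (E x)))) (fun t => by ring)
      (a := 29451) (b := 29453) (t := 100000 * bc) ?_ ?_ bc_bounds.1 bc_bounds.2
    · have hpos : 0 < 3200000 * 100000 * ((1 + E x ^ 8) ^ 6 * (1 + E x) ^ 2) := by positivity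
      refine le_of_mul_le_mul_right ?_ hpos
      rw [zero_mul]
      refine h.trans_eq ?_
      rw [srcN_eq_E, resN]; field_simp; ring
    · have := hc 29451 (by simp)
      simp only [resid, nnum, ev_padd, ev_psmul, ev_pmul, ev_pX, ev_ppow, ev_pQ, ev_pM] at this
      refine this.trans_eq ?_
      push_cast [ev_cons, ev_nil]; ring
    · have := hc 29453 (by simp)
      simp only [resid, nnum, ev_padd, ev_psmul, ev_pmul, ev_pX, ev_ppow, ev_pQ, ev_pM] at this
      refine this.trans_eq ?_
      push_cast [ev_cons, ev_nil]; ring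
  have h1 := key 1 (by simp)
  have h2 := key (-1) (by simp)
  push_cast at h1 h2
  rw [abs_le]; constructor <;> linarith

theorem K₂_zero : K₂ 0 = 0 := by simp [K₂, H]

theorem K₂'_zero : K₂' 0 = 4 := by
  have h := wronskian 0
  have h1 : K₁ 0 = 3 / 2 := by simp [K₁, H, sx, sech]; norm_num
  rw [K₂_zero, h1] at h; linarith

theorem integrable_srcD : Integrable srcD := by
  obtain ⟨F, hF⟩ := exists_schwartz_srcD
  rw [← hF]; exact F.integrable

theorem integrable_srcN : Integrable srcN := by
  obtain ⟨F, hF⟩ := exists_schwartz_srcN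
  rw [← hF]; exact F.integrable

/-- Pairing with the odd resonance through an approximate solution. -/
theorem DecayingSol.abs_integral_mul_K₂_le {φ φ' R S : ℝ → ℝ} {ε : ℝ}
    (h : DecayingSol φ φ' R 0) (hS : Integrable S)
    (hRS : ∀ x, 0 ≤ x → |S x - R x| ≤ ε * E x ^ 2) :
    |(∫ x in Set.Ioi 0, S x * K₂ x) + 4 * φ 0| ≤ ε * (7 / 4 * (2 * √2)) := by
  -- Since K₂(0) = 0 and K₂'(0) = 4, Green's formula leaves only −4φ(0); in particular φ' at 0 plays
  -- no role.
  have h1 := h.integral_mul_comb 0 1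
  have i1 := DecayingSol.integrable_mul_comb h.integrable 0 1
  have i2 := DecayingSol.integrable_mul_comb (x₀ := 0) hS.integrableOn 0 1
  simp only [zero_mul, one_mul, zero_add, K₂_zero, K₂'_zero, mul_zero, zero_sub] at h1 i1 i2
  have h2 : (∫ x in Set.Ioi 0, S x * K₂ x) + 4 * φ 0 =
      ∫ x in Set.Ioi 0, (S x * K₂ x - R x * K₂ x) := by
    rw [integral_sub i2 i1, h1]; ring
  have hE := integrableOn_E_pow two_ne_zero 0
  have h3 : |∫ x in Set.Ioi 0, (S x * K₂ x - R x * K₂ x)| ≤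
      ∫ x in Set.Ioi 0, ε * (7 / 4) * E x ^ 2 := by
    refine abs_integral_le_integral_abs.trans ?_
    refine setIntegral_mono_on (i2.sub i1).abs (hE.const_mul _) measurableSet_Ioi fun x hx => ?_
    have hx' := hRS x (le_of_lt hx)
    -- Uses 3 ≤ (7/4)²; the other factor 2√2 of the bound is the integral of E² over the half-line.
    have hK : |K₂ x| ≤ 7 / 4 :=
      abs_le_of_sq_le_sq (by nlinarith [K_sq_add_sq_le x, sq_nonneg (K₁ x)]) (by norm_num)
    rw [← sub_mul, abs_mul]
    calc _ ≤ ε * E x ^ 2 * (7 / 4) :=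
          mul_le_mul hx' hK (abs_nonneg _) ((abs_nonneg _).trans hx')
      _ = _ := by ring
  rw [h2]
  refine h3.trans_eq ?_
  rw [integral_const_mul, integral_E_pow two_ne_zero, E_zero]; push_cast; ring

theorem sqrt2_lt : √2 < 1415 / 1000 := by
  rw [Real.sqrt_lt' (by norm_num)]; norm_num

theorem lt_sqrt2 : 1414 / 1000 < √2 := by
  rw [Real.lt_sqrt (by norm_num)]; norm_num

theorem pφD_zero : quot pφD 4 0 = 41039 / 16 := by
  rw [quot, E_zero]; norm_num [pφD]

theorem pφN_zero : quot pφN 4 0 = -7053 / 4 := by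
  rw [quot, E_zero]; norm_num [pφN]

/-- The central value is −4·41039/1600000 ≈ −0.1026, with error below 0.001. The pairing is thus
bounded away from zero, which is the nonvanishing claim. -/
theorem integral_srcD_bounds : -(1036 / 10000) ≤ ∫ x in Set.Ioi 0, srcD x * K₂ x ∧
    ∫ x in Set.Ioi 0, srcD x * K₂ x ≤ -(1016 / 10000) := by
  have h := decayingSol_D.abs_integral_mul_K₂_le integrable_srcD fun x => abs_srcD_sub_resD
  rw [pφD_zero, abs_le] at h
  have := sqrt2_lt
  constructor <;> linarith [h.1, h.2]

theorem integral_srcN_bounds : 697 / 10000 ≤ ∫ x in Set.Ioi 0, srcN x * K₂ x ∧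
    ∫ x in Set.Ioi 0, srcN x * K₂ x ≤ 713 / 10000 := by
  have h := decayingSol_N.abs_integral_mul_K₂_le integrable_srcN fun x => abs_srcN_sub_resN
  rw [pφN_zero, abs_le] at h
  have := sqrt2_lt
  constructor <;> linarith [h.1, h.2]

theorem pair_D : pair (fun x => deriv ψ x * f x) imk =
    9 * √2 / 4 * ∫ x in Set.Ioi 0, srcD x * K₂ x := by
  have h : pair (fun x => deriv ψ x * f x) imk = 9 * √2 / 8 * ∫ x, srcD x * K₂ x := by
    rw [pair, ← integral_const_mul]
    congr 1; funext x
    rw [deriv_ψ, f_eq, imk_eq, srcD]; ring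
  rw [h, integral_of_even fun x => by rw [srcD_neg, K₂_neg]; ring]
  ring

theorem pair_N : pair (fun x => ψ x * deriv f x + 1 / 2 * deriv ψ x * f x) imk =
    9 * √2 / 4 * ∫ x in Set.Ioi 0, srcN x * K₂ x := by
  have h : pair (fun x => ψ x * deriv f x + 1 / 2 * deriv ψ x * f x) imk =
      9 * √2 / 8 * ∫ x, srcN x * K₂ x := by
    rw [pair, ← integral_const_mul]
    congr 1; funext x
    rw [deriv_ψ, deriv_f, f_eq, imk_eq, srcN]; ring
  rw [h, integral_of_even fun x => by rw [srcN_neg, K₂_neg]; ring]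
  ring

theorem pair_D_ne_zero : pair (fun x => deriv ψ x * f x) imk ≠ 0 := by
  rw [pair_D]
  have h := integral_srcD_bounds.2
  have := sqrt2_pos
  exact (mul_neg_of_pos_of_neg (by positivity) (by linarith)).ne

/-- The solvability condition: the source with parameter a is orthogonal to Im k. -/
theorem a_mul : a * (∫ x in Set.Ioi 0, srcD x * K₂ x) = -∫ x in Set.Ioi 0, srcN x * K₂ x := by
  have h := integral_srcD_bounds.2
  have := sqrt2_pos
  have h' : (∫ x in Set.Ioi 0, srcD x * K₂ x) ≠ 0 := by linarith
  rw [a, pair_D, pair_N]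
  field_simp

theorem a_bounds : 67 / 100 ≤ a ∧ a ≤ 702 / 1000 := by
  have h := a_mul
  have h1 := integral_srcD_bounds
  have h2 := integral_srcN_bounds
  constructor <;> nlinarith [h1.1, h1.2, h2.1, h2.2]

end Phi4Kink

namespace Phi4Kink

open Filter Topology

/-! ### Lower bounds of integrals by piecewise polynomials in a decaying exponential -/

theorem exists_exp_neg_eq {c q : ℝ} (hc : 0 < c) (hq : 0 < q) (hq1 : q ≤ 1) :
    ∃ x, 0 ≤ x ∧ Real.exp (-(c * x)) = q := by
  refine ⟨-(Real.log q) / c, div_nonneg (by have := Real.log_nonpos hq.le hq1; linarith) hc.le, ?_⟩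
  rw [mul_div_cancel₀ _ hc.ne', neg_neg, Real.exp_log hq]

theorem exp_neg_anti {c x y : ℝ} (hc : 0 < c) (h : x ≤ y) :
    Real.exp (-(c * y)) ≤ Real.exp (-(c * x)) :=
  Real.exp_le_exp.2 (by nlinarith)

theorem le_of_exp_neg {c x y : ℝ} (hc : 0 < c)
    (h : Real.exp (-(c * y)) ≤ Real.exp (-(c * x))) : x ≤ y := by
  have := Real.exp_le_exp.1 h
  nlinarith

/-- A polynomial minorant in exp(−cz) integrates exactly through an Euler primitive, turning the
bound into a rational evaluation at the end points. -/
theorem le_intervalIntegral_of_ev_le {F : ℝ → ℝ} {p P : List ℤ} {N : ℤ} (hN : N ≠ 0)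
    (hP : pD P = psmul N p) {c : ℝ} (hc : 0 < c) {x y : ℝ} (hxy : x ≤ y) {M : ℝ}
    (hF : IntervalIntegrable F volume x y)
    (h : ∀ z ∈ Set.Icc x y, M * ev p (Real.exp (-(c * z))) ≤ F z) :
    M * ((ev P (Real.exp (-(c * x))) - ev P (Real.exp (-(c * y)))) / (c * N)) ≤
      ∫ z in x..y, F z := by
  rw [← integral_ev_exp hN hP hc.ne', ← intervalIntegral.integral_const_mul]
  exact intervalIntegral.integral_mono_on hxy
    (((continuous_ev_exp p c).const_mul M).intervalIntegrable _ _) hF h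

theorem le_integral_Ioi_of_ev_le {F : ℝ → ℝ} {p P : List ℤ} {N : ℤ} (hN : N ≠ 0)
    (hP : pD P = psmul N p) (hp0 : ev p 0 = 0) (hP0 : ev P 0 = 0) {c : ℝ} (hc : 0 < c)
    {x : ℝ} (hx : 0 ≤ x) {M : ℝ} (hF : IntegrableOn F (Set.Ioi x))
    (h : ∀ z, x ≤ z → M * ev p (Real.exp (-(c * z))) ≤ F z) :
    M * (ev P (Real.exp (-(c * x))) / (c * N)) ≤ ∫ z in Set.Ioi x, F z := by
  rw [← integral_Ioi_ev_exp hN hP hP0 hc hx, ← integral_const_mul]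
  exact setIntegral_mono_on ((integrableOn_ev hc hp0 hx).const_mul M) hF measurableSet_Ioi
    fun z hz => h z (le_of_lt hz)

/-! ### Polynomial minorants of the products with the approximate solutions -/

/-- `10 ^ 5` times the numerator of `fh`. -/
def fnum (b : ℤ) : List ℤ :=
  pmul (psmul 2 (pX 4)) (pmul pM
    (padd (psmul 200000 (pmul (pX 4) (ppow pM 2))) (psmul (-b) (ppow pQ 3))))

/-- The polynomial whose positivity makes `q` a minorant of a product with `fh`. -/
def minorant (b : ℤ) (p q : List ℤ) : List ℤ :=
  padd (pmul (fnum b) p) (psmul (-10000) (pmul q (ppow pQ 9)))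

theorem ev_fnum (b : ℤ) (x : ℝ) : ev (fnum b) x = 2 * x ^ 4 * ((1 - x ^ 8) *
    (200000 * (x ^ 4 * (1 - x ^ 8) ^ 2) - b * (1 + x ^ 8) ^ 3)) := by
  simp only [fnum, ev_padd, ev_psmul, ev_pmul, ev_pX, ev_ppow, ev_pQ, ev_pM]
  push_cast; ring

theorem minorant_le {p q : List ℤ} {lo hi d : ℤ} (hd : 0 < d) (hlt : lo < hi)
    (hc : ∀ b ∈ [29451, 29453], nonnegOn (minorant b p q) 6 lo hi d = true) {x : ℝ}
    (hlo : (lo : ℝ) ≤ d * E x) (hhi : d * E x ≤ hi) :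
    1 / 1000000 * ev q (E x) ≤ fh x * (1 / 100000 * quot p 4 x) := by
  have hE := E_pos x
  have hc' : ∀ b ∈ [(29451 : ℤ), 29453], 0 ≤ ev (minorant b p q) (E x) := fun b hb =>
    ev_nonneg_of_nonnegOn hd hlt (hc b hb) hlo hhi
  simp only [minorant, ev_padd, ev_psmul, ev_pmul, ev_fnum, ev_ppow, ev_pQ] at hc'
  have h := affine_nonneg (F := fun t => 2 * E x ^ 4 * ((1 - E x ^ 8) *
    (200000 * (E x ^ 4 * (1 - E x ^ 8) ^ 2) - t * (1 + E x ^ 8) ^ 3)) * ev p (E x) -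
    10000 * (ev q (E x) * (1 + E x ^ 8) ^ 9)) (fun t => by ring)
    (a := 29451) (b := 29453) (t := 100000 * bc)
    ((hc' 29451 (by simp)).trans_eq (by push_cast; ring))
    ((hc' 29453 (by simp)).trans_eq (by push_cast; ring)) bc_bounds.1 bc_bounds.2
  have hpos : 0 < 10000000000 * (1 + E x ^ 8) ^ 9 := by positivity
  refine le_of_sub_nonneg (le_of_mul_le_mul_right ?_ hpos)
  rw [zero_mul]
  refine h.trans_eq ?_
  rw [fh_eq_E, quot]; field_simp; ring

/-- Minorant on `[0, 1/2]` for the source `ψ f' + ψ' f / 2`, times `10 ^ 6`. -/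
def minorN1 : List ℤ := [0, 0, -75, 2736, -37883, 160251, -182338, 0]

/-- Multiple of a primitive of `minorN1` for the Euler operator. -/
def primN1 : List ℤ := [0, 0, -2250, 54720, -568245, 1923012, -1823380]

/-- Minorant on `[1/2, 3/4]` for the source `ψ f' + ψ' f / 2`, times `10 ^ 6`. -/
def minorN2 : List ℤ := [0, 2067334, -18499259, 65751463, -115895153, 101196647, -34984385, 0]

/-- Multiple of a primitive of `minorN2` for the Euler operator. -/
def primN2 : List ℤ := [0, 124040040, -554977770, 1315029260, -1738427295, 1214359764, -349843850]

/-- Minorant on `[3/4, 1]` for the source `ψ f' + ψ' f / 2`, times `10 ^ 6`. -/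
def minorN3 : List ℤ := [0, 7475122930, -60563571289, 209679518532, -402104622080, 461288044872, -316554404593, 120321157815, -19541246228, 0]

/-- Multiple of a primitive of `minorN3` for the Euler operator. -/
def primN3 : List ℤ := [0, 1569775815300, -6359174985345, 14677566297240, -21110492659200, 19374097884624, -11079404160755, 3609634734450, -512957713485]

/-- Minorant on `[0, 1/2]` for the source `ψ' f`, times `10 ^ 6`. -/
def minorD1 : List ℤ := [0, 0, -26, -72, 1741, -6667, 0]

/-- Multiple of a primitive of `minorD1` for the Euler operator. -/
def primD1 : List ℤ := [0, 0, -260, -480, 8705, -26668]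

/-- Minorant on `[1/2, 3/4]` for the source `ψ' f`, times `10 ^ 6`. -/
def minorD2 : List ℤ := [0, -904056, 7508974, -24728195, 40321663, -32534283, 10386413, 0]

/-- Multiple of a primitive of `minorD2` for the Euler operator. -/
def primD2 : List ℤ := [0, -54243360, 225269220, -494563900, 604824945, -390411396, 103864130]

/-- Minorant on `[3/4, 1]` for the source `ψ' f`, times `10 ^ 6`. -/
def minorD3 : List ℤ := [0, 607066150, -5304115948, 19734312235, -40540042951, 49673449999, -36310488901, 14664447674, -2524628294, 0]

/-- Multiple of a primitive of `minorD3` for the Euler operator. -/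
def primD3 : List ℤ := [0, 254967783000, -1113864349080, 2762803712900, -4256704509855, 4172569799916, -2541734223070, 879866860440, -132542985435]

set_option maxRecDepth 100000 in
theorem minorN1_check : ∀ b ∈ [29451, 29453],
    nonnegOn (minorant b pφN minorN1) 6 0 1 2 = true := by decide +kernel

set_option maxRecDepth 100000 in
theorem minorN2_check : ∀ b ∈ [29451, 29453],
    nonnegOn (minorant b pφN minorN2) 6 2 3 4 = true := by decide +kernel

set_option maxRecDepth 100000 in
theorem minorN3_check : ∀ b ∈ [29451, 29453],
    nonnegOn (minorant b pφN minorN3) 6 3 4 4 = true := by decide +kernel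

set_option maxRecDepth 100000 in
theorem minorD1_check : ∀ b ∈ [29451, 29453],
    nonnegOn (minorant b pφD minorD1) 6 0 1 2 = true := by decide +kernel

set_option maxRecDepth 100000 in
theorem minorD2_check : ∀ b ∈ [29451, 29453],
    nonnegOn (minorant b pφD minorD2) 6 2 3 4 = true := by decide +kernel

set_option maxRecDepth 100000 in
theorem minorD3_check : ∀ b ∈ [29451, 29453],
    nonnegOn (minorant b pφD minorD3) 6 3 4 4 = true := by decide +kernel

set_option maxRecDepth 100000 in
theorem fh_le_check : ∀ σ ∈ [1, -1], ∀ b ∈ [29451, 29453],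
    nonnegOn (padd (psmul 7000 (ppow pQ 5)) (psmul σ (fnum b))) 6 0 1 1 = true := by decide +kernel

theorem abs_fh_le {x : ℝ} (hx : 0 ≤ x) : |fh x| ≤ 7 / 100 := by
  have hE := E_pos x
  have key : ∀ σ ∈ [(1 : ℤ), -1], 0 ≤ 7 / 100 + σ * fh x := by
    intro σ hσ
    have hc : ∀ b ∈ [(29451 : ℤ), 29453],
        0 ≤ ev (padd (psmul 7000 (ppow pQ 5)) (psmul σ (fnum b))) (E x) := fun b hb =>
      ev_nonneg_of_nonnegOn one_pos one_pos (fh_le_check σ hσ b hb) (by simpa using hE.le)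
        (by simpa using E_le_one hx)
    simp only [ev_padd, ev_psmul, ev_fnum, ev_ppow, ev_pQ] at hc
    have h := affine_nonneg (F := fun t => 7000 * (1 + E x ^ 8) ^ 5 + σ * (2 * E x ^ 4 *
      ((1 - E x ^ 8) * (200000 * (E x ^ 4 * (1 - E x ^ 8) ^ 2) - t * (1 + E x ^ 8) ^ 3))))
      (fun t => by ring) (a := 29451) (b := 29453) (t := 100000 * bc)
      ((hc 29451 (by simp)).trans_eq (by push_cast; ring))
      ((hc 29453 (by simp)).trans_eq (by push_cast; ring)) bc_bounds.1 bc_bounds.2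
    have hpos : 0 < 100000 * (1 + E x ^ 8) ^ 5 := by positivity
    refine le_of_mul_le_mul_right ?_ hpos
    rw [zero_mul]
    refine h.trans_eq ?_
    rw [fh_eq_E]; field_simp; ring
  have h1 := key 1 (by simp)
  have h2 := key (-1) (by simp)
  push_cast at h1 h2
  rw [abs_le]; constructor <;> linarith

theorem integrable_fh : Integrable fh := by
  obtain ⟨F, hF⟩ := exists_schwartz_fh
  rw [← hF]; exact F.integrable

theorem integrableOn_fh_mul_quot (p : List ℤ) :
    IntegrableOn (fun x => fh x * (1 / 100000 * quot p 4 x)) (Set.Ioi 0) := by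
  obtain ⟨C, hC⟩ := isCompact_Icc.exists_bound_of_continuousOn
    (f := fun t => 1 / 100000 * (ev p t / (1 + t ^ 8) ^ 4)) (s := Set.Icc (0 : ℝ) 1) (by
      refine ContinuousOn.mul continuousOn_const
        ((continuous_ev p).continuousOn.div (by fun_prop) fun t _ => ?_)
      positivity)
  refine Integrable.mul_bdd (c := C) integrable_fh.integrableOn
    ((continuous_quot p 4).const_mul _).aestronglyMeasurable ?_
  exact (ae_restrict_iff' measurableSet_Ioi).2 (Eventually.of_forall fun x hx =>
    hC _ ⟨(E_pos x).le, E_le_one (le_of_lt hx)⟩)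

theorem integral_fh_mul_N :
    4 * √2 * (625 / 1000000) ≤ ∫ x in Set.Ioi 0, fh x * (1 / 100000 * quot pφN 4 x) := by
  have hs := sqrt2_pos
  have hc : 0 < √2 / 8 := by positivity
  obtain ⟨x₁, h1, e1⟩ := exists_exp_neg_eq hc (q := 3 / 4) (by norm_num) (by norm_num)
  obtain ⟨x₂, h2, e2⟩ := exists_exp_neg_eq hc (q := 1 / 2) (by norm_num) (by norm_num)
  have h12 : x₁ ≤ x₂ := le_of_exp_neg hc (by rw [e1, e2]; norm_num)
  have hi := integrableOn_fh_mul_quot pφN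
  have i1 := hi.mono_set (Set.Ioi_subset_Ioi h1)
  have i2 := hi.mono_set (Set.Ioi_subset_Ioi h2)
  have ii : ∀ x y, 0 ≤ x → x ≤ y → IntervalIntegrable
      (fun x => fh x * (1 / 100000 * quot pφN 4 x)) volume x y := fun x y hx hxy =>
    (intervalIntegrable_iff_integrableOn_Ioc_of_le hxy).2
      (hi.mono_set fun z hz => lt_of_le_of_lt hx hz.1)
  -- The primitive relation is an equality of lists. Since `pD` lengthens a list by one, the
  -- minorants carry a final zero coefficient. The breakpoints are E = 3/4 and E = 1/2.
  have b1 := le_intervalIntegral_of_ev_le (p := minorN3) (P := primN3) (N := 210)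
    (by norm_num) (by decide) hc h1 (M := 1 / 1000000) (ii 0 x₁ le_rfl h1) fun z hz => by
      refine minorant_le (by norm_num) (by norm_num) minorN3_check ?_ ?_
      · have := exp_neg_anti hc hz.2
        rw [e1] at this; push_cast; unfold E; linarith
      · have := E_le_one hz.1
        push_cast; linarith
  have b2 := le_intervalIntegral_of_ev_le (p := minorN2) (P := primN2) (N := 60)
    (by norm_num) (by decide) hc h12 (M := 1 / 1000000) (ii x₁ x₂ h1 h12) fun z hz => by
      refine minorant_le (by norm_num) (by norm_num) minorN2_check ?_ ?_
      · have := exp_neg_anti hc hz.2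
        rw [e2] at this; push_cast; unfold E; linarith
      · have := exp_neg_anti hc hz.1
        rw [e1] at this; push_cast; unfold E; linarith
  have b3 := le_integral_Ioi_of_ev_le (p := minorN1) (P := primN1) (N := 60)
    (by norm_num) (by decide) (by simp [minorN1]) (by simp [primN1]) hc h2
    (M := 1 / 1000000) i2 fun z hz => by
      refine minorant_le (by norm_num) (by norm_num) minorN1_check ?_ ?_
      · have := E_pos z
        push_cast; linarith
      · have := exp_neg_anti hc hz
        rw [e2] at this; push_cast; unfold E; linarith
  have e0 : Real.exp (-(√2 / 8 * 0)) = 1 := by simp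
  rw [e0, e1] at b1
  rw [e1, e2] at b2
  rw [e2] at b3
  have s1 := intervalIntegral.integral_interval_add_Ioi i1 i2
  have s0 := intervalIntegral.integral_interval_add_Ioi hi i1
  have hq : ∀ X N : ℝ, X / (√2 / 8 * N) = 4 * √2 * (X / N) := by
    intro X N
    rw [div_mul_eq_div_div, div_div_eq_mul_div, div_eq_mul_inv (X * 8), inv_sqrt2]; ring
  rw [hq] at b1 b2 b3
  norm_num [ev_cons, ev_nil, primN1, primN2, primN3] at b1 b2 b3
  linarith

theorem integral_fh_mul_D :
    4 * √2 * (-(131 / 1000000)) ≤ ∫ x in Set.Ioi 0, fh x * (1 / 100000 * quot pφD 4 x) := by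
  have hs := sqrt2_pos
  have hc : 0 < √2 / 8 := by positivity
  obtain ⟨x₁, h1, e1⟩ := exists_exp_neg_eq hc (q := 3 / 4) (by norm_num) (by norm_num)
  obtain ⟨x₂, h2, e2⟩ := exists_exp_neg_eq hc (q := 1 / 2) (by norm_num) (by norm_num)
  have h12 : x₁ ≤ x₂ := le_of_exp_neg hc (by rw [e1, e2]; norm_num)
  have hi := integrableOn_fh_mul_quot pφD
  have i1 := hi.mono_set (Set.Ioi_subset_Ioi h1)
  have i2 := hi.mono_set (Set.Ioi_subset_Ioi h2)
  have ii : ∀ x y, 0 ≤ x → x ≤ y → IntervalIntegrable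
      (fun x => fh x * (1 / 100000 * quot pφD 4 x)) volume x y := fun x y hx hxy =>
    (intervalIntegrable_iff_integrableOn_Ioc_of_le hxy).2
      (hi.mono_set fun z hz => lt_of_le_of_lt hx hz.1)
  have b1 := le_intervalIntegral_of_ev_le (p := minorD3) (P := primD3) (N := 420)
    (by norm_num) (by decide) hc h1 (M := 1 / 1000000) (ii 0 x₁ le_rfl h1) fun z hz => by
      refine minorant_le (by norm_num) (by norm_num) minorD3_check ?_ ?_
      · have := exp_neg_anti hc hz.2
        rw [e1] at this; push_cast; unfold E; linarith
      · have := E_le_one hz.1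
        push_cast; linarith
  have b2 := le_intervalIntegral_of_ev_le (p := minorD2) (P := primD2) (N := 60)
    (by norm_num) (by decide) hc h12 (M := 1 / 1000000) (ii x₁ x₂ h1 h12) fun z hz => by
      refine minorant_le (by norm_num) (by norm_num) minorD2_check ?_ ?_
      · have := exp_neg_anti hc hz.2
        rw [e2] at this; push_cast; unfold E; linarith
      · have := exp_neg_anti hc hz.1
        rw [e1] at this; push_cast; unfold E; linarith
  have b3 := le_integral_Ioi_of_ev_le (p := minorD1) (P := primD1) (N := 20)
    (by norm_num) (by decide) (by simp [minorD1]) (by simp [primD1]) hc h2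
    (M := 1 / 1000000) i2 fun z hz => by
      refine minorant_le (by norm_num) (by norm_num) minorD1_check ?_ ?_
      · have := E_pos z
        push_cast; linarith
      · have := exp_neg_anti hc hz
        rw [e2] at this; push_cast; unfold E; linarith
  have e0 : Real.exp (-(√2 / 8 * 0)) = 1 := by simp
  rw [e0, e1] at b1
  rw [e1, e2] at b2
  rw [e2] at b3
  have s1 := intervalIntegral.integral_interval_add_Ioi i1 i2
  have s0 := intervalIntegral.integral_interval_add_Ioi hi i1
  have hq : ∀ X N : ℝ, X / (√2 / 8 * N) = 4 * √2 * (X / N) := by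
    intro X N
    rw [div_mul_eq_div_div, div_div_eq_mul_div, div_eq_mul_inv (X * 8), inv_sqrt2]; ring
  rw [hq] at b1 b2 b3
  norm_num [ev_cons, ev_nil, primD1, primD2, primD3] at b1 b2 b3
  linarith

/-! ### The solution g, normalized by 9√2/8, and the lower bound of ⟨f, g⟩. -/

/-- `ψ f' + (a + 1/2) ψ' f` up to the factor `9 √2 / 8`. -/
noncomputable def src (x : ℝ) : ℝ := srcN x + a * srcD x

theorem exists_schwartz_src : ∃ F : 𝓢(ℝ, ℝ), ⇑F = src := by
  obtain ⟨F, hF⟩ := exists_schwartz_srcN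
  obtain ⟨G, hG⟩ := exists_schwartz_srcD
  exact ⟨F + a • G, by funext x; simp [hF, hG, src]⟩

theorem src_neg (x : ℝ) : src (-x) = -src x := by
  simp only [src, srcN_neg, srcD_neg]; ring

theorem integral_of_odd {F : ℝ → ℝ} (hF : ∀ x, F (-x) = -F x) : ∫ x, F x = 0 := by
  have h := integral_neg_eq_self F volume
  simp only [hF, integral_neg] at h
  linarith

/-- Orthogonality to K₁ is parity; orthogonality to K₂ is the choice of a. -/
theorem exists_ghat :
    ∃ g : 𝓢(ℝ, ℝ), ∀ x, -deriv (deriv g) x - (4 + 3 * sx x ^ 2) * g x = src x := by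
  obtain ⟨F, hF⟩ := exists_schwartz_src
  rsuffices ⟨h₁, h₂⟩ : ∫ x, K₁ x * F x = 0 ∧ ∫ x, K₂ x * F x = 0
  · obtain ⟨g, hg⟩ := exists_schwartz_sol F h₁ h₂
    exact ⟨g, fun x => by rw [hg, hF]⟩
  constructor
  · rw [hF]; exact integral_of_odd fun x => by rw [K₁_neg, src_neg]; ring
  · rw [hF, integral_of_even fun x => by rw [K₂_neg, src_neg]; ring]
    have i1 := DecayingSol.integrable_mul_comb (x₀ := 0) integrable_srcN.integrableOn 0 1
    have i2 := DecayingSol.integrable_mul_comb (x₀ := 0) integrable_srcD.integrableOn 0 1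
    simp only [zero_mul, one_mul, zero_add] at i1 i2
    have e : ∀ x, K₂ x * src x = srcN x * K₂ x + a * (srcD x * K₂ x) := fun x => by
      rw [src]; ring
    simp only [e]
    rw [integral_add i1 (i2.const_mul a), integral_const_mul, a_mul]; ring

section ghat

variable {g : 𝓢(ℝ, ℝ)} (hg : ∀ x, -deriv (deriv g) x - (4 + 3 * sx x ^ 2) * g x = src x)
include hg

/-- The function −g(−x) solves the same equation because the source is odd, so uniqueness applies.
-/
theorem ghat_neg (x : ℝ) : g (-x) = -g x := by
  obtain ⟨F, hF⟩ := exists_schwartz_src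
  let r : 𝓢(ℝ, ℝ) := -(SchwartzMap.compCLMOfContinuousLinearEquiv ℝ
    (ContinuousLinearEquiv.neg ℝ : ℝ ≃L[ℝ] ℝ) g)
  have hr : ⇑r = fun x => -g (-x) := by funext x; simp [r]
  have hd : deriv r = fun x => deriv g (-x) := by
    rw [hr]; funext x
    rw [deriv.fun_neg, deriv_comp_neg, neg_neg]
  have h : r = g := by
    refine schwartz_sol_unique (g := g) (R := src) (by rw [← hF]; exact F.integrable) hg fun x => ?_
    have h2 : deriv (deriv r) x = -deriv (deriv g) (-x) := by rw [hd, deriv_comp_neg]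
    rw [h2, hr]
    have := hg (-x)
    rw [src_neg, sx_neg] at this
    linarith
  have := congrArg (fun u : 𝓢(ℝ, ℝ) => u x) h
  simp only [hr] at this
  linarith

/-- The difference is a decaying solution on x ≥ 0 whose source is the combined residual, at most
(0.00015 + 0.0002a)E². The stability estimate multiplies this by ½·2√2, and a ≤ 0.702 gives 0.00042.
-/
theorem abs_ghat_sub_le {x : ℝ} (hx : 0 ≤ x) :
    |g x - 1 / 100000 * quot pφN 4 x - a * (1 / 100000 * quot pφD 4 x)| ≤
      42 / 100000 * E x ^ 2 := by
  obtain ⟨F, hF⟩ := exists_schwartz_src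
  have hi : Integrable src := by rw [← hF]; exact F.integrable
  have h := ((decayingSol_of_schwartz hi hg 0).add ((decayingSol_N.const_mul (-1)).add
    (decayingSol_D.const_mul (-a)))).mono hx
  have h1 := h.abs_le_integral
  have hE := (integrableOn_E_pow two_ne_zero x).const_mul (15 / 100000 + a * (2 / 10000))
  have ha := a_bounds
  have h2 : ∫ z in Set.Ioi x, |src z + (-1 * resN z + -a * resD z)| ≤
      ∫ z in Set.Ioi x, (15 / 100000 + a * (2 / 10000)) * E z ^ 2 := by
    refine setIntegral_mono_on h.integrable.abs hE measurableSet_Ioi fun z hz => ?_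
    have hz' : 0 ≤ z := hx.trans (le_of_lt hz)
    have hD := abs_srcD_sub_resD hz'
    have hN := abs_srcN_sub_resN hz'
    have e : src z + (-1 * resN z + -a * resD z) = (srcN z - resN z) + a * (srcD z - resD z) := by
      rw [src]; ring
    rw [e]
    refine (abs_add_le _ _).trans ?_
    rw [abs_mul, abs_of_nonneg (by linarith : 0 ≤ a)]
    nlinarith
  rw [integral_const_mul, integral_E_pow two_ne_zero] at h2
  have e : g x - 1 / 100000 * quot pφN 4 x - a * (1 / 100000 * quot pφD 4 x) =
      g x + (-1 * (1 / 100000 * quot pφN 4 x) + -a * (1 / 100000 * quot pφD 4 x)) := by ring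
  rw [e]
  refine h1.trans ?_
  have hE2 : 0 ≤ E x ^ 2 := sq_nonneg _
  have hs := sqrt2_lt
  have hs0 := sqrt2_pos
  push_cast at h2
  have h3 : (15 / 100000 + a * (2 / 10000)) * √2 ≤ 42 / 100000 := by nlinarith
  nlinarith [mul_le_mul_of_nonneg_right h3 hE2]

/-- The mean value `⟨f, g⟩`, up to the factor `81 / 32`, is not too small. -/
theorem integral_fh_mul_ghat : 58 / 10000 ≤ ∫ x, fh x * g x := by
  rw [integral_of_even fun x => by rw [fh_neg, ghat_neg hg]; ring]
  have hN := integral_fh_mul_N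
  have hD := integral_fh_mul_D
  have iN := integrableOn_fh_mul_quot pφN
  have iD := integrableOn_fh_mul_quot pφD
  have iE := integrableOn_E_pow two_ne_zero 0
  have ha := a_bounds
  obtain ⟨G, hG⟩ := exists_schwartz_fh
  have ig : Integrable fun x => fh x * g x := by
    rw [← hG]
    obtain ⟨G', hG'⟩ := exists_schwartz_mul G.hasTemperateGrowth g
    rw [← hG']; exact G'.integrable
  -- Replacing g by its approximation costs at most 0.07·0.00042·E², by the uniform bound on `fh`.
  have h : ∫ x in Set.Ioi 0, (fh x * (1 / 100000 * quot pφN 4 x) +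
      a * (fh x * (1 / 100000 * quot pφD 4 x)) - 7 / 100 * (42 / 100000) * E x ^ 2) ≤
      ∫ x in Set.Ioi 0, fh x * g x := by
    refine setIntegral_mono_on ((iN.add (iD.const_mul a)).sub (iE.const_mul _)) ig.integrableOn
      measurableSet_Ioi fun x hx => ?_
    have h1 := abs_ghat_sub_le hg (le_of_lt hx)
    have h2 := abs_fh_le (le_of_lt hx)
    have h3 := mul_le_mul h2 h1 (abs_nonneg _) (by norm_num)
    rw [← abs_mul] at h3
    have h4 := (abs_le.1 h3).1
    linarith
  have e := integral_sub (iN.add (iD.const_mul a)) (iE.const_mul (7 / 100 * (42 / 100000)))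
  have e' := integral_add iN (iD.const_mul a)
  simp only [Pi.add_apply] at e
  rw [e, e', integral_const_mul, integral_const_mul, integral_E_pow two_ne_zero, E_zero] at h
  have hs := lt_sqrt2
  have hs2 := sqrt2_lt
  have h5 := mul_le_mul_of_nonneg_left hD (by linarith : 0 ≤ a)
  have h6 : -(702 / 1000 * (√2 * (131 / 1000000))) ≤ a * (√2 * -(131 / 1000000)) := by
    nlinarith [mul_nonneg (sub_nonneg.2 ha.2) sqrt2_pos.le]
  push_cast at h
  linarith

end ghat

end Phi4Kink

namespace Phi4Kink

open Filter Topology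

/-! ### A completed-square identity on an interval -/

/-- Lower bound of the quadratic integrand by an exact derivative, with a positive supersolution
`θ` and a corrector `u`. -/
theorem integrand_ge {v W U Z h g θ θ' θ'' u u' u'' m b σ τ γ : ℝ} (hθ : 0 < θ)
    (hg : g ≤ -θ'' - U * θ) (hh : |h| ≤ g) (hu : |-u'' - U * u - σ * Z| ≤ 1 / 2 * g)
    (hm : m ≤ u' ^ 2 - U * u ^ 2 - 2 * σ * u * Z) (hb : |u| ≤ b) :
    (θ'' * θ - θ' ^ 2) / θ ^ 2 * (W - τ * u) ^ 2 +
        θ' / θ * (2 * (W - τ * u) * (v - τ * u')) +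
        2 * τ * ((v - τ * u') * u' + (W - τ * u) * u'') ≤
      v ^ 2 - U * W ^ 2 + 2 * γ * (W * h) - 2 * σ * τ * (W * Z) +
        (1 / 2 * |τ| + |γ|) ^ 2 * (g * θ) - τ ^ 2 * m + 2 * |γ * τ| * (b * g) := by
  set y := W - τ * u with hy
  have hW : W = y + τ * u := by rw [hy]; ring
  have hg0 : 0 ≤ g := (abs_nonneg _).trans hh
  -- Jacobi's factorization for y = W − τu: subtracting the derivative of (θ'/θ)y² leaves a perfect
  -- square and the supersolution term, while the derivative of 2τyu' moves the cross term onto the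
  -- equation for u.
  have e1 : v ^ 2 - U * W ^ 2 + 2 * γ * (W * h) - 2 * σ * τ * (W * Z) -
      ((θ'' * θ - θ' ^ 2) / θ ^ 2 * y ^ 2 + θ' / θ * (2 * y * (v - τ * u')) +
        2 * τ * ((v - τ * u') * u' + y * u'')) =
      (v - τ * u' - θ' / θ * y) ^ 2 + (-θ'' - U * θ) / θ * y ^ 2 +
        2 * y * (τ * (-u'' - U * u - σ * Z) + γ * h) +
        τ ^ 2 * (u' ^ 2 - U * u ^ 2 - 2 * σ * u * Z) + 2 * (γ * τ) * (u * h) := by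
    rw [hW]; field_simp; ring
  have h1 : g / θ * y ^ 2 ≤ (-θ'' - U * θ) / θ * y ^ 2 := by gcongr
  have h2 : |y * (τ * (-u'' - U * u - σ * Z) + γ * h)| ≤ |y| * ((1 / 2 * |τ| + |γ|) * g) := by
    rw [abs_mul]
    refine mul_le_mul_of_nonneg_left ((abs_add_le _ _).trans ?_) (abs_nonneg _)
    rw [abs_mul, abs_mul]
    nlinarith [mul_le_mul_of_nonneg_left hu (abs_nonneg τ),
      mul_le_mul_of_nonneg_left hh (abs_nonneg γ)]
  have h3 : |(γ * τ) * (u * h)| ≤ |γ * τ| * (b * g) := by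
    rw [abs_mul, abs_mul u]
    exact mul_le_mul_of_nonneg_left (mul_le_mul hb hh (abs_nonneg _) ((abs_nonneg _).trans hb))
      (abs_nonneg _)
  -- The terms linear in y are absorbed by completing the square in |y|, at the price (|τ|/2 + |γ|)²
  -- gθ.
  have h4 : 0 ≤ g / θ * y ^ 2 - 2 * (|y| * ((1 / 2 * |τ| + |γ|) * g)) +
      (1 / 2 * |τ| + |γ|) ^ 2 * (g * θ) := by
    have : g / θ * y ^ 2 - 2 * (|y| * ((1 / 2 * |τ| + |γ|) * g)) +
        (1 / 2 * |τ| + |γ|) ^ 2 * (g * θ) = g / θ * (|y| - (1 / 2 * |τ| + |γ|) * θ) ^ 2 := by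
      rw [← sq_abs y]; field_simp; ring
    rw [this]; positivity
  have h5 := mul_le_mul_of_nonneg_left hm (sq_nonneg τ)
  have h6 := sq_nonneg (v - τ * u' - θ' / θ * y)
  linarith [(abs_le.1 h2).1, (abs_le.1 h3).1]

/-- A positive supersolution `θ` and a corrector `u` on the set `s`, with a weight `g`, a lower
bound `m` of the energy density of `u`, and a bound `b` of `u`. -/
structure Comparison (U Z h : ℝ → ℝ) (σ : ℝ) (g θ θ' θ'' u u' u'' m b : ℝ → ℝ) (s : Set ℝ) :
    Prop where
  cg : Continuous g
  cm : Continuous m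
  cb : Continuous b
  dθ : ∀ x, HasDerivAt θ (θ' x) x
  dθ' : ∀ x, HasDerivAt θ' (θ'' x) x
  du : ∀ x, HasDerivAt u (u' x) x
  du' : ∀ x, HasDerivAt u' (u'' x) x
  sθ : ContDiff ℝ 1 θ
  sθ' : ContDiff ℝ 1 θ'
  su : ContDiff ℝ 1 u
  su' : ContDiff ℝ 1 u'
  hθ : ∀ x ∈ s, 0 < θ x
  hg : ∀ x ∈ s, g x ≤ -θ'' x - U x * θ x
  hh : ∀ x ∈ s, |h x| ≤ g x
  hu : ∀ x ∈ s, |-u'' x - U x * u x - σ * Z x| ≤ 1 / 2 * g x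
  hm : ∀ x ∈ s, m x ≤ u' x ^ 2 - U x * u x ^ 2 - 2 * σ * u x * Z x
  hb : ∀ x ∈ s, |u x| ≤ b x

section interval

variable {v : ℝ → ℝ} (hv : MemLp v 2)
include hv

theorem intervalIntegrable_of_memLp_two (p q : ℝ) : IntervalIntegrable v volume p q :=
  have h : LocallyIntegrable v := hv.locallyIntegrable (by norm_num)
  intervalIntegrable_iff.2
    ((h.integrableOn_isCompact isCompact_uIcc).mono_set Set.uIoc_subset_uIcc)

theorem continuous_primitive_of_memLp_two : Continuous fun x => ∫ z in (0 : ℝ)..x, v z :=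
  intervalIntegral.continuous_primitive (fun p q => intervalIntegrable_of_memLp_two hv p q) 0

theorem ac_primitive_of_memLp_two (p q : ℝ) :
    AbsolutelyContinuousOnInterval (fun x => ∫ z in (0 : ℝ)..x, v z) p q := by
  have h := (intervalIntegrable_of_memLp_two hv (min 0 (min p q)) (max 0 (max p q)))
  refine (h.absolutelyContinuousOnInterval_intervalIntegral (c := 0) ?_).mono ?_
  · rw [Set.uIcc_of_le (by simp)]; simp
  · rw [Set.uIcc_of_le (a := min 0 _) (by simp)]
    exact Set.Icc_subset_Icc (by simp) (by simp)

/-- Integration of `integrand_ge`. As W is only a primitive of an L² function, the fundamental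
theorem is applied to the absolutely continuous function (θ'/θ)y² + 2τyu'. -/
theorem Comparison.sub_le_integral {p q : ℝ} (hpq : p ≤ q)
    {U Z h g θ θ' θ'' u u' u'' m b : ℝ → ℝ} {σ : ℝ} (τ γ : ℝ)
    (cU : Continuous U) (cZ : Continuous Z) (ch : Continuous h)
    (C : Comparison U Z h σ g θ θ' θ'' u u' u'' m b (Set.Icc p q))
    {W : ℝ → ℝ} (hW : W = fun x => ∫ z in (0 : ℝ)..x, v z) :
    (θ' q / θ q * (W q - τ * u q) ^ 2 + 2 * τ * ((W q - τ * u q) * u' q)) -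
        (θ' p / θ p * (W p - τ * u p) ^ 2 + 2 * τ * ((W p - τ * u p) * u' p)) ≤
      (∫ x in p..q, (v x ^ 2 - U x * W x ^ 2 + 2 * γ * (W x * h x) -
          2 * σ * τ * (W x * Z x))) +
        (1 / 2 * |τ| + |γ|) ^ 2 * (∫ x in p..q, g x * θ x) - τ ^ 2 * (∫ x in p..q, m x) +
        2 * |γ * τ| * (∫ x in p..q, b x * g x) := by
  obtain ⟨cg, cm, cb, dθ, dθ', du, du', sθ, sθ', su, su', hθ, hg, hh, hu, hm, hb⟩ := C
  have hac : AbsolutelyContinuousOnInterval W p q := hW ▸ ac_primitive_of_memLp_two hv p q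
  have cW : Continuous W := hW ▸ continuous_primitive_of_memLp_two hv
  have hae : ∀ᵐ x : ℝ, HasDerivAt W (v x) x := by
    have h : LocallyIntegrable v := hv.locallyIntegrable (by norm_num)
    filter_upwards [LocallyIntegrable.ae_hasDerivAt_integral h] with x hx
    rw [hW]; exact hx 0
  have acu := (su.contDiffOn (s := Set.uIcc p q)).absolutelyContinuousOnInterval
  have acu' := (su'.contDiffOn (s := Set.uIcc p q)).absolutelyContinuousOnInterval
  have acq : AbsolutelyContinuousOnInterval (fun x => θ' x / θ x) p q := by
    refine ContDiffOn.absolutelyContinuousOnInterval (sθ'.contDiffOn.div sθ.contDiffOn ?_)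
    rw [Set.uIcc_of_le hpq]
    exact fun x hx => (hθ x hx).ne'
  have acy := hac.fun_sub (acu.const_mul τ)
  have acF := (acq.fun_mul (acy.fun_mul acy)).fun_add ((acy.fun_mul acu').const_mul (2 * τ))
  have hF := acF.integral_deriv_eq_sub
  have hder : ∀ᵐ x : ℝ, x ∈ Set.Icc p q → deriv (fun x => θ' x / θ x *
      ((W x - τ * u x) * (W x - τ * u x)) + 2 * τ * ((W x - τ * u x) * u' x)) x =
      (θ'' x * θ x - θ' x ^ 2) / θ x ^ 2 * (W x - τ * u x) ^ 2 +
        θ' x / θ x * (2 * (W x - τ * u x) * (v x - τ * u' x)) +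
        2 * τ * ((v x - τ * u' x) * u' x + (W x - τ * u x) * u'' x) := by
    filter_upwards [hae] with x hx hxI
    have dy := hx.sub ((du x).const_mul τ)
    have d := (((dθ' x).div (dθ x) (hθ x hxI).ne').mul (dy.mul dy)).add
      ((dy.mul (du' x)).const_mul (2 * τ))
    refine d.deriv.trans ?_
    simp only [Pi.sub_apply, Pi.div_apply, Pi.mul_apply]
    ring
  have iv2 : IntervalIntegrable (fun x => v x ^ 2) volume p q :=
    hv.integrable_sq.intervalIntegrable
  have ci : Continuous fun x => -(U x * W x ^ 2) + 2 * γ * (W x * h x) -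
      2 * σ * τ * (W x * Z x) := by fun_prop
  have i1 : IntervalIntegrable (fun x => v x ^ 2 - U x * W x ^ 2 + 2 * γ * (W x * h x) -
      2 * σ * τ * (W x * Z x)) volume p q :=
    (iv2.add (ci.intervalIntegrable p q)).congr (fun x _ => by ring)
  have cθ := sθ.continuous
  have j1 : IntervalIntegrable (fun x => (1 / 2 * |τ| + |γ|) ^ 2 * (g x * θ x)) volume p q :=
    Continuous.intervalIntegrable (by fun_prop) _ _
  have j2 : IntervalIntegrable (fun x => τ ^ 2 * m x) volume p q :=
    Continuous.intervalIntegrable (by fun_prop) _ _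
  have j3 : IntervalIntegrable (fun x => 2 * |γ * τ| * (b x * g x)) volume p q :=
    Continuous.intervalIntegrable (by fun_prop) _ _
  have hle := intervalIntegral.integral_mono_ae_restrict hpq acF.intervalIntegrable_deriv
    (((i1.add j1).sub j2).add j3) (by
      refine (ae_restrict_iff' measurableSet_Icc).2 ?_
      filter_upwards [hder] with x hx hxI
      rw [hx hxI]
      exact integrand_ge (hθ x hxI) (hg x hxI) (hh x hxI) (hu x hxI) (hm x hxI) (hb x hxI))
  rw [hF] at hle
  have s1 := intervalIntegral.integral_add ((i1.add j1).sub j2) j3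
  have s2 := intervalIntegral.integral_sub (i1.add j1) j2
  have s3 := intervalIntegral.integral_add i1 j1
  rw [intervalIntegral.integral_const_mul] at s1 s2 s3
  have hle' := hle.trans_eq (s1.trans (congrArg₂ _ (s2.trans (congrArg₂ _ s3 rfl)) rfl))
  refine le_trans (le_of_eq ?_) hle'
  ring

/-- From |v| ≤ (1 + v²)/2. Linear growth of the primitive is enough, since it is only multiplied by
a function u₂' with x u₂' → 0. -/
theorem abs_primitive_le {X : ℝ} (hX : 0 ≤ X) :
    |∫ z in (0 : ℝ)..X, v z| ≤ X / 2 + 1 / 2 * ∫ x, v x ^ 2 := by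
  have hi := intervalIntegrable_of_memLp_two hv 0 X
  have iv2 : IntervalIntegrable (fun x => 1 / 2 * v x ^ 2) volume 0 X :=
    (hv.integrable_sq.const_mul _).intervalIntegrable
  have h1 : |∫ z in (0 : ℝ)..X, v z| ≤ ∫ z in (0 : ℝ)..X, (1 / 2 + 1 / 2 * v z ^ 2) := by
    refine (intervalIntegral.abs_integral_le_integral_abs hX).trans ?_
    refine intervalIntegral.integral_mono_on hX hi.abs
      (intervalIntegrable_const.add iv2) fun x _ => ?_
    nlinarith [sq_nonneg (|v x| - 1), sq_abs (v x)]
  rw [intervalIntegral.integral_add intervalIntegrable_const iv2,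
    intervalIntegral.integral_const_mul, intervalIntegral.integral_const, smul_eq_mul] at h1
  have h2 : ∫ z in (0 : ℝ)..X, v z ^ 2 ≤ ∫ z, v z ^ 2 := by
    rw [intervalIntegral.integral_of_le hX]
    exact setIntegral_le_integral hv.integrable_sq (Eventually.of_forall fun x => sq_nonneg _)
  linarith

/-- With τ = W(x₁), the function y = W − τu vanishes at 0 and on both sides of x₁. The boundary
terms drop there, and the two pieces need neither a common θ nor matching derivatives of u. At
infinity θ₂' ≥ 0 gives the remaining boundary term a favourable sign and the decay of u₂' removes
the other. The same σ serves both pieces so that the terms with Z add up to a multiple of ∫WZ = 0.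
-/
theorem half_line_ge {x₁ : ℝ} (hx₁ : 0 ≤ x₁) {U Z h : ℝ → ℝ} {σ : ℝ}
    {g₁ θ₁ θ₁' θ₁'' u₁ u₁' u₁'' m₁ b₁ g₂ θ₂ θ₂' θ₂'' u₂ u₂' u₂'' m₂ b₂ : ℝ → ℝ}
    (cU : Continuous U) (cZ : Continuous Z) (ch : Continuous h)
    (C₁ : Comparison U Z h σ g₁ θ₁ θ₁' θ₁'' u₁ u₁' u₁'' m₁ b₁ (Set.Icc 0 x₁))
    (C₂ : Comparison U Z h σ g₂ θ₂ θ₂' θ₂'' u₂ u₂' u₂'' m₂ b₂ (Set.Ici x₁))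
    (h10 : u₁ 0 = 0) (h11 : u₁ x₁ = 1) (h21 : u₂ x₁ = 1) (hθ₂ : ∀ x, x₁ ≤ x → 0 ≤ θ₂' x)
    (t0 : Tendsto u₂' atTop (𝓝 0)) (t1 : Tendsto (fun x => x * u₂' x) atTop (𝓝 0))
    (t2 : Tendsto (fun x => u₂ x * u₂' x) atTop (𝓝 0))
    (iM : IntegrableOn (fun x => g₂ x * θ₂ x) (Set.Ioi x₁)) (im : IntegrableOn m₂ (Set.Ioi x₁))
    (iB : IntegrableOn (fun x => b₂ x * g₂ x) (Set.Ioi x₁))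
    {W : ℝ → ℝ} (hW : W = fun x => ∫ z in (0 : ℝ)..x, v z)
    (iU : IntegrableOn (fun x => v x ^ 2 - U x * W x ^ 2) (Set.Ioi 0))
    (ih : IntegrableOn (fun x => W x * h x) (Set.Ioi 0))
    (iZ : IntegrableOn (fun x => W x * Z x) (Set.Ioi 0))
    (hZ : ∫ x in Set.Ioi 0, W x * Z x = 0) (γ : ℝ) :
    ∃ τ : ℝ, W x₁ = τ ∧ 0 ≤ (∫ x in Set.Ioi 0, (v x ^ 2 - U x * W x ^ 2)) +
      2 * γ * (∫ x in Set.Ioi 0, W x * h x) +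
      (1 / 2 * |τ| + |γ|) ^ 2 *
        ((∫ x in (0 : ℝ)..x₁, g₁ x * θ₁ x) + ∫ x in Set.Ioi x₁, g₂ x * θ₂ x) -
      τ ^ 2 * ((∫ x in (0 : ℝ)..x₁, m₁ x) + ∫ x in Set.Ioi x₁, m₂ x) +
      2 * |γ * τ| * ((∫ x in (0 : ℝ)..x₁, b₁ x * g₁ x) + ∫ x in Set.Ioi x₁, b₂ x * g₂ x) := by
  refine ⟨W x₁, rfl, ?_⟩
  set τ := W x₁ with hτ
  have hW0 : W 0 = 0 := by rw [hW]; simp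
  have e1 := C₁.sub_le_integral hv hx₁ τ γ cU cZ ch hW
  rw [h10, h11, hW0, ← hτ] at e1
  simp only [mul_zero, mul_one, sub_self, zero_mul, add_zero, ne_eq, OfNat.ofNat_ne_zero,
    not_false_eq_true, zero_pow] at e1
  have iT : IntegrableOn (fun x => v x ^ 2 - U x * W x ^ 2 + 2 * γ * (W x * h x) -
      2 * σ * τ * (W x * Z x)) (Set.Ioi 0) := (iU.add (ih.const_mul _)).sub (iZ.const_mul _)
  have iT1 := iT.mono_set (Set.Ioi_subset_Ioi hx₁)
  have lT := intervalIntegral_tendsto_integral_Ioi x₁ iT1 tendsto_id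
  have lM := intervalIntegral_tendsto_integral_Ioi x₁ iM tendsto_id
  have lm := intervalIntegral_tendsto_integral_Ioi x₁ im tendsto_id
  have lB := intervalIntegral_tendsto_integral_Ioi x₁ iB tendsto_id
  have lR := ((lT.add (lM.const_mul ((1 / 2 * |τ| + |γ|) ^ 2))).sub (lm.const_mul (τ ^ 2))).add
    (lB.const_mul (2 * |γ * τ|))
  have lW : Tendsto (fun x => W x * u₂' x) atTop (𝓝 0) := by
    have hs : Tendsto (fun x => 1 / 2 * |x * u₂' x| + (1 / 2 * ∫ x, v x ^ 2) * |u₂' x|) atTop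
        (𝓝 0) := by
      have := (t1.abs.const_mul (1 / 2)).add (t0.abs.const_mul (1 / 2 * ∫ x, v x ^ 2))
      simpa only [abs_zero, mul_zero, add_zero] using this
    refine squeeze_zero_norm' ?_ hs
    filter_upwards [eventually_ge_atTop 0] with x hx
    have := abs_primitive_le hv hx
    rw [norm_mul, Real.norm_eq_abs, Real.norm_eq_abs, abs_mul, abs_of_nonneg hx, hW]
    nlinarith [mul_le_mul_of_nonneg_right this (abs_nonneg (u₂' x))]
  have lF : Tendsto (fun x => 2 * τ * ((W x - τ * u₂ x) * u₂' x)) atTop (𝓝 0) := by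
    have := (lW.sub (t2.const_mul τ)).const_mul (2 * τ)
    simp only [mul_zero, sub_zero] at this
    exact this.congr fun x => by ring
  have e2 := le_of_tendsto_of_tendsto lF lR (by
    filter_upwards [eventually_ge_atTop x₁] with X hX
    have C₂' : Comparison U Z h σ g₂ θ₂ θ₂' θ₂'' u₂ u₂' u₂'' m₂ b₂ (Set.Icc x₁ X) :=
      { C₂ with
        hθ := fun x hx => C₂.hθ x hx.1
        hg := fun x hx => C₂.hg x hx.1
        hh := fun x hx => C₂.hh x hx.1
        hu := fun x hx => C₂.hu x hx.1
        hm := fun x hx => C₂.hm x hx.1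
        hb := fun x hx => C₂.hb x hx.1 }
    have e := C₂'.sub_le_integral hv hX τ γ cU cZ ch hW
    rw [h21, ← hτ] at e
    simp only [mul_one, sub_self, mul_zero, zero_mul, add_zero, sub_zero, ne_eq,
      OfNat.ofNat_ne_zero, not_false_eq_true, zero_pow] at e
    have hp : 0 ≤ θ₂' X / θ₂ X * (W X - τ * u₂ X) ^ 2 :=
      mul_nonneg (div_nonneg (hθ₂ X hX) (C₂.hθ X hX).le) (sq_nonneg _)
    simp only [id]
    linarith)
  have s1 := intervalIntegral.integral_interval_add_Ioi iT iT1
  have s2 := integral_sub (iU.add (ih.const_mul (2 * γ))) (iZ.const_mul (2 * σ * τ))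
  have s3 := integral_add iU (ih.const_mul (2 * γ))
  simp only [Pi.add_apply] at s2 s3
  rw [s3, integral_const_mul, integral_const_mul, hZ] at s2
  rw [s2] at s1
  linarith

end interval

end Phi4Kink

namespace Phi4Kink

open Filter Topology

/-! ### Polynomial data for the coercivity estimate -/

/-- `1 + x ^ 16`. -/
def qQ : List ℤ := padd [1] (pX 16)

/-- `1 - x ^ 16`. -/
def qM : List ℤ := padd [1] (psmul (-1) (pX 16))

/-- `1 + x ^ 2`. -/
def qC : List ℤ := [1, 0, 1]

/-- The common denominator. -/
def qCQ : List ℤ := pmul (ppow qC 2) (ppow qQ 3)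

/-- `3200` times the numerator of the potential. -/
def qU : List ℤ :=
  psmul 51 (padd (pmul (pX 2) (ppow qQ 3))
    (psmul 1536 (pmul (pmul (pX 14) (padd [1] (psmul (-1) (pX 4)))) (pmul qM (ppow qC 2)))))

/-- Numerator of the constraint function. -/
def qZ : List ℤ := pmul (pmul qM (pX 7)) (pmul (ppow qC 3) qQ)

/-- `10 ^ 5` times the numerator of `ζ fh`. -/
def qh (b : ℤ) : List ℤ :=
  pmul (psmul 4 (pX 9)) (pmul qM
    (padd (psmul 200000 (pmul (pX 8) (ppow qM 2))) (psmul (-b) (ppow qQ 3))))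

/-- Coefficients of the supersolution on the left interval, times `10 ^ 4`. -/
def pθ₁ : List ℤ := [562744805, -5177961803, 20795297027, -47607779477, 67948187270, -61905930245, 35157408981, -11378872805, 1606906267]

/-- Coefficients of the supersolution on the right interval, times `10 ^ 4`. -/
def pθ₂ : List ℤ := [2815, 0, -1542, -3703, 117514, -1619630, 12454845, -58840770, 179763314, -362329677, 478568618, -398281763, 189151689, -38978655]

/-- Coefficients of the weight on the left interval, times `10 ^ 4`. -/
def pg₁ : List ℤ := [0, -920, 1630]

/-- Coefficients of the weight on the right interval, times `10 ^ 4`. -/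
def pg₂ : List ℤ := [0, 0, 3, 0, 0, 0, 0, 0, 5910, -32540, 108620, -96060]

/-- Coefficients of the corrector on the left interval, times `10 ^ 4`. -/
def pu₁ : List ℤ := [-110476025560, 1464644949450, -8783505044330, 31462010116650, -74810059800230, 124014855004365, -146279399031100, 122788863993935, -71893463949830, 27966685655010, -6505900480685, 685744612325]

/-- Coefficients of the corrector on the right interval, times `10 ^ 4`. -/
def pu₂ : List ℤ := [784, 0, -412, 699, -33226, 714070, -8535195, 63938658, -318558628, 1094124572, -2628096680, 4409456300, -5065575017, 3797764334, -1673605967, 328478015]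

/-- Coefficients of the lower bound of the energy density of the corrector on the left interval, times `10 ^ 4`. -/
def pm₁ : List ℤ := [0, 386106450, -2243595540, 5193778450, -5987106500, 3436830270, -786013180]

/-- Coefficients of the lower bound of the energy density of the corrector on the right interval, times `10 ^ 4`. -/
def pm₂ : List ℤ := [0, 0, -1460, 43070, -545590, 2881700, -7169080, 8289790, -3547980]

/-- Coefficients of the bound of the corrector on the left interval, times `10 ^ 4`. -/
def pb₁ : List ℤ := [468146, -1004400, 540000]

/-- `3200` times the numerator of `-u'' - U u`. -/
def qA (p : List ℤ) : List ℤ :=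
  padd (psmul (-25) (pmul (pD (pD p)) qCQ)) (psmul (-1) (pmul qU p))

/-- Supersolution condition. -/
def superPoly (θ g : List ℤ) : List ℤ := padd (qA θ) (psmul (-3200) (pmul g qCQ))

/-- Condition for `g` to dominate `|ζ fh|`. -/
def weightPoly (σ b : ℤ) (g : List ℤ) : List ℤ :=
  padd (psmul 10 (pmul g (pmul qC (ppow qQ 5)))) (psmul σ (qh b))

/-- Condition for `u` to be a corrector. -/
def correctorPoly (σ : ℤ) (u g : List ℤ) : List ℤ :=
  padd (psmul 1600 (pmul g qCQ)) (psmul σ (padd (qA u) (psmul 51200000 qZ)))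

/-- Condition for `m` to be below the energy density of `u`. -/
def energyPoly (u m : List ℤ) : List ℤ :=
  padd (padd (psmul 25 (pmul (pmul (pD u) (pD u)) qCQ)) (psmul (-1) (pmul qU (pmul u u))))
    (padd (psmul 102400000 (pmul u qZ)) (psmul (-32000000) (pmul m qCQ)))

-- Subtracting 5 from the constant coefficient turns a test of nonnegativity into strict positivity
-- of θ.
theorem pθ₁_check : nonnegOn (padd pθ₁ [-5]) 7 4 5 5 = true := by decide +kernel

set_option maxRecDepth 100000 in
theorem superPoly₁_check : nonnegOn (superPoly pθ₁ pg₁) 7 4 5 5 = true := by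
  decide +kernel

set_option maxRecDepth 100000 in
theorem weightPoly₁_check : ∀ σ ∈ [1, -1], ∀ b ∈ [29451, 29453],
    nonnegOn (weightPoly σ b pg₁) 7 4 5 5 = true := by decide +kernel

set_option maxRecDepth 100000 in
theorem correctorPoly₁_check : ∀ σ ∈ [1, -1],
    nonnegOn (correctorPoly σ pu₁ pg₁) 7 4 5 5 = true := by decide +kernel

set_option maxRecDepth 100000 in
theorem energyPoly₁_check : nonnegOn (energyPoly pu₁ pm₁) 7 4 5 5 = true := by
  decide +kernel

theorem pθ₂_check : nonnegOn (padd pθ₂ [-5]) 7 0 4 5 = true := by decide +kernel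

set_option maxRecDepth 100000 in
theorem superPoly₂_check : nonnegOn (superPoly pθ₂ pg₂) 7 0 4 5 = true := by
  decide +kernel

set_option maxRecDepth 100000 in
theorem weightPoly₂_check : ∀ σ ∈ [1, -1], ∀ b ∈ [29451, 29453],
    nonnegOn (weightPoly σ b pg₂) 7 0 4 5 = true := by decide +kernel

set_option maxRecDepth 100000 in
theorem correctorPoly₂_check : ∀ σ ∈ [1, -1],
    nonnegOn (correctorPoly σ pu₂ pg₂) 7 0 4 5 = true := by decide +kernel

set_option maxRecDepth 100000 in
theorem energyPoly₂_check : nonnegOn (energyPoly pu₂ pm₂) 7 0 4 5 = true := by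
  decide +kernel

theorem pb₁_check : ∀ σ ∈ [1, -1], nonnegOn (padd pb₁ (psmul σ pu₁)) 7 4 5 5 = true := by
  decide +kernel

theorem pu₂_check : nonnegOn pu₂ 7 0 4 5 = true := by decide +kernel

theorem pθ₂_mono_check : nonnegOn (psmul (-1) (pD pθ₂)) 7 0 4 5 = true := by decide +kernel

end Phi4Kink

namespace Phi4Kink

open Filter Topology

/-! ### Verification of the comparison data -/

/-- `exp (-√2 x / 16)`. -/
noncomputable def Eh (x : ℝ) : ℝ := Real.exp (-(√2 / 16 * x))

theorem Eh_pos (x : ℝ) : 0 < Eh x := Real.exp_pos _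

/-- The square root of E is needed because ζ itself, not only ζ², occurs in the constraint function
and in ζ·fh. -/
theorem E_eq_Eh (x : ℝ) : E x = Eh x ^ 2 := by
  unfold E Eh; rw [← Real.exp_nat_mul]; congr 1; push_cast; ring

/-- The constraint function: `Z₁` up to a factor. -/
noncomputable def Zh (x : ℝ) : ℝ := H x * sx x / ζ x

/-- The enlarged potential. -/
noncomputable def Up (x : ℝ) : ℝ := 51 / 50 * V x

theorem ζ_eq_Eh (x : ℝ) : ζ x = 2 * Eh x / (1 + Eh x ^ 2) := by
  rw [ζ, sech_eq_exp, div_lam_sqrt2, ← E_eq_Eh, E,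
    show 2 * (√2 / 16 * x) = √2 / 8 * x by ring]; rfl

theorem Zh_eq_Eh (x : ℝ) : Zh x = ev qZ (Eh x) / ev qCQ (Eh x) := by
  have h := Eh_pos x
  rw [Zh, H_eq_E, sx_eq_E, ζ_eq_Eh, E_eq_Eh]
  simp only [qZ, qCQ, qC, qQ, qM, ev_padd, ev_psmul, ev_pmul, ev_pX, ev_ppow, ev_cons, ev_nil]
  field_simp
  push_cast
  ring

theorem Up_eq_Eh (x : ℝ) : Up x = ev qU (Eh x) / (3200 * ev qCQ (Eh x)) := by
  have h := Eh_pos x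
  rw [Up, V_eq, H_eq_E, sx_eq_E, tl_eq_E, ζ_sq_eq_E, E_eq_Eh]
  simp only [qU, qCQ, qC, qQ, qM, ev_padd, ev_psmul, ev_pmul, ev_pX, ev_ppow, ev_cons, ev_nil]
  field_simp
  push_cast
  ring

theorem ζ_mul_fh_eq_Eh (x : ℝ) : ζ x * fh x = 4 * Eh x ^ 9 * ((1 - Eh x ^ 16) *
    (2 * (Eh x ^ 8 * (1 - Eh x ^ 16) ^ 2) - bc * (1 + Eh x ^ 16) ^ 3)) /
      ((1 + Eh x ^ 2) * (1 + Eh x ^ 16) ^ 5) := by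
  have h := Eh_pos x
  rw [fh_eq_E, ζ_eq_Eh, E_eq_Eh]
  field_simp
  ring

theorem ev_qCQ_pos (x : ℝ) : 0 < ev qCQ (Eh x) := by
  have h := Eh_pos x
  simp only [qCQ, qC, qQ, ev_padd, ev_pmul, ev_pX, ev_ppow, ev_cons, ev_nil]
  push_cast
  positivity

/-- A polynomial in `Eh`, with coefficients scaled by `10 ^ 4`. -/
noncomputable def poly (p : List ℤ) (x : ℝ) : ℝ := 1 / 10000 * ev p (Eh x)

theorem hasDerivAt_poly (p : List ℤ) (x : ℝ) :
    HasDerivAt (poly p) (-(√2 / 16) * poly (pD p) x) x :=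
  ((hasDerivAt_ev_exp p (√2 / 16) x).const_mul (1 / 10000)).congr_deriv (by
    unfold poly Eh; ring)

theorem hasDerivAt_poly' (p : List ℤ) (x : ℝ) :
    HasDerivAt (fun x => -(√2 / 16) * poly (pD p) x) (1 / 128 * poly (pD (pD p)) x) x :=
  ((hasDerivAt_poly (pD p) x).const_mul (-(√2 / 16))).congr_deriv (by
    linear_combination (1 / 256 * poly (pD (pD p)) x) * sq2)

theorem contDiff_ev (p : List ℤ) : ContDiff ℝ 1 (ev p) := by
  induction p with
  | nil => exact contDiff_const
  | cons c p ih => exact contDiff_const.add (contDiff_id.mul ih)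

theorem contDiff_poly (p : List ℤ) : ContDiff ℝ 1 (poly p) := by
  have h : ContDiff ℝ 1 Eh := by unfold Eh; fun_prop
  exact contDiff_const.mul ((contDiff_ev p).comp h)

theorem continuous_poly (p : List ℤ) : Continuous (poly p) := (contDiff_poly p).continuous

theorem ev_qA (p : List ℤ) (x : ℝ) :
    ev (qA p) (Eh x) = 32000000 * ev qCQ (Eh x) *
      (-(1 / 128 * poly (pD (pD p)) x) - Up x * poly p x) := by
  have h := ev_qCQ_pos x
  rw [Up_eq_Eh]
  simp only [qA, ev_padd, ev_psmul, ev_pmul, poly]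
  field_simp
  push_cast
  ring

/-- Each condition of `Comparison`, multiplied by a positive common denominator, is one tested
polynomial. Two x-derivatives produce (√2/16)² = 1/128, and only the bound on ζ·fh involves `bc`. -/
theorem comparison_of_checks {θ g u m : List ℤ} {b : ℝ → ℝ} {n : ℕ} {lo hi d : ℤ} (hd : 0 < d)
    (hlt : lo < hi) {s : Set ℝ} (hs : ∀ x ∈ s, (lo : ℝ) ≤ d * Eh x ∧ d * Eh x ≤ hi)
    (cb : Continuous b) (hb : ∀ x ∈ s, |poly u x| ≤ b x)
    (k₁ : nonnegOn (padd θ [-5]) n lo hi d = true)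
    (k₂ : nonnegOn (superPoly θ g) n lo hi d = true)
    (k₃ : ∀ σ ∈ [1, -1], ∀ b ∈ [29451, 29453], nonnegOn (weightPoly σ b g) n lo hi d = true)
    (k₄ : ∀ σ ∈ [1, -1], nonnegOn (correctorPoly σ u g) n lo hi d = true)
    (k₅ : nonnegOn (energyPoly u m) n lo hi d = true) :
    Comparison Up Zh (fun x => ζ x * fh x) (-(8 / 5)) (poly g) (poly θ)
      (fun x => -(√2 / 16) * poly (pD θ) x) (fun x => 1 / 128 * poly (pD (pD θ)) x) (poly u)
      (fun x => -(√2 / 16) * poly (pD u) x) (fun x => 1 / 128 * poly (pD (pD u)) x) (poly m) b s := by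
  have key : ∀ {p : List ℤ}, nonnegOn p n lo hi d = true → ∀ x ∈ s, 0 ≤ ev p (Eh x) :=
    fun hp x hx => ev_nonneg_of_nonnegOn hd hlt hp (hs x hx).1 (hs x hx).2
  refine ⟨continuous_poly _, continuous_poly _, cb, hasDerivAt_poly _, hasDerivAt_poly' _,
    hasDerivAt_poly _, hasDerivAt_poly' _, contDiff_poly _, contDiff_const.mul (contDiff_poly _),
    contDiff_poly _, contDiff_const.mul (contDiff_poly _), fun x hx => ?_, fun x hx => ?_,
    fun x hx => ?_, fun x hx => ?_, fun x hx => ?_, hb⟩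
  · have := key k₁ x hx
    simp only [ev_padd, ev_cons, ev_nil] at this
    push_cast at this
    unfold poly; linarith
  · have := key k₂ x hx
    simp only [superPoly, ev_padd, ev_psmul, ev_pmul, ev_qA] at this
    push_cast at this
    have hpos := ev_qCQ_pos x
    refine le_of_sub_nonneg (le_of_mul_le_mul_left ?_
      (by positivity : 0 < 32000000 * ev qCQ (Eh x)))
    rw [mul_zero]
    refine this.trans_eq ?_
    rw [poly, poly, poly]; ring
  · have hE := Eh_pos x
    have hσ : ∀ σ ∈ [(1 : ℤ), -1], 0 ≤ poly g x + σ * (ζ x * fh x) := by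
      intro σ hσ
      have hc : ∀ b ∈ [(29451 : ℤ), 29453], 0 ≤ ev (weightPoly σ b g) (Eh x) := fun b hb =>
        key (k₃ σ hσ b hb) x hx
      simp only [weightPoly, qh, qC, qQ, qM, ev_padd, ev_psmul, ev_pmul, ev_ppow, ev_pX,
        ev_cons, ev_nil] at hc
      have h := affine_nonneg (F := fun t => 10 * (ev g (Eh x) * ((1 + Eh x ^ 2) *
        (1 + Eh x ^ 16) ^ 5)) + σ * (4 * Eh x ^ 9 * ((1 - Eh x ^ 16) *
        (200000 * (Eh x ^ 8 * (1 - Eh x ^ 16) ^ 2) - t * (1 + Eh x ^ 16) ^ 3))))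
        (fun t => by ring) (a := 29451) (b := 29453) (t := 100000 * bc)
        ((hc 29451 (by simp)).trans_eq (by push_cast; ring))
        ((hc 29453 (by simp)).trans_eq (by push_cast; ring)) bc_bounds.1 bc_bounds.2
      have hpos : 0 < 100000 * ((1 + Eh x ^ 2) * (1 + Eh x ^ 16) ^ 5) := by positivity
      refine le_of_mul_le_mul_right ?_ hpos
      rw [zero_mul]
      refine h.trans_eq ?_
      rw [ζ_mul_fh_eq_Eh, poly]; field_simp; ring
    have h1 := hσ 1 (by simp)
    have h2 := hσ (-1) (by simp)
    push_cast at h1 h2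
    rw [abs_le]; constructor <;> linarith
  · have hpos := ev_qCQ_pos x
    have hσ : ∀ σ ∈ [(1 : ℤ), -1], 0 ≤ 1 / 2 * poly g x + σ *
        (-(1 / 128 * poly (pD (pD u)) x) - Up x * poly u x - -(8 / 5) * Zh x) := by
      intro σ hσ
      have := key (k₄ σ hσ) x hx
      simp only [correctorPoly, ev_padd, ev_psmul, ev_pmul, ev_qA] at this
      push_cast at this
      refine le_of_mul_le_mul_left ?_ (by positivity : 0 < 32000000 * ev qCQ (Eh x))
      rw [mul_zero]
      refine this.trans_eq ?_
      rw [Zh_eq_Eh, poly, poly, poly]; field_simp; ring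
    have h1 := hσ 1 (by simp)
    have h2 := hσ (-1) (by simp)
    push_cast at h1 h2
    rw [abs_le]; constructor <;> linarith
  · have hpos := ev_qCQ_pos x
    have := key k₅ x hx
    simp only [energyPoly, ev_padd, ev_psmul, ev_pmul] at this
    push_cast at this
    refine le_of_sub_nonneg (le_of_mul_le_mul_left ?_
      (by positivity : 0 < 320000000000 * ev qCQ (Eh x)))
    rw [mul_zero]
    refine this.trans_eq ?_
    rw [Zh_eq_Eh, Up_eq_Eh, poly, poly, poly, mul_pow, neg_sq, div_pow, sq2]; field_simp; ring

/-- The cut point x₁: the half-lines x ≤ x₁ and x ≥ x₁ correspond to the tested intervals [4/5, 1]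
and [0, 4/5]. -/
theorem exists_Eh_eq : ∃ x, 0 ≤ x ∧ Eh x = 4 / 5 :=
  exists_exp_neg_eq (by have := sqrt2_pos; positivity) (by norm_num) (by norm_num)

theorem Eh_zero : Eh 0 = 1 := by simp [Eh]

theorem Eh_anti {x y : ℝ} (h : x ≤ y) : Eh y ≤ Eh x :=
  exp_neg_anti (by have := sqrt2_pos; positivity) h

theorem comparison_left {x₁ : ℝ} (e₁ : Eh x₁ = 4 / 5) :
    Comparison Up Zh (fun x => ζ x * fh x) (-(8 / 5)) (poly pg₁) (poly pθ₁)
      (fun x => -(√2 / 16) * poly (pD pθ₁) x) (fun x => 1 / 128 * poly (pD (pD pθ₁)) x) (poly pu₁)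
      (fun x => -(√2 / 16) * poly (pD pu₁) x) (fun x => 1 / 128 * poly (pD (pD pu₁)) x)
      (poly pm₁) (poly pb₁) (Set.Icc 0 x₁) := by
  have hs : ∀ x ∈ Set.Icc 0 x₁, ((4 : ℤ) : ℝ) ≤ (5 : ℤ) * Eh x ∧ (5 : ℤ) * Eh x ≤ (5 : ℤ) := by
    intro x hx
    have h1 := Eh_anti hx.1
    have h2 := Eh_anti hx.2
    rw [Eh_zero] at h1; rw [e₁] at h2
    push_cast
    constructor <;> linarith
  refine comparison_of_checks (by norm_num) (by norm_num) hs (continuous_poly _) (fun x hx => ?_)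
    pθ₁_check superPoly₁_check weightPoly₁_check correctorPoly₁_check energyPoly₁_check
  have k : ∀ σ ∈ [(1 : ℤ), -1], 0 ≤ ev (padd pb₁ (psmul σ pu₁)) (Eh x) := fun σ hσ =>
    ev_nonneg_of_nonnegOn (by norm_num) (by norm_num) (pb₁_check σ hσ) (hs x hx).1 (hs x hx).2
  have h1 := k 1 (by simp)
  have h2 := k (-1) (by simp)
  simp only [ev_padd, ev_psmul] at h1 h2
  push_cast at h1 h2
  unfold poly
  rw [abs_le]; constructor <;> linarith

theorem Eh_mem_right {x₁ : ℝ} (e₁ : Eh x₁ = 4 / 5) {x : ℝ} (hx : x₁ ≤ x) :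
    ((0 : ℤ) : ℝ) ≤ (5 : ℤ) * Eh x ∧ (5 : ℤ) * Eh x ≤ (4 : ℤ) := by
  have h1 := Eh_anti hx
  have h2 := Eh_pos x
  rw [e₁] at h1
  push_cast
  constructor <;> linarith

/-- The corrector is nonnegative on this side and serves as its own bound b. -/
theorem comparison_right {x₁ : ℝ} (e₁ : Eh x₁ = 4 / 5) :
    Comparison Up Zh (fun x => ζ x * fh x) (-(8 / 5)) (poly pg₂) (poly pθ₂)
      (fun x => -(√2 / 16) * poly (pD pθ₂) x) (fun x => 1 / 128 * poly (pD (pD pθ₂)) x) (poly pu₂)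
      (fun x => -(√2 / 16) * poly (pD pu₂) x) (fun x => 1 / 128 * poly (pD (pD pu₂)) x)
      (poly pm₂) (poly pu₂) (Set.Ici x₁) := by
  refine comparison_of_checks (by norm_num) (by norm_num) (fun x hx => Eh_mem_right e₁ hx)
    (continuous_poly _) (fun x hx => ?_)
    pθ₂_check superPoly₂_check weightPoly₂_check correctorPoly₂_check energyPoly₂_check
  have k := ev_nonneg_of_nonnegOn (by norm_num) (by norm_num) pu₂_check (Eh_mem_right e₁ hx).1
    (Eh_mem_right e₁ hx).2
  rw [abs_of_nonneg]
  unfold poly; positivity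

/-! ### Integrals of the comparison data -/

/-- Multiple of a primitive of `pmul pg₁ pθ₁` for the Euler operator. -/
def primM₁ : List ℤ := [0, -130466755591200, 715805860254660, -2316027084313320, 4894815950189550, -7061695846929864, 7043778045171000, -4797053372227320, 2134916898018345, -560725660258120, 66005281823292]

-- The summand with factor 0 only pads with zeros, so that the two lists have equal length.
theorem primM₁_eq : pD primM₁ =
    psmul 252 (padd (pmul pg₁ pθ₁) (psmul 0 (pX 11))) := by decide +kernel

/-- Multiple of a primitive of `pmul pg₂ pθ₂` for the Euler operator. -/
def primM₂ : List ℤ := [0, 0, 11304115722900, 0, -3096082849860, -5948012862792, 157299213151080, -1858257797338800, 18070919017576425, -79754930610955600, 223791245809899768, -323469892184133240, 464750898180949380, -3057029822905609320, 26770844195461929420, -167829936998741897880, 750513432911716574100, -2453270425765322763600, 5918904263566421327200, -10504261773019012798800, 13501422601962633718380, -12189542813075529330000, 7310100464153276353200, -2607715806232980643200, 417662156409493495500]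

theorem primM₂_eq : pD primM₂ =
    psmul 2677114440 (padd (pmul pg₂ pθ₂) (psmul 0 (pX 25))) := by decide +kernel

/-- Multiple of a primitive of `pm₁` for the Euler operator. -/
def primm₁ : List ℤ := [0, 1158319350, -3365393310, 5193778450, -4490329875, 2062098162, -393006590]

theorem primm₁_eq : pD primm₁ =
    psmul 3 (padd (pm₁) (psmul 0 (pX 7))) := by decide +kernel

/-- Multiple of a primitive of `pm₂` for the Euler operator. -/
def primm₂ : List ℤ := [0, 0, -30660, 602980, -5728695, 24206280, -50183560, 49738740, -18626895]

theorem primm₂_eq : pD primm₂ =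
    psmul 42 (padd (pm₂) (psmul 0 (pX 9))) := by decide +kernel

/-- Multiple of a primitive of `pmul pb₁ pg₁` for the Euler operator. -/
def primB₁ : List ℤ := [0, -430694320, 843562990, -711324000, 220050000]

theorem primB₁_eq : pD primB₁ =
    psmul 1 (padd (pmul pb₁ pg₁) (psmul 0 (pX 5))) := by decide +kernel

/-- Multiple of a primitive of `pmul pu₂ pg₂` for the Euler operator. -/
def primB₂ : List ℤ := [0, 0, 6296573162880, 0, -1654456723920, 2245563592272, -88949804383440, 1638554664146400, -14036208054318450, 98936996350672480, -467398868571546912, 1569567978508027680, -3635589497463924000, 7679281659003662400, -35395934906880096120, 266911872029940000864, -1661133676829330008305, 7747275422772156070800, -27329962475832459643200, 73556595169067721110400, -150985700311099236743160, 234231886457367828057600, -269479652099621622094800, 222436257166113831640800, -124327201686013167441600, 42072646273002992110464, -6497891781801404292000]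

theorem primB₂_eq : pD primB₂ =
    psmul 5354228880 (padd (pmul pu₂ pg₂) (psmul 0 (pX 27))) := by decide +kernel

theorem tendsto_poly_pD (p : List ℤ) : Tendsto (fun x => poly (pD p) x) atTop (𝓝 0) := by
  have h := (((continuous_ev (pD p)).tendsto 0).comp
    (tendsto_exp_neg (c := √2 / 16) (by have := sqrt2_pos; positivity))).const_mul (1 / 10000)
  rw [ev_pD, zero_mul, mul_zero] at h
  exact h

theorem tendsto_mul_poly_pD (p : List ℤ) :
    Tendsto (fun x => x * poly (pD p) x) atTop (𝓝 0) := by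
  have hc : 0 < √2 / 16 := by have := sqrt2_pos; positivity
  have h1 : Tendsto (fun x : ℝ => x * Eh x) atTop (𝓝 0) := by
    have := (Real.tendsto_pow_mul_exp_neg_atTop_nhds_zero 1).comp
      (tendsto_id.const_mul_atTop hc)
    have h := this.const_mul (√2 / 16)⁻¹
    rw [mul_zero] at h
    refine h.congr fun x => ?_
    simp only [Function.comp, pow_one, id, Eh]
    field_simp
  have h2 := (((continuous_ev (pder p)).tendsto 0).comp (tendsto_exp_neg hc)).const_mul (1 / 10000)
  have h3 := h1.mul h2
  rw [zero_mul] at h3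
  refine h3.congr fun x => ?_
  simp only [Function.comp, poly, ev_pD, Eh]; ring

theorem tendsto_poly (p : List ℤ) : Tendsto (poly p) atTop (𝓝 (1 / 10000 * ev p 0)) :=
  (((continuous_ev p).tendsto 0).comp
    (tendsto_exp_neg (c := √2 / 16) (by have := sqrt2_pos; positivity))).const_mul _

theorem div_sqrt2_sixteenth (X N : ℝ) : X / (√2 / 16 * N) = 8 * √2 * (X / N) := by
  rw [div_mul_eq_div_div, div_div_eq_mul_div, div_eq_mul_inv (X * 16), inv_sqrt2]; ring

theorem integral_left {p P : List ℤ} {N : ℤ} {k : ℕ} (hN : N ≠ 0)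
    (hP : pD P = psmul N (padd p (psmul 0 (pX k)))) {x₁ : ℝ} (e₁ : Eh x₁ = 4 / 5) :
    ∫ x in (0 : ℝ)..x₁, ev p (Eh x) = 8 * √2 * ((ev P 1 - ev P (4 / 5)) / N) := by
  have h := integral_ev_exp hN hP (c := √2 / 16) (by have := sqrt2_pos; positivity) 0 x₁
  simp only [ev_padd, ev_psmul, Int.cast_zero, zero_mul, add_zero] at h
  change _ = (ev P (Eh 0) - ev P (Eh x₁)) / _ at h
  rw [Eh_zero, e₁, div_sqrt2_sixteenth] at h
  exact h

theorem integral_right {p P : List ℤ} {N : ℤ} {k : ℕ} (hN : N ≠ 0)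
    (hP : pD P = psmul N (padd p (psmul 0 (pX k)))) (hP0 : ev P 0 = 0) {x₁ : ℝ} (hx₁ : 0 ≤ x₁)
    (e₁ : Eh x₁ = 4 / 5) :
    ∫ x in Set.Ioi x₁, ev p (Eh x) = 8 * √2 * (ev P (4 / 5) / N) := by
  have h := integral_Ioi_ev_exp hN hP hP0 (c := √2 / 16) (by have := sqrt2_pos; positivity) hx₁
  simp only [ev_padd, ev_psmul, Int.cast_zero, zero_mul, add_zero] at h
  change _ = ev P (Eh x₁) / _ at h
  rw [e₁, div_sqrt2_sixteenth] at h
  exact h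

theorem poly_mul (p q : List ℤ) (x : ℝ) :
    poly p x * poly q x = 1 / 100000000 * ev (pmul p q) (Eh x) := by
  rw [ev_pmul, poly, poly]; ring

theorem integrableOn_poly {p : List ℤ} (hp : ev p 0 = 0) {x₁ : ℝ} (hx₁ : 0 ≤ x₁) :
    IntegrableOn (poly p) (Set.Ioi x₁) :=
  (integrableOn_ev (c := √2 / 16) (by have := sqrt2_pos; positivity) hp hx₁).const_mul _

theorem integrableOn_poly_mul {p q : List ℤ} (hp : ev (pmul p q) 0 = 0) {x₁ : ℝ}
    (hx₁ : 0 ≤ x₁) : IntegrableOn (fun x => poly p x * poly q x) (Set.Ioi x₁) := by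
  simp only [poly_mul]
  exact (integrableOn_ev (c := √2 / 16) (by have := sqrt2_pos; positivity) hp hx₁).const_mul _

theorem integral_weight_le {x₁ : ℝ} (hx₁ : 0 ≤ x₁) (e₁ : Eh x₁ = 4 / 5) :
    (∫ x in (0 : ℝ)..x₁, poly pg₁ x * poly pθ₁ x) + ∫ x in Set.Ioi x₁, poly pg₂ x * poly pθ₂ x ≤ 17 / 1000 := by
  simp only [poly_mul]
  rw [intervalIntegral.integral_const_mul, integral_const_mul,
    integral_left (by norm_num) primM₁_eq e₁,
    integral_right (by norm_num) primM₂_eq (by simp [primM₂]) hx₁ e₁]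
  have h1 := lt_sqrt2
  have h2 := sqrt2_lt
  norm_num [primM₁, primM₂]
  linarith

theorem le_integral_energy {x₁ : ℝ} (hx₁ : 0 ≤ x₁) (e₁ : Eh x₁ = 4 / 5) :
    1796 / 1000 ≤ ((∫ x in (0 : ℝ)..x₁, poly pm₁ x) + ∫ x in Set.Ioi x₁, poly pm₂ x) := by
  simp only [poly]
  rw [intervalIntegral.integral_const_mul, integral_const_mul,
    integral_left (by norm_num) primm₁_eq e₁,
    integral_right (by norm_num) primm₂_eq (by simp [primm₂]) hx₁ e₁]
  have h1 := lt_sqrt2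
  have h2 := sqrt2_lt
  norm_num [primm₁, primm₂]
  linarith

theorem integral_bound_le {x₁ : ℝ} (hx₁ : 0 ≤ x₁) (e₁ : Eh x₁ = 4 / 5) :
    (∫ x in (0 : ℝ)..x₁, poly pb₁ x * poly pg₁ x) + ∫ x in Set.Ioi x₁, poly pu₂ x * poly pg₂ x ≤ 667 / 10000 := by
  simp only [poly_mul]
  rw [intervalIntegral.integral_const_mul, integral_const_mul,
    integral_left (by norm_num) primB₁_eq e₁,
    integral_right (by norm_num) primB₂_eq (by simp [primB₂]) hx₁ e₁]
  have h1 := lt_sqrt2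
  have h2 := sqrt2_lt
  norm_num [primB₁, primB₂]
  linarith

end Phi4Kink

namespace Phi4Kink

open Filter Topology

/-! ### Coercivity on the half-line -/

/-- With y = x/(8√2): cosh 8y ≥ cosh 2y = 2cosh²y − 1 ≥ cosh²y. This controls the divisions by ζ and
ζ² in `Zh` and `Up`. -/
theorem sx_le_ζ_sq (x : ℝ) : sx x ≤ ζ x ^ 2 := by
  have hs := sqrt2_pos
  set y := x / (lam * √2) with hy
  have e : x / √2 = 8 * y := by rw [hy]; unfold lam; field_simp
  have h1 : Real.cosh (2 * y) ≤ Real.cosh (8 * y) := by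
    rw [Real.cosh_le_cosh, abs_mul, abs_mul]
    norm_num
    nlinarith [abs_nonneg y]
  have h2 := Real.cosh_two_mul y
  have h3 := Real.cosh_sq y
  have h4 := Real.one_le_cosh (2 * y)
  have hc := Real.cosh_pos y
  rw [sx, ζ, sech, sech, e, ← hy, div_pow, one_pow]
  exact one_div_le_one_div_of_le (by positivity) (by nlinarith)

theorem ζ_le_one (x : ℝ) : ζ x ≤ 1 := by
  have h := ζ_sq x
  nlinarith [sq_nonneg (tl x), ζ_pos x]

theorem continuous_fh : Continuous fh :=
  continuous_iff_continuousAt.2 fun x => (hasDerivAt_fh x).continuousAt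

theorem continuous_Zh : Continuous Zh :=
  (continuous_H.mul continuous_sx).div continuous_ζ fun x => (ζ_pos x).ne'

theorem Up_eq (x : ℝ) :
    Up x = 51 / 50 * (ζ x ^ 2 / 256 + 24 * (tl x / ζ x ^ 2 * (H x * sx x ^ 2))) := by
  rw [Up, V_eq]; ring

theorem continuous_Up : Continuous Up := by
  have h : Continuous fun x =>
      51 / 50 * (ζ x ^ 2 / 256 + 24 * (tl x / ζ x ^ 2 * (H x * sx x ^ 2))) := by
    have h1 : Continuous fun x => tl x / ζ x ^ 2 :=
      continuous_tl.div (continuous_ζ.pow 2) fun x => by have := ζ_pos x; positivity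
    have h2 := continuous_ζ
    have h3 := continuous_H
    have h4 := continuous_sx
    fun_prop
  exact h.congr fun x => (Up_eq x).symm

theorem abs_Zh_le (x : ℝ) : |Zh x| ≤ ζ x := by
  have h := ζ_pos x
  rw [Zh, abs_div, abs_mul, abs_of_pos (sx_pos x), abs_of_pos h, div_le_iff₀ h]
  nlinarith [sx_le_ζ_sq x, abs_H_le x, abs_nonneg (H x), sx_pos x]

theorem abs_Up_le (x : ℝ) : |Up x| ≤ 51 / 50 * 25 := by
  have h := ζ_pos x
  have h1 := ζ_le_one x
  have hs := sx_pos x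
  have h3 : |tl x / ζ x ^ 2 * (H x * sx x ^ 2)| ≤ 1 := by
    have e : tl x / ζ x ^ 2 * (H x * sx x ^ 2) = tl x * H x * sx x * (sx x / ζ x ^ 2) := by
      field_simp
    have h5 : sx x / ζ x ^ 2 ≤ 1 := (div_le_one (by positivity)).2 (sx_le_ζ_sq x)
    have h6 : sx x ≤ 1 := (sx_le_ζ_sq x).trans (by nlinarith)
    rw [e, abs_mul, abs_mul, abs_mul, abs_of_pos hs,
      abs_of_nonneg (by positivity : 0 ≤ sx x / ζ x ^ 2)]
    have h7 : |tl x| ≤ 1 := abs_tanh_le _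
    calc |tl x| * |H x| * sx x * (sx x / ζ x ^ 2) ≤ 1 * 1 * 1 * 1 := by
          have := abs_H_le x
          gcongr
      _ = 1 := by norm_num
  rw [Up_eq, abs_mul, abs_of_pos (by norm_num : (0 : ℝ) < 51 / 50)]
  refine mul_le_mul_of_nonneg_left ((abs_add_le _ _).trans ?_) (by norm_num)
  rw [abs_of_nonneg (by positivity : 0 ≤ ζ x ^ 2 / 256), abs_mul,
    abs_of_pos (by norm_num : (0 : ℝ) < 24)]
  nlinarith

theorem memLp_ζ : MemLp ζ 2 := by
  obtain ⟨F, hF⟩ := exists_schwartz_ζ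
  rw [← hF]; exact F.memLp 2 volume

theorem memLp_Zh : MemLp Zh 2 :=
  memLp_ζ.mono continuous_Zh.aestronglyMeasurable
    (Eventually.of_forall fun x => (abs_Zh_le x).trans (le_abs_self _))

theorem memLp_ζ_mul_fh : MemLp (fun x => ζ x * fh x) 2 := by
  obtain ⟨F, hF⟩ := exists_schwartz_fh
  obtain ⟨G, hG⟩ := exists_schwartz_mul hasTemperateGrowth_ζ F
  rw [hF] at hG
  rw [← hG]; exact G.memLp 2 volume

theorem integrable_Up_mul_sq {W : ℝ → ℝ} (hW : MemLp W 2) :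
    Integrable fun x => Up x * W x ^ 2 :=
  hW.integrable_sq.bdd_mul (c := 51 / 50 * 25) continuous_Up.aestronglyMeasurable
    (Eventually.of_forall abs_Up_le)

/-- The unknown τ is eliminated: the energy 1.796 τ² of the corrector dominates every term
containing τ, up to a multiple of γ². -/
theorem half_line_coercive {v : ℝ → ℝ} (hv : MemLp v 2) {W : ℝ → ℝ}
    (hW : W = fun x => ∫ z in (0 : ℝ)..x, v z) (hW2 : MemLp W 2)
    (hZ : ∫ x in Set.Ioi 0, W x * Zh x = 0) (γ : ℝ) :
    0 ≤ (∫ x in Set.Ioi 0, (v x ^ 2 - Up x * W x ^ 2)) +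
      2 * γ * (∫ x in Set.Ioi 0, W x * (ζ x * fh x)) + 41 / 2000 * γ ^ 2 := by
  obtain ⟨x₁, hx₁, e₁⟩ := exists_Eh_eq
  have hs := sqrt2_pos
  obtain ⟨τ, -, h⟩ := half_line_ge (h := fun x => ζ x * fh x) hv hx₁ continuous_Up continuous_Zh
    (continuous_ζ.mul continuous_fh) (comparison_left e₁) (comparison_right e₁)
    (by rw [poly, Eh_zero]; norm_num [pu₁]) (by rw [poly, e₁]; norm_num [pu₁])
    (by rw [poly, e₁]; norm_num [pu₂])
    (fun x hx => by
      have k := ev_nonneg_of_nonnegOn (by norm_num) (by norm_num) pθ₂_mono_check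
        (Eh_mem_right e₁ hx).1 (Eh_mem_right e₁ hx).2
      rw [ev_psmul] at k
      push_cast at k
      unfold poly
      nlinarith)
    (by simpa using (tendsto_poly_pD pu₂).const_mul (-(√2 / 16)))
    (by
      have := (tendsto_mul_poly_pD pu₂).const_mul (-(√2 / 16))
      rw [mul_zero] at this
      exact this.congr fun x => by ring)
    (by
      have := ((tendsto_poly pu₂).mul (tendsto_poly_pD pu₂)).const_mul (-(√2 / 16))
      rw [mul_zero, mul_zero] at this
      exact this.congr fun x => by ring)
    (integrableOn_poly_mul (by simp [pg₂]) hx₁) (integrableOn_poly (by simp [pm₂]) hx₁)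
    (integrableOn_poly_mul (by simp [pg₂]) hx₁) hW
    (hv.integrable_sq.sub (integrable_Up_mul_sq hW2)).integrableOn
    (hW2.integrable_mul memLp_ζ_mul_fh).integrableOn
    (hW2.integrable_mul memLp_Zh).integrableOn hZ γ
  have hM := mul_le_mul_of_nonneg_left (integral_weight_le hx₁ e₁)
    (sq_nonneg (1 / 2 * |τ| + |γ|))
  have hm := mul_le_mul_of_nonneg_left (le_integral_energy hx₁ e₁) (sq_nonneg τ)
  have hB := mul_le_mul_of_nonneg_left (integral_bound_le hx₁ e₁)
    (by positivity : 0 ≤ 2 * |γ * τ|)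
  rw [abs_mul] at hB h
  have e1 := sq_abs τ
  have e2 := sq_abs γ
  -- A positive definite form in (|τ|, |γ|); for fixed γ its minimum lies near |τ| = 0.042|γ|,
  -- whence the square in the hint.
  have hq : (1 / 2 * |τ| + |γ|) ^ 2 * (17 / 1000) + 2 * (|γ| * |τ|) * (667 / 10000) ≤
      τ ^ 2 * (1796 / 1000) + 41 / 2000 * γ ^ 2 := by
    nlinarith [sq_nonneg (|τ| - 42 / 1000 * |γ|), sq_nonneg (|γ|)]
  linarith

end Phi4Kink

namespace Phi4Kink

open Filter Topology

/-! ### Absolutely continuous representatives -/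

theorem exists_support_subset {φ : ℝ → ℝ} (hφ : HasCompactSupport φ) :
    ∃ R, 0 < R ∧ Function.support φ ⊆ Set.Ioc (-R) R ∧ φ R = 0 ∧ φ (-R) = 0 := by
  obtain ⟨r, hr⟩ := hφ.isCompact.isBounded.subset_closedBall 0
  have h0 : ∀ x, r < |x| → φ x = 0 := fun x hx => by
    by_contra hne
    have := hr (subset_tsupport φ hne)
    rw [Metric.mem_closedBall, dist_zero_right, Real.norm_eq_abs] at this
    linarith
  have h1 : r < |r| + 1 := by linarith [le_abs_self r]
  have h2 : 0 < |r| + 1 := by positivity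
  refine ⟨|r| + 1, h2, fun x hx => ?_, h0 _ (by rwa [abs_of_pos h2]),
    h0 _ (by rwa [abs_neg, abs_of_pos h2])⟩
  have : |x| ≤ r := not_lt.1 fun h => hx (h0 x h)
  have h3 := abs_le.1 this
  exact ⟨by linarith [h3.1], by linarith [h3.2]⟩

/-- The lemma of du Bois-Reymond. -/
theorem ae_eq_const_of_integral_mul_deriv {u : ℝ → ℝ} (hu : LocallyIntegrable u)
    (h : ∀ φ : ℝ → ℝ, ContDiff ℝ ∞ φ → HasCompactSupport φ → ∫ x, u x * deriv φ x = 0) :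
    ∃ c, ∀ᵐ x, u x = c := by
  let B : ContDiffBump (0 : ℝ) := ⟨1, 2, one_pos, one_lt_two⟩
  set ρ : ℝ → ℝ := B.normed volume with hρ
  have sρ : ContDiff ℝ ∞ ρ := B.contDiff_normed
  have kρ : HasCompactSupport ρ := B.hasCompactSupport_normed
  have iρ : ∫ x, ρ x = 1 := B.integral_normed
  refine ⟨∫ x, u x * ρ x, ?_⟩
  have hint : ∀ {η : ℝ → ℝ}, Continuous η → HasCompactSupport η →
      Integrable fun x => u x * η x := fun {η} hη kη => by
    simpa [mul_comm] using hu.integrable_smul_left_of_hasCompactSupport hη kη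
  have key := ae_eq_zero_of_integral_contDiff_smul_eq_zero (μ := volume)
    (f := fun x => u x - ∫ x, u x * ρ x) (hu.sub (locallyIntegrable_const _)) ?_
  · filter_upwards [key] with x hx
    linarith
  intro η sη kη
  have iη : Integrable η := sη.continuous.integrable_of_hasCompactSupport kη
  have iρ' : Integrable ρ := sρ.continuous.integrable_of_hasCompactSupport kρ
  -- Subtracting the mean of η times a normalized bump gives zero mean, so the primitive of k has
  -- compact support and is an admissible test function.
  set k : ℝ → ℝ := fun x => η x - (∫ x, η x) * ρ x with hk
  have sk : ContDiff ℝ ∞ k := sη.sub (contDiff_const.mul sρ)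
  have kk : HasCompactSupport k := kη.sub kρ.mul_left
  have ik : ∫ x, k x = 0 := by
    rw [hk, integral_sub iη (iρ'.const_mul _), integral_const_mul, iρ]; ring
  obtain ⟨R, hR, hsupp, -, -⟩ := exists_support_subset kk
  set φ : ℝ → ℝ := fun x => ∫ z in (-R)..x, k z with hφ
  have dφ : ∀ x, HasDerivAt φ (k x) x := fun x => sk.continuous.integral_hasStrictDerivAt _ x
    |>.hasDerivAt
  have dφ' : deriv φ = k := funext fun x => (dφ x).deriv
  have sφ : ContDiff ℝ ∞ φ := by
    rw [contDiff_infty_iff_deriv]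
    exact ⟨fun x => (dφ x).differentiableAt, dφ' ▸ sk⟩
  have hk0 : ∀ x, x ∉ Set.Ioc (-R) R → k x = 0 := fun x hx => by
    by_contra hne; exact hx (hsupp hne)
  have kφ : HasCompactSupport φ := by
    refine HasCompactSupport.intro (isCompact_Icc (a := -R) (b := R)) fun x hx => ?_
    rcases lt_or_ge x (-R) with h1 | h1
    · refine intervalIntegral.integral_zero_ae (Eventually.of_forall fun z hz => hk0 z fun hz' => ?_)
      rw [Set.uIoc_of_ge h1.le] at hz
      exact absurd hz.2 (not_le.2 hz'.1)
    · have h2 : R < x := not_le.1 fun h2 => hx ⟨h1, h2⟩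
      rw [hφ]
      simp only
      rw [intervalIntegral.integral_eq_integral_of_support_subset
        (hsupp.trans (Set.Ioc_subset_Ioc_right h2.le)), ik]
  have h0 := h φ sφ kφ
  rw [dφ'] at h0
  have e : ∀ x, η x • (u x - ∫ x, u x * ρ x) =
      u x * k x + (∫ x, η x) * (u x * ρ x) - (∫ x, u x * ρ x) * η x := fun x => by
    rw [hk, smul_eq_mul]; ring
  simp only [e]
  have s1 := integral_sub ((hint sk.continuous kk).add
    ((hint sρ.continuous kρ).const_mul (∫ x, η x))) (iη.const_mul (∫ x, u x * ρ x))
  have s2 := integral_add (hint sk.continuous kk)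
    ((hint sρ.continuous kρ).const_mul (∫ x, η x))
  simp only [Pi.add_apply] at s1 s2
  rw [s1, s2, h0, integral_const_mul, integral_const_mul]
  ring

theorem integral_primitive_mul_deriv {v : ℝ → ℝ} (hv : MemLp v 2) {φ : ℝ → ℝ}
    (sφ : ContDiff ℝ ∞ φ) (kφ : HasCompactSupport φ) :
    ∫ x, (∫ z in (0 : ℝ)..x, v z) * deriv φ x = -∫ x, v x * φ x := by
  obtain ⟨R, hR, hsupp, h1, h2⟩ := exists_support_subset (kφ)
  obtain ⟨R', hR', hsupp', -, -⟩ := exists_support_subset kφ.deriv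
  set S := max R R' with hS
  have hφ : ∀ x, x ∉ Set.Ioc (-R) R → φ x = 0 := fun x hx => by
    by_contra hne; exact hx (hsupp hne)
  have sub1 : Function.support (fun x => v x * φ x) ⊆ Set.Ioc (-S) S := fun x hx => by
    have := hsupp (show φ x ≠ 0 from right_ne_zero_of_mul hx)
    exact ⟨by linarith [this.1, le_max_left R R'], this.2.trans (le_max_left _ _)⟩
  have sub2 : Function.support (fun x => (∫ z in (0 : ℝ)..x, v z) * deriv φ x) ⊆
      Set.Ioc (-S) S := fun x hx => by
    have := hsupp' (show deriv φ x ≠ 0 from right_ne_zero_of_mul hx)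
    exact ⟨by linarith [this.1, le_max_right R R'], this.2.trans (le_max_right _ _)⟩
  have b1 : φ S = 0 := by
    rcases eq_or_lt_of_le (le_max_left R R') with h | h
    · rw [hS, ← h]; exact h1
    · exact hφ _ fun h' => absurd h'.2 (not_le.2 h)
  have b2 : φ (-S) = 0 := by
    rcases eq_or_lt_of_le (le_max_left R R') with h | h
    · rw [hS, ← h]; exact h2
    · exact hφ _ fun h' => absurd h'.1 (by linarith)
  rw [← intervalIntegral.integral_eq_integral_of_support_subset sub1,
    ← intervalIntegral.integral_eq_integral_of_support_subset sub2,
    (ac_primitive_of_memLp_two hv (-S) S).integral_mul_deriv_eq_deriv_mul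
      ((sφ.of_le (by simp)).contDiffOn (s := Set.uIcc (-S) S)).absolutelyContinuousOnInterval,
    b1, b2, mul_zero, mul_zero, sub_zero, zero_sub]
  congr 1
  refine intervalIntegral.integral_congr_ae ?_
  have hl : LocallyIntegrable v := hv.locallyIntegrable (by norm_num)
  filter_upwards [LocallyIntegrable.ae_hasDerivAt_integral hl] with x hx _
  rw [(hx 0).deriv]

theorem IsH1.ae_eq_primitive {w wx : ℝ → ℝ} (h : IsH1 w wx) :
    ∃ c, ∀ᵐ x, w x = (∫ z in (0 : ℝ)..x, wx z) + c := by
  have cW := continuous_primitive_of_memLp_two h.memLp_deriv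
  have hw : LocallyIntegrable w := h.memLp.locallyIntegrable (by norm_num)
  obtain ⟨c, hc⟩ := ae_eq_const_of_integral_mul_deriv (hw.sub cW.locallyIntegrable)
    fun φ sφ kφ => by
      have hφ' : Continuous (deriv φ) := sφ.continuous_deriv (by simp)
      have i1 : Integrable fun x => w x * deriv φ x := by
        simpa [mul_comm] using hw.integrable_smul_left_of_hasCompactSupport hφ' kφ.deriv
      have i2 : Integrable fun x => (∫ z in (0 : ℝ)..x, wx z) * deriv φ x :=
        (cW.mul hφ').integrable_of_hasCompactSupport kφ.deriv.mul_left
      have e := h.weak_deriv φ sφ kφ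
      rw [← integral_primitive_mul_deriv h.memLp_deriv sφ kφ] at e
      simp only [Pi.sub_apply, sub_mul]
      rw [integral_sub i1 i2, e, sub_self]
  refine ⟨c, ?_⟩
  filter_upwards [hc] with x hx
  simp only [Pi.sub_apply] at hx
  linarith

/-- An odd function in `H¹` has an odd primitive of its derivative as representative. -/
theorem IsH1.ae_eq_of_odd {w wx : ℝ → ℝ} (h : IsH1 w wx) (hodd : ∀ᵐ x : ℝ, w (-x) = -w x) :
    (∀ᵐ x, w x = ∫ z in (0 : ℝ)..x, wx z) ∧
      ∀ x : ℝ, ∫ z in (0 : ℝ)..(-x), wx z = -∫ z in (0 : ℝ)..x, wx z := by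
  obtain ⟨c, hc⟩ := h.ae_eq_primitive
  set W : ℝ → ℝ := fun x => ∫ z in (0 : ℝ)..x, wx z with hW
  have cW : Continuous W := continuous_primitive_of_memLp_two h.memLp_deriv
  have hc' : ∀ᵐ x, w (-x) = W (-x) + c :=
    (Measure.measurePreserving_neg (volume : Measure ℝ)).quasiMeasurePreserving.ae hc
  have hae : (fun x => W (-x) + W x) =ᵐ[volume] fun _ => -(2 * c) := by
    filter_upwards [hc, hc', hodd] with x h1 h2 h3
    rw [h1, h2] at h3
    linarith
  -- Continuous functions equal almost everywhere are equal; evaluation at 0 then forces c = 0 and W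
  -- odd.
  have heq : (fun x => W (-x) + W x) = fun _ => -(2 * c) :=
    ((cW.comp continuous_neg).add cW).ae_eq_iff_eq volume continuous_const |>.1 hae
  have h0 : W 0 = 0 := by simp [hW]
  have hc0 : c = 0 := by
    have := congrFun heq 0
    simp only [neg_zero, h0] at this
    linarith
  refine ⟨?_, fun x => ?_⟩
  · filter_upwards [hc] with x hx
    rw [hx, hc0, add_zero]
  · have := congrFun heq x
    simp only [hc0] at this
    change W (-x) = -W x
    linarith

end Phi4Kink

namespace Phi4Kink

open Filter Topology

/-! ### Coercivity for odd functions on the line -/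

theorem Zh_neg (x : ℝ) : Zh (-x) = -Zh x := by
  simp only [Zh, H_neg, sx_neg, ζ_neg]; ring

theorem Up_neg (x : ℝ) : Up (-x) = Up x := by
  rw [Up_eq, Up_eq, ζ_neg, tl_neg, H_neg, sx_neg]; ring

theorem exists_Z₁_eq : ∃ A : ℝ, A ≠ 0 ∧ ∀ x, Z₁ x = A * Zh x := by
  refine ⟨(2 : ℝ) ^ (-(3 / 4) : ℝ) * √3, by positivity, fun x => ?_⟩
  have hc := Real.cosh_pos (x / (lam * √2))
  simp only [Z₁, Y₁, Zh, H, sx, ζ, sech]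
  field_simp

/-- The half-line estimate is applied on each side, which doubles 41/2000. -/
theorem odd_coercive {w wx : ℝ → ℝ} (h : IsH1 w wx) (hodd : ∀ᵐ x : ℝ, w (-x) = -w x)
    (hZ : pair w Z₁ = 0) (γ : ℝ) :
    0 ≤ (∫ x, (wx x ^ 2 - Up x * w x ^ 2)) + 2 * γ * (∫ x, w x * (ζ x * fh x)) +
      41 / 1000 * γ ^ 2 := by
  obtain ⟨hw, hWodd⟩ := h.ae_eq_of_odd hodd
  set W : ℝ → ℝ := fun x => ∫ z in (0 : ℝ)..x, wx z with hW
  have hWn : ∀ x, W (-x) = -W x := hWodd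
  have hW2 : MemLp W 2 := h.memLp.ae_eq hw
  have hv' : MemLp (fun x => wx (-x)) 2 :=
    h.memLp_deriv.comp_measurePreserving (Measure.measurePreserving_neg volume)
  have hW' : W = fun x => ∫ z in (0 : ℝ)..x, wx (-z) := by
    funext x
    -- Because W is odd, it is also the primitive of x ↦ wx(−x). The negative half-line is thus
    -- covered by the same estimate, without establishing that wx is even.
    rw [intervalIntegral.integral_comp_neg, neg_zero, intervalIntegral.integral_symm]
    have := hWn x
    simp only [hW] at this ⊢
    rw [this, neg_neg]
  have hZ' : ∫ x in Set.Ioi 0, W x * Zh x = 0 := by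
    obtain ⟨A, hA, hZA⟩ := exists_Z₁_eq
    have e : pair w Z₁ = A * (2 * ∫ x in Set.Ioi 0, W x * Zh x) := by
      rw [← integral_of_even fun x => by rw [hWn, Zh_neg]; ring, ← integral_const_mul, pair]
      refine integral_congr_ae ?_
      filter_upwards [hw] with x hx
      rw [hx, hZA]; ring
    rw [e] at hZ
    have := (mul_eq_zero.1 hZ).resolve_left hA
    linarith
  have p := half_line_coercive h.memLp_deriv hW hW2 hZ' γ
  have n := half_line_coercive hv' hW' hW2 hZ' γ
  have i0 : Integrable fun x => wx x ^ 2 - Up x * W x ^ 2 :=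
    h.memLp_deriv.integrable_sq.sub (integrable_Up_mul_sq hW2)
  have e1 : ∫ x in Set.Ioi 0, (wx (-x) ^ 2 - Up x * W x ^ 2) =
      ∫ x in Set.Iic 0, (wx x ^ 2 - Up x * W x ^ 2) := by
    have := integral_comp_neg_Ioi 0 fun x => wx x ^ 2 - Up x * W x ^ 2
    rw [neg_zero] at this
    rw [← this]
    congr 1; funext x
    rw [Up_neg, hWn]; ring
  have e2 : (∫ x, (wx x ^ 2 - Up x * w x ^ 2)) =
      (∫ x in Set.Iic 0, (wx x ^ 2 - Up x * W x ^ 2)) +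
        ∫ x in Set.Ioi 0, (wx x ^ 2 - Up x * W x ^ 2) := by
    rw [intervalIntegral.integral_Iic_add_Ioi i0.integrableOn i0.integrableOn]
    refine integral_congr_ae ?_
    filter_upwards [hw] with x hx
    rw [hx]
  have e3 : ∫ x, w x * (ζ x * fh x) = 2 * ∫ x in Set.Ioi 0, W x * (ζ x * fh x) := by
    rw [← integral_of_even fun x => by rw [hWn, ζ_neg, fh_neg]; ring]
    refine integral_congr_ae ?_
    filter_upwards [hw] with x hx
    rw [hx]
  rw [e1] at n
  rw [e2, e3]
  linarith

/-! ### The equation for the corrector and the main estimate -/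

theorem four_mul_μ_sq : 4 * μ ^ 2 = 6 := by
  rw [μ, Real.sq_sqrt (by norm_num)]; norm_num

/-- From −1 + 3H² − 6 = −4 − 3 sech². -/
theorem L_sub (g : ℝ → ℝ) (x : ℝ) :
    L g x - 4 * μ ^ 2 * g x = -deriv (deriv g) x - (4 + 3 * sx x ^ 2) * g x := by
  rw [four_mul_μ_sq, L, sx_sq]; ring

theorem rhs_eq (x : ℝ) : ψ x * deriv f x + (a + 1 / 2) * deriv ψ x * f x =
    9 * √2 / 8 * src x := by
  rw [deriv_ψ, deriv_f, f_eq, src, srcN, srcD]; ring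

theorem solvesG_iff (g : ℝ → ℝ) : SolvesG g ↔
    ∀ x, -deriv (deriv g) x - (4 + 3 * sx x ^ 2) * g x = 9 * √2 / 8 * src x := by
  simp only [SolvesG, L_sub, rhs_eq]

theorem Dsharp_eq {g : ℝ → ℝ} (hg : SolvesG g) (w wx : ℝ → ℝ) (α : ℝ) :
    Dsharp g w wx α = Bsharp w wx + α * a * (9 * √2 / 8) * (∫ x, w x * (ζ x * fh x)) +
      α ^ 2 * (∫ x, f x * g x) := by
  have e : ∀ x, w x * (1 / ζ x) *
      (ψ x * deriv f x + 1 / 2 * deriv ψ x * f x - L g x + 4 * μ ^ 2 * g x) =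
      -(a * (9 * √2 / 8)) * (w x * (ζ x * fh x)) := by
    intro x
    have h := hg x
    have hz := ζ_pos x
    have e : ψ x * deriv f x + 1 / 2 * deriv ψ x * f x - L g x + 4 * μ ^ 2 * g x =
        -(a * (deriv ψ x * f x)) := by linear_combination -h
    rw [e, deriv_ψ, f_eq]
    field_simp
  rw [Dsharp]
  simp only [e]
  rw [integral_const_mul]
  ring

/-- The form 𝓑♯ is 50/51 of the form with potential 1.02V plus 1/51 of ∫w_x². The loss in α² is at
most (50/51)·0.041·0.51²·(81/32)·0.702² ≈ 0.01304, against 0.0145 from ⟨f, g⟩; both surpluses exceed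
1/1000. -/
theorem le_Dsharp {g : 𝓢(ℝ, ℝ)} (hg : SolvesG g) (hm : 29 / 2000 ≤ ∫ x, f x * g x)
    {w wx : ℝ → ℝ} (h : IsH1 w wx) (hodd : ∀ᵐ x : ℝ, w (-x) = -w x)
    (hZ : pair w Z₁ = 0) (α : ℝ) :
    1 / 1000 * (α ^ 2 + ∫ x, wx x ^ 2) ≤ Dsharp g w wx α := by
  rw [Dsharp_eq hg]
  have hs := sq2
  have ha := a_bounds
  -- This γ satisfies (50/51)·2γ = αa·9√2/8, the coefficient of the cross term in 𝓓♯.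
  have hc := odd_coercive h hodd hZ (51 / 100 * a * (α * (9 * √2 / 8)))
  have i1 := h.memLp_deriv.integrable_sq
  have i2 : Integrable fun x => V x * w x ^ 2 :=
    ((integrable_Up_mul_sq h.memLp).const_mul (50 / 51)).congr
      (Eventually.of_forall fun x => by simp only [Up]; ring)
  have e1 : ∫ x, (wx x ^ 2 - Up x * w x ^ 2) =
      (∫ x, wx x ^ 2) - 51 / 50 * ∫ x, V x * w x ^ 2 := by
    rw [← integral_const_mul, ← integral_sub i1 (i2.const_mul _)]
    congr 1; funext x; rw [Up]; ring
  have e2 : Bsharp w wx = (∫ x, wx x ^ 2) - ∫ x, V x * w x ^ 2 := integral_sub i1 i2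
  have hp : 0 ≤ ∫ x, wx x ^ 2 := integral_nonneg fun x => sq_nonneg _
  have ha2 : a ^ 2 ≤ (702 / 1000) ^ 2 := by nlinarith
  have h1 := mul_le_mul_of_nonneg_right ha2 (sq_nonneg α)
  have h2 := mul_le_mul_of_nonneg_left hm (sq_nonneg α)
  have e3 : (51 / 100 * a * (α * (9 * √2 / 8))) ^ 2 =
      (51 / 100) ^ 2 * (81 / 32) * (a ^ 2 * α ^ 2) := by
    linear_combination ((51 / 100) ^ 2 * (81 / 64) * (a ^ 2 * α ^ 2)) * hs
  rw [e1, e3] at hc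
  rw [e2]
  have hα := sq_nonneg α
  nlinarith

end Phi4Kink

theorem lemma4p3 :
    Phi4Kink.pair (fun x => deriv Phi4Kink.ψ x * Phi4Kink.f x) Phi4Kink.imk ≠ 0 ∧
    ∃ g : 𝓢(ℝ, ℝ), Phi4Kink.SolvesG g ∧
      (∀ g' : 𝓢(ℝ, ℝ), Phi4Kink.SolvesG g' → g' = g) ∧
      ∃ κ : ℝ, 0 < κ ∧
        ∀ w wx : ℝ → ℝ, Phi4Kink.IsH1 w wx →
          (∀ᵐ x : ℝ, w (-x) = -w x) →
          Phi4Kink.pair w Phi4Kink.Z₁ = 0 →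
          ∀ α : ℝ,
            κ * (α ^ 2 + ∫ x, wx x ^ 2) ≤ Phi4Kink.Dsharp g w wx α := by
  refine ⟨Phi4Kink.pair_D_ne_zero, ?_⟩
  obtain ⟨F, hF⟩ := Phi4Kink.exists_schwartz_src
  obtain ⟨G, hG⟩ := Phi4Kink.exists_ghat
  have hs := Phi4Kink.sq2
  obtain ⟨g, hg⟩ : ∃ g : 𝓢(ℝ, ℝ), ⇑g = fun x => 9 * √2 / 8 * G x :=
    ⟨(9 * √2 / 8 : ℝ) • G, rfl⟩
  have hsol : Phi4Kink.SolvesG g := by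
    rw [Phi4Kink.solvesG_iff]
    intro x
    have h1 : deriv (fun x => 9 * √2 / 8 * G x) = fun x => 9 * √2 / 8 * deriv G x :=
      funext fun x => ((G.hasDerivAt x).const_mul _).deriv
    have h2 : deriv (fun x => 9 * √2 / 8 * deriv G x) x = 9 * √2 / 8 * deriv (deriv G) x :=
      deriv_const_mul_field _
    rw [hg, h1, h2, ← hG]
    ring
  -- Both f and g carry the factor 9√2/8, whose square is 81/32, and 81/32·0.0058 exceeds 0.0145.
  have hm : 29 / 2000 ≤ ∫ x, Phi4Kink.f x * g x := by
    have h := Phi4Kink.integral_fh_mul_ghat hG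
    have e : ∀ x, Phi4Kink.f x * g x =
        81 / 32 * (Phi4Kink.fh x * G x) := by
      intro x
      rw [hg, Phi4Kink.f_eq]
      linear_combination (81 / 64 * (Phi4Kink.fh x * G x)) * hs
    simp only [e]
    rw [integral_const_mul]
    linarith
  refine ⟨g, hsol, fun g' hg' => ?_, 1 / 1000, by norm_num,
    fun w wx h hodd hZ α => Phi4Kink.le_Dsharp hsol hm h hodd hZ α⟩
  have hi : Integrable Phi4Kink.src := by rw [← hF]; exact F.integrable
  exact Phi4Kink.schwartz_sol_unique (hi.const_mul (9 * √2 / 8))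
    ((Phi4Kink.solvesG_iff _).1 hsol) ((Phi4Kink.solvesG_iff _).1 hg')
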